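/- Let $T>0$ and let $V:[0,T]\times\mathbb R\to\mathbb R$ be a measurable potential with $$V\in W^{2,\infty}([0,T];L^\infty(\mathbb R))\cap L^\infty([0,T];W^{4,\infty}(\mathbb R)),$$ and let $\Phi_0\in (L^2(\mathbb R))^2$. For $\varepsilon\in(0,1]$ put $\mathcal T^\varepsilon=-i\varepsilon\sigma_1\partial_x+\sigma_3$, with the Pauli matrices $\sigma_1=\begin{pmatrix}0&1\\1&0\end{pmatrix}$ and $\sigma_3=\begin{pmatrix}1&0\\0&-1\end{pmatrix}$. Let $\Phi=\Phi^\varepsilon\in C([0,T];(L^2(\mathbb R))^2)$ be the (weak) solution of the one-dimensional Dirac equation $$i\partial_t\Phi(t,x)=\frac1{\varepsilon^2}\mathcal T^\varepsilon\Phi(t,x)+V(t,x)\Phi(t,x),\qquad \Phi(0,x)=\Phi_0(x),$$ and assume that $\Phi\in L^\infty([0,T];(H^4(\mathbb R))^2)$. For a time step $\tau>0$ let $t_n=n\tau$ and let $\Phi^n$ be given by the Strang splitting $S_2$: $\Phi^0=\Phi_0$ and $$\Phi^{n+1}=e^{-\frac{i\tau}{2\varepsilon^2}\mathcal T^\varepsilon}\,e^{-i\int_{t_n}^{t_{n+1}}V(s,x)\,ds}\,e^{-\frac{i\tau}{2\varepsilon^2}\mathcal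 T^\varepsilon}\Phi^n .$$ Let $e^n=\Phi(t_n,\cdot)-\Phi^n$. Then there is a constant $C>0$, which may depend on $T$, $V$ and $\Phi_0$ but not on $\varepsilon$, $\tau$ or $n$, such that for all $\varepsilon\in(0,1]$, all $\tau>0$ and all integers $n$ with $0\le n\le T/\tau$, $$\|e^n\|_{L^2}\le C(\tau^2+\varepsilon),\qquad \|e^n\|_{L^2}\le C\Big(\tau^2+\frac{\tau^2}{\varepsilon^3}\Big).$$ As a result, there is an error bound that is uniform in $\varepsilon\in(0,1]$: $$\|e^n\|_{L^2}\le C\Big(\tau^2+\max_{0<\delta\le1}\min\{\delta,\tau^2/\delta^3\}\Big),\qquad \|e^n\|_{L^2}\le C\sqrt\tau,$$ where, for $\tau\le T$, also $\tau^2+\max_{0<\delta\le1}\min\{\delta,\tau^2/\delta^3\}\le C\sqrt\tau$. -/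

import Mathlib

open MeasureTheory Set
open scoped FourierTransform ContDiff ENNReal

noncomputable section

namespace Dirac

/-- The values of the wave function: `ℂ²` with its Hermitian norm. -/
abbrev Spinor : Type := EuclideanSpace ℂ (Fin 2)

/-- The space `(L²(ℝ))²`, with `‖f‖² = ∫ |f₁|² + |f₂|²`. -/
abbrev SpinorL2 : Type := Lp Spinor 2 (volume : Measure ℝ)

/-- The Pauli matrix `σ₁`. -/
def pauli₁ : Matrix (Fin 2) (Fin 2) ℂ := !![0, 1; 1, 0]

/-- The Pauli matrix `σ₃`. -/
def pauli₃ : Matrix (Fin 2) (Fin 2) ℂ := !![1, 0; 0, -1]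

/-- A `2 × 2` matrix acting on a spinor. -/
def act (A : Matrix (Fin 2) (Fin 2) ℂ) (v : Spinor) : Spinor :=
  WithLp.toLp 2 (A.mulVec v.ofLp)

/-- Test functions: elements of `C_c^∞(ℝ)`. -/
def IsTest (χ : ℝ → ℝ) : Prop := ContDiff ℝ ∞ χ ∧ HasCompactSupport χ

/-! ### The free evolution -/

/-- The Fourier symbol of `𝒯^ε = -i ε σ₁ ∂ₓ + σ₃`, with the normalisation
`𝓕 f ξ = ∫ e^{-2πi x ξ} f x dx`, for which `∂ₓ` has the symbol `2πi ξ`. -/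
def symbol (ε ξ : ℝ) : Matrix (Fin 2) (Fin 2) ℂ :=
  ((2 * Real.pi * ε * ξ : ℝ) : ℂ) • pauli₁ + pauli₃

/-- The Fourier symbol of `e^{-i s 𝒯^ε}`: the matrix exponential `e^{-i s 𝒯^ε(ξ)}`. -/
def flowSymbol (ε s ξ : ℝ) : Matrix (Fin 2) (Fin 2) ℂ :=
  NormedSpace.exp ((-(Complex.I * (s : ℂ))) • symbol ε ξ)

theorem symbol_isHermitian (ε ξ : ℝ) : (symbol ε ξ).IsHermitian := by
  ext i j
  fin_cases i <;> fin_cases j <;> simp [symbol, pauli₁, pauli₃]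

theorem flowSymbol_mem_unitary (ε s ξ : ℝ) :
    flowSymbol ε s ξ ∈ unitary (Matrix (Fin 2) (Fin 2) ℂ) := by
  have h : star (flowSymbol ε s ξ) =
      NormedSpace.exp (-((-(Complex.I * (s : ℂ))) • symbol ε ξ)) := by
    rw [flowSymbol, Matrix.star_eq_conjTranspose, ← Matrix.exp_conjTranspose,
      Matrix.conjTranspose_smul, (symbol_isHermitian ε ξ).eq]
    congr 1
    simp
  rw [Unitary.mem_iff, h, flowSymbol]
  generalize (-(Complex.I * (s : ℂ))) • symbol ε ξ = A
  have h₁ : Commute (-A) A := Commute.neg_left (Commute.refl A)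
  constructor
  · rw [← Matrix.exp_add_of_commute _ _ h₁]
    simp
  · rw [← Matrix.exp_add_of_commute _ _ h₁.symm]
    simp

theorem continuous_flowSymbol (ε s : ℝ) : Continuous (flowSymbol ε s) := by
  let _ : NormedRing (Matrix (Fin 2) (Fin 2) ℂ) := Matrix.linftyOpNormedRing
  let _ : NormedAlgebra ℂ (Matrix (Fin 2) (Fin 2) ℂ) := Matrix.linftyOpNormedAlgebra
  let _ : NormedAlgebra ℚ (Matrix (Fin 2) (Fin 2) ℂ) := NormedAlgebra.restrictScalars ℚ ℂ _
  have h : Continuous fun ξ : ℝ => (-(Complex.I * (s : ℂ))) • symbol ε ξ := by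
    unfold symbol
    fun_prop
  exact NormedSpace.exp_continuous.comp h

theorem norm_act_flowSymbol (ε s ξ : ℝ) (v : Spinor) : ‖act (flowSymbol ε s ξ) v‖ = ‖v‖ := by
  have h := flowSymbol_mem_unitary ε s ξ
  have h' : Matrix.toEuclideanCLM (n := Fin 2) (𝕜 := ℂ) (flowSymbol ε s ξ) ∈
      unitary (Spinor →L[ℂ] Spinor) := Unitary.map_mem _ h
  exact ContinuousLinearMap.norm_map_of_mem_unitary h' v

theorem continuous_act_flowSymbol (ε s : ℝ) :
    Continuous fun p : ℝ × Spinor => act (flowSymbol ε s p.1) p.2 := by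
  have h₁ := continuous_flowSymbol ε s
  unfold act
  fun_prop

theorem memLp_flowSymbol (ε s : ℝ) (f : SpinorL2) :
    MemLp (fun ξ => act (flowSymbol ε s ξ) (f ξ)) 2 volume := by
  have h₁ : AEStronglyMeasurable (fun ξ : ℝ => ξ) volume := continuous_id.aestronglyMeasurable
  have h₂ : AEStronglyMeasurable (fun ξ : ℝ => (ξ, f ξ)) volume :=
    h₁.prodMk (Lp.aestronglyMeasurable f)
  have h₃ := (continuous_act_flowSymbol ε s).comp_aestronglyMeasurable h₂
  refine MemLp.of_le (Lp.memLp f) h₃ ?_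
  exact Filter.Eventually.of_forall fun ξ => (norm_act_flowSymbol ε s ξ (f ξ)).le

/-- The unitary group `e^{-i s 𝒯^ε}` on `(L²(ℝ))²`, as a Fourier multiplier. -/
def freeFlow (ε s : ℝ) (f : SpinorL2) : SpinorL2 :=
  𝓕⁻ ((memLp_flowSymbol ε s (𝓕 f)).toLp _)

/-! ### The evolution under the potential and the Strang splitting -/

theorem memLp_potentialFlow {V : ℝ → ℝ → ℝ} (hV : Measurable (Function.uncurry V)) (a b : ℝ)
    (f : SpinorL2) :
    MemLp (fun x => Complex.exp (-(Complex.I * ((∫ s in a..b, V s x : ℝ) : ℂ))) • f x) 2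
      volume := by
  have h1 : Measurable fun x => ∫ s in a..b, V s x := by
    unfold intervalIntegral
    have h2 : StronglyMeasurable (fun p : ℝ × ℝ => V p.2 p.1) :=
      (hV.comp measurable_swap).stronglyMeasurable
    exact (h2.integral_prod_right' (ν := volume.restrict (Ioc a b))).measurable.sub
      (h2.integral_prod_right' (ν := volume.restrict (Ioc b a))).measurable
  have h3 : Measurable fun x => Complex.exp (-(Complex.I * ((∫ s in a..b, V s x : ℝ) : ℂ))) := by
    fun_prop
  refine (Lp.memLp f).of_le (h3.aestronglyMeasurable.smul (Lp.aestronglyMeasurable f)) ?_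
  refine Filter.Eventually.of_forall fun x => ?_
  rw [norm_smul, Complex.norm_exp]
  simp

/-- Multiplication by `e^{-i ∫_a^b V(s, x) ds}` on `(L²(ℝ))²`. -/
def potentialFlow {V : ℝ → ℝ → ℝ} (hV : Measurable (Function.uncurry V)) (a b : ℝ)
    (f : SpinorL2) : SpinorL2 :=
  (memLp_potentialFlow hV a b f).toLp _

/-- The approximations `Φⁿ` of the Strang splitting `S₂` with step `τ` and initial value `Φ₀`:
`Φⁿ⁺¹ = e^{-iτ𝒯^ε/(2ε²)} e^{-i∫_{nτ}^{(n+1)τ} V(s,x) ds} e^{-iτ𝒯^ε/(2ε²)} Φⁿ`. -/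
def strang {V : ℝ → ℝ → ℝ} (hV : Measurable (Function.uncurry V)) (ε τ : ℝ) (Φ₀ : SpinorL2) :
    ℕ → SpinorL2
  | 0 => Φ₀
  | n + 1 => freeFlow ε (τ / (2 * ε ^ 2))
      (potentialFlow hV (n * τ) ((n + 1) * τ)
        (freeFlow ε (τ / (2 * ε ^ 2)) (strang hV ε τ Φ₀ n)))

/-! ### The exact solution -/

/-- `Φ ∈ C([0,T]; (L²(ℝ))²)` is a weak solution of
`i ∂ₜΦ = ε⁻² 𝒯^ε Φ + V Φ = -(i/ε) σ₁ ∂ₓΦ + ε⁻² σ₃ Φ + V Φ` on `[0,T] × ℝ`: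
tested against `χ ∈ C_c^∞(ℝ)` in space, and integrated over `[0,t]` in time. -/
def IsSolution (ε T : ℝ) (V : ℝ → ℝ → ℝ) (Φ : ℝ → SpinorL2) : Prop :=
  ContinuousOn Φ (Icc 0 T) ∧
  ∀ χ : ℝ → ℝ, IsTest χ → ∀ t ∈ Icc 0 T,
    Complex.I • ((∫ x, χ x • Φ t x) - ∫ x, χ x • Φ 0 x) =
      ∫ s in (0 : ℝ)..t, ∫ x,
        ((Complex.I / (ε : ℂ)) • (deriv χ x • act pauli₁ (Φ s x)) +
          χ x • ((1 / ε ^ 2) • act pauli₃ (Φ s x) + V s x • Φ s x))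

/-! ### The regularity assumptions -/

/-- `g` is the `k`-th weak derivative of `f` on `ℝ`. -/
def IsWeakDeriv (k : ℕ) (f g : ℝ → ℝ) : Prop :=
  LocallyIntegrable f ∧ LocallyIntegrable g ∧
  ∀ χ : ℝ → ℝ, IsTest χ →
    ∫ x, iteratedDeriv k χ x * f x = (-1) ^ k * ∫ x, χ x * g x

/-- `V ∈ L^∞([0,T]; L^∞(ℝ))`, for functions on `[0,T] × ℝ`. -/
def MemLinfty (T : ℝ) (V : ℝ → ℝ → ℝ) : Prop :=
  MemLp (Function.uncurry V) ∞ (volume.restrict (Icc 0 T ×ˢ (univ : Set ℝ)))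

/-- `V ∈ W^{m,∞}([0,T]; L^∞(ℝ))`: the weak time derivatives up to order `m` lie in
`L^∞([0,T]; L^∞(ℝ))`. -/
def MemTimeSobolev (T : ℝ) (m : ℕ) (V : ℝ → ℝ → ℝ) : Prop :=
  MemLinfty T V ∧
  ∀ k ≤ m, ∃ W : ℝ → ℝ → ℝ, MemLinfty T W ∧
    ∀ θ : ℝ → ℝ, IsTest θ → tsupport θ ⊆ Ioo 0 T →
      ∀ᵐ x, ∫ t in (0 : ℝ)..T, iteratedDeriv k θ t * V t x =
        (-1) ^ k * ∫ t in (0 : ℝ)..T, θ t * W t x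

/-- `V ∈ L^∞([0,T]; W^{l,∞}(ℝ))`: for a.e. `t ∈ [0,T]`, the weak derivatives of `V(t, ·)` up to
order `l` are essentially bounded, by a bound that does not depend on `t`. -/
def MemSpaceSobolev (T : ℝ) (l : ℕ) (V : ℝ → ℝ → ℝ) : Prop :=
  ∃ M : ℝ, ∀ᵐ t ∂volume.restrict (Icc 0 T), ∀ k ≤ l, ∃ W : ℝ → ℝ,
    IsWeakDeriv k (V t) W ∧ ∀ᵐ x, |W x| ≤ M

/-- Assumption (A): `V ∈ W^{m,∞}([0,T]; L^∞(ℝ)) ∩ L^∞([0,T]; W^{2m+m_*,∞}(ℝ))`. -/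
def AssumptionA (T : ℝ) (m mstar : ℕ) (V : ℝ → ℝ → ℝ) : Prop :=
  MemTimeSobolev T m V ∧ MemSpaceSobolev T (2 * m + mstar) V

/-- Assumption (B): `Φ ∈ L^∞([0,T]; (H^{2m+m_*}(ℝ))²)`, where the norm of `f` in `H^l` is the
`L²` norm of the Bessel potential `(1 - (2π)⁻² Δ)^{l/2} f`. -/
def AssumptionB (T : ℝ) (m mstar : ℕ) (Φ : ℝ → SpinorL2) : Prop :=
  ∃ M : ℝ, ∀ᵐ t ∂volume.restrict (Icc 0 T), ∃ g : SpinorL2,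
    TemperedDistribution.besselPotential ℝ Spinor ((2 * m + mstar : ℕ) : ℝ)
      (Lp.toTemperedDistribution (Φ t)) = Lp.toTemperedDistribution g ∧ ‖g‖ ≤ M

end Dirac

end

namespace Dirac

open Filter Topology

/-! Everything is done on the Fourier side and in the interaction picture. With `g(s) =
e^{-is𝒯/ε²}`, the function `ψ(t) = g(-t)Φ(t)` solves `ψ' = -iA(t)ψ`, where `A(t) = g(-t)V(t)g(t)`
(`IsSolution.interaction`), and one step of the splitting is multiplication by `e^{-i∫V}` conjugated
by `g` at the midpoint (`ft_strang_succ`). Expand both to second order. The quadratic terms agree up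
to `τ³` and `τ²` times the variation of the conjugates over a step. The linear terms differ by the
error of freezing the conjugation at the midpoint. So everything depends on how fast `r ↦
g(-r)Wg(r)` varies.

The symbol of `𝒯` is `λS` with `S² = 1` and `λ = √(1 + (2πεξ)²)`. Split `V` into the part that
commutes with `S` and the part that anticommutes with it. For the first part the fast phase
`e^{-irS/ε²}` drops out (`conj_free_diagPart`). What remains is the flow with frequency `(λ - 1)/ε²
= O(1 + ξ²)`, so its first and second differences are bounded uniformly in `ε`. The second part is
`O(ε)`, because `V` commutes with `σ₃` and `S - σ₃ = O(ε(1 + ξ²))` (`norm_offPart_apply_le`). Its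
first differences are `O(h/ε)` and its second differences `O(h²/ε³)`. Discarding the second part
costs `ε` and gives the first bound; treating it by quadrature costs `τ²/ε³` and gives the second.

The regularity of `V` in time and in space is assumed separately, so no mixed derivative is
available for a midpoint rule. Instead the conjugate of each fixed `V(s)` is interpolated linearly
in `r`. This leaves `τ⁻¹` times an increment of conjugates of the first moment of `V` about the
midpoint. That term is too large to be summed step by step, but it can be summed by parts:
consecutive moments differ by `O(τ⁴)` (`norm_moment_sub_le`, `norm_interaction_error_le`).

Two uniformity questions remain. Multiplication by `V` has to preserve the weighted spaces, which
follows from bounds on finite differences (`sobBdd_realOp`). The `H⁴` norm of `Φ` has to be bounded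
independently of `ε`, which a Gronwall argument in the interaction picture derives from `Φ₀` alone
(`IsSolution.sob_interaction`). Since `V` is regular in time only in the weak sense, it is replaced
by a Lipschitz family of operators obtained by mollification (`PotBound.exists_family`). -/

theorem norm_sq_eq_integral (f : SpinorL2) : ‖f‖ ^ 2 = ∫ x, ‖f x‖ ^ 2 := by
  have h := L2.inner_def (𝕜 := ℂ) f f
  simp_rw [inner_self_eq_norm_sq_to_K] at h
  exact_mod_cast h

/-! ### Multiplication operators on `(L²(ℝ))²` -/

/-- The bounded operator `A` is the multiplication by the operator-valued function `m`. -/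
def IsMul (A : SpinorL2 →L[ℂ] SpinorL2) (m : ℝ → Spinor →L[ℂ] Spinor) : Prop :=
  ∀ f : SpinorL2, ⇑(A f) =ᵐ[volume] fun x => m x (f x)

theorem exists_isMul {m : ℝ → Spinor →L[ℂ] Spinor} (hm : AEStronglyMeasurable m volume) {c : ℝ}
    (hc : ∀ᵐ x, ‖m x‖ ≤ c) : ∃ A, IsMul A m := by
  have h1 : ∀ f : SpinorL2, ∀ᵐ x, ‖m x (f x)‖ ≤ c * ‖f x‖ := fun f => by
    filter_upwards [hc] with x hx
    exact (m x).le_of_opNorm_le hx _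
  have h2 : ∀ f : SpinorL2, MemLp (fun x => m x (f x)) 2 volume := fun f => by
    refine MemLp.of_le_mul (c := c) (Lp.memLp f) ?_ (h1 f)
    exact (ContinuousLinearMap.apply ℂ Spinor).flip.aestronglyMeasurable_comp₂ hm
      (Lp.aestronglyMeasurable f)
  let A : SpinorL2 →ₗ[ℂ] SpinorL2 :=
    { toFun := fun f => (h2 f).toLp _
      map_add' := fun f g => by
        rw [← MemLp.toLp_add]
        apply MemLp.toLp_congr
        filter_upwards [Lp.coeFn_add f g] with x hx
        rw [hx, Pi.add_apply, map_add, Pi.add_apply]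
      map_smul' := fun a f => by
        rw [RingHom.id_apply, ← MemLp.toLp_const_smul]
        apply MemLp.toLp_congr
        filter_upwards [Lp.coeFn_smul a f] with x hx
        rw [hx, Pi.smul_apply, map_smul, Pi.smul_apply] }
  refine ⟨A.mkContinuous c fun f => ?_, fun f => (h2 f).coeFn_toLp⟩
  refine Lp.norm_le_mul_norm_of_ae_le_mul ?_
  filter_upwards [(h2 f).coeFn_toLp, h1 f] with x hx h1x
  change ‖((h2 f).toLp _ : SpinorL2) x‖ ≤ _
  rw [hx]
  exact h1x

open Classical in
/-- The multiplication by `m`, if this is a bounded operator. -/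
noncomputable def mulOp (m : ℝ → Spinor →L[ℂ] Spinor) : SpinorL2 →L[ℂ] SpinorL2 :=
  if h : ∃ A, IsMul A m then h.choose else 0

theorem isMul_mulOp {m : ℝ → Spinor →L[ℂ] Spinor} (hm : AEStronglyMeasurable m volume) {c : ℝ}
    (hc : ∀ᵐ x, ‖m x‖ ≤ c) : IsMul (mulOp m) m := by
  rw [mulOp, dif_pos (exists_isMul hm hc)]
  exact (exists_isMul hm hc).choose_spec

namespace IsMul

variable {A B : SpinorL2 →L[ℂ] SpinorL2} {m n : ℝ → Spinor →L[ℂ] Spinor}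

theorem congr (hA : IsMul A m) (h : ∀ᵐ x, m x = n x) : IsMul A n := fun f => by
  filter_upwards [hA f, h] with x hx h
  rw [hx, h]

theorem eq (hA : IsMul A m) (hB : IsMul B m) : A = B := by
  ext1 f
  exact Lp.ext ((hA f).trans (hB f).symm)

theorem one : IsMul 1 fun _ => 1 := fun f => by simp

theorem add (hA : IsMul A m) (hB : IsMul B n) : IsMul (A + B) fun x => m x + n x := fun f => by
  filter_upwards [hA f, hB f, Lp.coeFn_add (A f) (B f)] with x h1 h2 h3
  rw [add_apply, h3, Pi.add_apply, h1, h2, add_apply]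

theorem sub (hA : IsMul A m) (hB : IsMul B n) : IsMul (A - B) fun x => m x - n x := fun f => by
  filter_upwards [hA f, hB f, Lp.coeFn_sub (A f) (B f)] with x h1 h2 h3
  rw [sub_apply, h3, Pi.sub_apply, h1, h2, sub_apply]

theorem smul (c : ℂ) (hA : IsMul A m) : IsMul (c • A) fun x => c • m x := fun f => by
  filter_upwards [hA f, Lp.coeFn_smul c (A f)] with x h1 h3
  simp [h3, h1]

theorem mul (hA : IsMul A m) (hB : IsMul B n) : IsMul (A * B) fun x => m x * n x := fun f => by
  filter_upwards [hA (B f), hB f] with x h1 h2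
  simp [h1, h2]

theorem norm_apply_le (hA : IsMul A m) {c : ℝ} (hc : ∀ᵐ x, ∀ v, ‖m x v‖ ≤ c * ‖v‖) (f : SpinorL2) :
    ‖A f‖ ≤ c * ‖f‖ := by
  refine Lp.norm_le_mul_norm_of_ae_le_mul ?_
  filter_upwards [hA f, hc] with x hx hcx
  rw [hx]
  exact hcx _

theorem opNorm_le (hA : IsMul A m) {c : ℝ} (h0 : 0 ≤ c) (hc : ∀ᵐ x, ‖m x‖ ≤ c) : ‖A‖ ≤ c := by
  refine A.opNorm_le_bound h0 fun f => hA.norm_apply_le ?_ f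
  filter_upwards [hc] with x hx v using (m x).le_of_opNorm_le hx v

end IsMul

/-! ### Weighted spaces on the Fourier side -/

/-- The weight `1 + ξ²`. -/
def wt (ξ : ℝ) : ℝ := 1 + ξ ^ 2

theorem one_le_wt (ξ : ℝ) : 1 ≤ wt ξ := by
  unfold wt
  nlinarith [sq_nonneg ξ]

theorem wt_pos (ξ : ℝ) : 0 < wt ξ := zero_lt_one.trans_le (one_le_wt ξ)

theorem continuous_wt : Continuous wt := by
  unfold wt
  fun_prop

/-- The symbol `(1 + ξ²)^j`, cut off at `|ξ| ≤ R + 1`. -/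
noncomputable def cutSymbol (j R : ℕ) (ξ : ℝ) : ℝ :=
  indicator (Icc (-(R + 1 : ℝ)) (R + 1)) (fun ξ => wt ξ ^ j) ξ

theorem cutSymbol_nonneg (j R : ℕ) (ξ : ℝ) : 0 ≤ cutSymbol j R ξ :=
  indicator_nonneg (fun ξ _ => (pow_pos (wt_pos ξ) j).le) ξ

theorem measurable_cutSymbol (j R : ℕ) : Measurable (cutSymbol j R) :=
  ((continuous_wt.pow j).measurable).indicator measurableSet_Icc

theorem cutSymbol_le (j R : ℕ) (ξ : ℝ) : cutSymbol j R ξ ≤ wt (R + 1) ^ j := by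
  unfold cutSymbol
  by_cases h : ξ ∈ Icc (-(R + 1 : ℝ)) (R + 1)
  · rw [indicator_of_mem h]
    have : wt ξ ≤ wt (R + 1) := by
      unfold wt
      nlinarith [h.1, h.2]
    gcongr
    exact (wt_pos ξ).le
  · rw [indicator_of_notMem h]
    exact (pow_pos (wt_pos _) j).le

/-- Multiplication by a scalar function. -/
noncomputable abbrev scalOp (α : ℝ → ℂ) : SpinorL2 →L[ℂ] SpinorL2 :=
  mulOp fun x => α x • (1 : Spinor →L[ℂ] Spinor)

theorem norm_smul_one_le (z : ℂ) : ‖z • (1 : Spinor →L[ℂ] Spinor)‖ ≤ ‖z‖ := by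
  rw [norm_smul]
  exact mul_le_of_le_one_right (norm_nonneg z) ContinuousLinearMap.norm_id_le

theorem isMul_scalOp {α : ℝ → ℂ} (hα : AEStronglyMeasurable α volume) {c : ℝ}
    (hc : ∀ᵐ x, ‖α x‖ ≤ c) : IsMul (scalOp α) fun x => α x • (1 : Spinor →L[ℂ] Spinor) := by
  refine isMul_mulOp (c := c) (hα.smul aestronglyMeasurable_const) ?_
  filter_upwards [hc] with x hx using (norm_smul_one_le _).trans hx

/-- The multiplication by the weight `(1 + ξ²)^j`, cut off at `|ξ| ≤ R + 1`. -/
noncomputable def cut (j R : ℕ) : SpinorL2 →L[ℂ] SpinorL2 := scalOp fun ξ => (cutSymbol j R ξ : ℂ)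

theorem isMul_cut (j R : ℕ) :
    IsMul (cut j R) fun ξ => (cutSymbol j R ξ : ℂ) • (1 : Spinor →L[ℂ] Spinor) := by
  refine isMul_scalOp (c := wt (R + 1) ^ j) ?_ (Eventually.of_forall fun ξ => ?_)
  · exact (Complex.measurable_ofReal.comp (measurable_cutSymbol j R)).aestronglyMeasurable
  · rw [Complex.norm_real, Real.norm_of_nonneg (cutSymbol_nonneg j R ξ)]
    exact cutSymbol_le j R ξ

theorem cut_ae (j R : ℕ) (f : SpinorL2) :
    ∀ᵐ ξ, ‖cut j R f ξ‖ = cutSymbol j R ξ * ‖f ξ‖ := by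
  filter_upwards [isMul_cut j R f] with ξ hξ
  rw [hξ]
  simp [norm_smul, abs_of_nonneg (cutSymbol_nonneg j R ξ)]

/-- `‖(1 + ξ²)^j f‖ ≤ c` in `L²`. -/
def Sob (j : ℕ) (c : ℝ) (f : SpinorL2) : Prop := ∀ R : ℕ, ‖cut j R f‖ ≤ c

namespace Sob

variable {j p : ℕ} {a b c N : ℝ} {f g : SpinorL2}

theorem nonneg (h : Sob j c f) : 0 ≤ c := (norm_nonneg _).trans (h 0)

theorem mono (h : Sob j a f) (hab : a ≤ b) : Sob j b f := fun R => (h R).trans hab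

theorem add (hf : Sob j a f) (hg : Sob j b g) : Sob j (a + b) (f + g) := fun R => by
  rw [map_add]
  exact (norm_add_le _ _).trans (add_le_add (hf R) (hg R))

theorem sub (hf : Sob j a f) (hg : Sob j b g) : Sob j (a + b) (f - g) := fun R => by
  rw [map_sub]
  exact (norm_sub_le _ _).trans (add_le_add (hf R) (hg R))

theorem smul (z : ℂ) (hf : Sob j a f) : Sob j (‖z‖ * a) (z • f) := fun R => by
  rw [map_smul, norm_smul]
  exact mul_le_mul_of_nonneg_left (hf R) (norm_nonneg z)

/-- Both weights use the same cut-off interval, so they factor exactly, and a multiplier of order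
`p` in the weight trades `p` orders of regularity for its constant. -/
theorem isMul {A : SpinorL2 →L[ℂ] SpinorL2} {m : ℝ → Spinor →L[ℂ] Spinor} (hA : IsMul A m)
    (hc0 : 0 ≤ c) (hc : ∀ ξ v, ‖m ξ v‖ ≤ c * wt ξ ^ p * ‖v‖) (hf : Sob (j + p) N f) :
    Sob j (c * N) (A f) := fun R => by
  refine le_trans ?_ (mul_le_mul_of_nonneg_left (hf R) hc0)
  refine Lp.norm_le_mul_norm_of_ae_le_mul ?_
  filter_upwards [hA f, cut_ae j R (A f), cut_ae (j + p) R f] with ξ h1 h2 h3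
  rw [h2, h3, h1]
  have h4 : cutSymbol (j + p) R ξ = cutSymbol j R ξ * wt ξ ^ p := by
    unfold cutSymbol indicator
    split_ifs
    · simp only [pow_add]
    · simp
  rw [h4]
  calc cutSymbol j R ξ * ‖m ξ (f ξ)‖ ≤ cutSymbol j R ξ * (c * wt ξ ^ p * ‖f ξ‖) :=
        mul_le_mul_of_nonneg_left (hc ξ _) (cutSymbol_nonneg j R ξ)
    _ = _ := by ring

theorem isMul_same {A : SpinorL2 →L[ℂ] SpinorL2} {m : ℝ → Spinor →L[ℂ] Spinor} (hA : IsMul A m)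
    (hc0 : 0 ≤ c) (hc : ∀ ξ v, ‖m ξ v‖ ≤ c * ‖v‖) (hf : Sob j N f) :
    Sob j (c * N) (A f) :=
  isMul (p := 0) hA hc0 (by simpa using hc) hf

theorem of_le {i : ℕ} (hij : j ≤ i) (hf : Sob i N f) : Sob j N f := by
  obtain ⟨p, rfl⟩ := Nat.exists_eq_add_of_le hij
  have := isMul (c := 1) (p := p) IsMul.one zero_le_one (fun ξ v => ?_) hf
  · simpa using this
  · rw [one_mul]
    exact le_mul_of_one_le_left (norm_nonneg _) (one_le_pow₀ (one_le_wt ξ))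

theorem of_norm_le (h : ‖f‖ ≤ N) : Sob 0 N f := fun R => by
  refine le_trans ?_ h
  refine Lp.norm_le_norm_of_ae_le ?_
  filter_upwards [cut_ae 0 R f] with ξ h1
  rw [h1]
  refine mul_le_of_le_one_left (norm_nonneg _) ?_
  simpa using cutSymbol_le 0 R ξ

/-- Dominated convergence: at each frequency the cut-off is eventually `1`. This recovers norms and
identities from their truncations. -/
theorem tendsto_cut_zero (f : SpinorL2) : Tendsto (fun R => cut 0 R f) atTop (𝓝 f) := by
  have h : ∀ᵐ ξ, ∀ R, (cut 0 R f - f : SpinorL2) ξ = (cutSymbol 0 R ξ : ℂ) • f ξ - f ξ :=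
    ae_all_iff.2 fun R => by
      filter_upwards [isMul_cut 0 R f, Lp.coeFn_sub (cut 0 R f) f] with ξ h1 h2
      rw [h2, Pi.sub_apply, h1]
      rfl
  rw [tendsto_iff_norm_sub_tendsto_zero]
  have h2 : Tendsto (fun R => ‖cut 0 R f - f‖ ^ 2) atTop (𝓝 0) := by
    simp_rw [norm_sq_eq_integral]
    rw [← integral_zero ℝ ℝ]
    refine tendsto_integral_of_dominated_convergence (fun ξ => ‖f ξ‖ ^ 2) (fun R => ?_)
      ((memLp_two_iff_integrable_sq_norm (Lp.aestronglyMeasurable f)).1 (Lp.memLp f))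
      (fun R => ?_) ?_
    · exact (Lp.aestronglyMeasurable _).norm.pow 2
    · filter_upwards [h] with ξ hξ
      rw [hξ R, norm_pow, norm_norm]
      gcongr
      unfold cutSymbol indicator
      split_ifs <;> simp
    · filter_upwards [h] with ξ hξ
      refine tendsto_const_nhds.congr' ?_
      obtain ⟨R₀, hR₀⟩ := exists_nat_ge |ξ|
      filter_upwards [eventually_ge_atTop R₀] with R hR
      have : (R₀ : ℝ) ≤ R := by exact_mod_cast hR
      rw [hξ R, cutSymbol, indicator_of_mem]
      · simp
      · constructor <;> linarith [abs_le.1 hR₀]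
  simpa using h2.sqrt

theorem norm_le (h : Sob 0 N f) : ‖f‖ ≤ N :=
  le_of_tendsto (tendsto_cut_zero f).norm (Eventually.of_forall h)

theorem norm_le' (h : Sob j N f) : ‖f‖ ≤ N := (h.of_le j.zero_le).norm_le

/-- Each truncation is continuous. Closedness is what extends a regularity bound from almost every
time to every time. -/
theorem isClosed (j : ℕ) (c : ℝ) : IsClosed {f | Sob j c f} := by
  have : {f | Sob j c f} = ⋂ R, {f | ‖cut j R f‖ ≤ c} := by
    ext f
    simp [Sob]
  rw [this]
  exact isClosed_iInter fun R => isClosed_le (by fun_prop) continuous_const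

theorem intervalIntegral {u : ℝ → SpinorL2} {c : ℝ → ℝ} {s t : ℝ} (hst : s ≤ t)
    (hu : IntervalIntegrable u volume s t) (hc : IntervalIntegrable c volume s t)
    (h : ∀ r ∈ Ioc s t, Sob j (c r) (u r)) :
    Sob j (∫ r in s..t, c r) (∫ r in s..t, u r) := fun R => by
  rw [← ContinuousLinearMap.intervalIntegral_comp_comm _ hu]
  exact intervalIntegral.norm_integral_le_of_norm_le hst
    (Eventually.of_forall fun r hr => h r hr R) hc

end Sob


/-! ### The symbol of the Dirac operator -/

/-- A `2 × 2` matrix as an operator on spinors. -/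
noncomputable abbrev toOp (A : Matrix (Fin 2) (Fin 2) ℂ) : Spinor →L[ℂ] Spinor :=
  Matrix.toEuclideanCLM (n := Fin 2) (𝕜 := ℂ) A

theorem toOp_apply (A : Matrix (Fin 2) (Fin 2) ℂ) (v : Spinor) : toOp A v = act A v := rfl

theorem norm_toOp_pauli₁ (v : Spinor) : ‖toOp pauli₁ v‖ = ‖v‖ := by
  simp [EuclideanSpace.norm_eq, pauli₁, Matrix.mulVec, dotProduct,
    Fin.sum_univ_two, add_comm]

theorem norm_toOp_pauli₃ (v : Spinor) : ‖toOp pauli₃ v‖ = ‖v‖ := by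
  simp [EuclideanSpace.norm_eq, pauli₃, Matrix.mulVec, dotProduct,
    Fin.sum_univ_two]

/-- The positive eigenvalue `√(1 + ε²|2πξ|²)` of the symbol. -/
noncomputable def lam (ε ξ : ℝ) : ℝ := √(1 + (2 * Real.pi * ε * ξ) ^ 2)

theorem one_le_lam (ε ξ : ℝ) : 1 ≤ lam ε ξ := by
  rw [lam, Real.one_le_sqrt]
  nlinarith [sq_nonneg (2 * Real.pi * ε * ξ)]

theorem lam_pos (ε ξ : ℝ) : 0 < lam ε ξ := zero_lt_one.trans_le (one_le_lam ε ξ)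

theorem lam_sq (ε ξ : ℝ) : lam ε ξ ^ 2 = 1 + (2 * Real.pi * ε * ξ) ^ 2 :=
  Real.sq_sqrt (by positivity)

theorem lam_le (ε ξ : ℝ) : lam ε ξ ≤ 1 + |2 * Real.pi * ε * ξ| := by
  rw [lam, Real.sqrt_le_left (by positivity)]
  nlinarith [abs_nonneg (2 * Real.pi * ε * ξ), sq_abs (2 * Real.pi * ε * ξ)]

theorem abs_le_wt (ξ : ℝ) : 2 * |ξ| ≤ wt ξ := by
  unfold wt
  nlinarith [sq_abs ξ, sq_nonneg (|ξ| - 1)]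

theorem abs_freq_le {ε : ℝ} (hε : 0 ≤ ε) (ξ : ℝ) : |2 * Real.pi * ε * ξ| ≤ 4 * ε * wt ξ := by
  rw [abs_mul, abs_of_nonneg (by positivity)]
  nlinarith [abs_le_wt ξ, Real.pi_lt_four, Real.pi_pos, mul_nonneg hε (abs_nonneg ξ),
    mul_nonneg hε (wt_pos ξ).le, mul_le_mul_of_nonneg_left (abs_le_wt ξ) hε]

theorem continuous_lam (ε : ℝ) : Continuous (lam ε) := by
  unfold lam
  fun_prop

theorem symbol_mul_self (ε ξ : ℝ) :
    symbol ε ξ * symbol ε ξ = ((lam ε ξ : ℂ) ^ 2) • (1 : Matrix (Fin 2) (Fin 2) ℂ) := by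
  rw [← Complex.ofReal_pow, lam_sq]
  ext i j
  fin_cases i <;> fin_cases j <;>
    simp [symbol, pauli₁, pauli₃, Matrix.mul_apply, Fin.sum_univ_two] <;> ring

/-- The symbol normalised to an involution. -/
noncomputable def unitSymbol (ε ξ : ℝ) : Matrix (Fin 2) (Fin 2) ℂ :=
  ((lam ε ξ : ℂ)⁻¹) • symbol ε ξ

theorem lam_ne_zero (ε ξ : ℝ) : (lam ε ξ : ℂ) ≠ 0 := by
  exact_mod_cast (lam_pos ε ξ).ne'

theorem unitSymbol_mul_self (ε ξ : ℝ) : unitSymbol ε ξ * unitSymbol ε ξ = 1 := by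
  rw [unitSymbol, smul_mul_smul_comm, symbol_mul_self, smul_smul]
  have := lam_ne_zero ε ξ
  field_simp
  simp

theorem lam_smul_unitSymbol (ε ξ : ℝ) : (lam ε ξ : ℂ) • unitSymbol ε ξ = symbol ε ξ := by
  rw [unitSymbol, smul_smul, mul_inv_cancel₀ (lam_ne_zero ε ξ), one_smul]

theorem exp_smul_of_mul_self_eq_one {A : Matrix (Fin 2) (Fin 2) ℂ} (hA : A * A = 1) (z : ℂ) :
    NormedSpace.exp (z • A) = Complex.cosh z • 1 + Complex.sinh z • A := by
  let _ : NormedRing (Matrix (Fin 2) (Fin 2) ℂ) := Matrix.linftyOpNormedRing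
  let _ : NormedAlgebra ℂ (Matrix (Fin 2) (Fin 2) ℂ) := Matrix.linftyOpNormedAlgebra
  have h1 := NormedSpace.exp_series_hasSum_exp' (𝕂 := ℂ) (z • A)
  refine h1.unique (HasSum.even_add_odd ?_ ?_)
  · have h2 := (Complex.hasSum_cosh z).smul_const (1 : Matrix (Fin 2) (Fin 2) ℂ)
    refine h2.congr_fun fun n => ?_
    rw [smul_pow, pow_mul A, pow_two, hA, one_pow, smul_smul, div_eq_inv_mul]
  · have h2 := (Complex.hasSum_sinh z).smul_const A
    refine h2.congr_fun fun n => ?_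
    rw [smul_pow, pow_succ A, pow_mul A, pow_two, hA, one_pow, one_mul, smul_smul, div_eq_inv_mul]

/-- The symbol `e^{-i x S}`, where `S` is the normalised symbol of the Dirac operator. -/
noncomputable def rot (ε x ξ : ℝ) : Spinor →L[ℂ] Spinor :=
  (Real.cos x : ℂ) • 1 - (Complex.I * Real.sin x) • toOp (unitSymbol ε ξ)

/-- Since `S² = 1`, the even and odd parts of the exponential series sum to `cos` and `sin`.
Estimates on the free evolution thereby become scalar ones. -/
theorem toOp_flowSymbol (ε s ξ : ℝ) : toOp (flowSymbol ε s ξ) = rot ε (s * lam ε ξ) ξ := by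
  have h : flowSymbol ε s ξ = (Real.cos (s * lam ε ξ) : ℂ) • 1 -
      (Complex.I * Real.sin (s * lam ε ξ)) • unitSymbol ε ξ := by
    rw [flowSymbol, ← lam_smul_unitSymbol, smul_smul,
      exp_smul_of_mul_self_eq_one (unitSymbol_mul_self ε ξ)]
    have h1 : -(Complex.I * (s : ℂ)) * (lam ε ξ : ℂ) = -(((s * lam ε ξ : ℝ) : ℂ) * Complex.I) := by
      push_cast
      ring
    rw [h1, Complex.cosh_neg, Complex.sinh_neg, Complex.cosh_mul_I, Complex.sinh_mul_I, neg_smul,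
      ← sub_eq_add_neg, mul_comm _ Complex.I, Complex.ofReal_cos, Complex.ofReal_sin]
  rw [h, toOp, map_sub, map_smul, map_smul, map_one, rot]

theorem rot_eq_flowSymbol (ε x ξ : ℝ) : rot ε x ξ = toOp (flowSymbol ε (x / lam ε ξ) ξ) := by
  rw [toOp_flowSymbol, div_mul_cancel₀ _ (lam_pos ε ξ).ne']

theorem norm_rot (ε x ξ : ℝ) (v : Spinor) : ‖rot ε x ξ v‖ = ‖v‖ := by
  rw [rot_eq_flowSymbol]
  exact norm_act_flowSymbol _ _ _ _

theorem toOp_unitSymbol_mul_self (ε ξ : ℝ) :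
    toOp (unitSymbol ε ξ) * toOp (unitSymbol ε ξ) = 1 := by
  rw [← map_mul, unitSymbol_mul_self, map_one]

theorem rot_mul_rot (ε x y ξ : ℝ) : rot ε x ξ * rot ε y ξ = rot ε (x + y) ξ := by
  have h := toOp_unitSymbol_mul_self ε ξ
  simp only [rot, sub_mul, mul_sub, smul_mul_smul_comm, h, one_mul, mul_one, Real.cos_add,
    Real.sin_add]
  push_cast
  have hI : Complex.I * Complex.sin x * (Complex.I * Complex.sin y) =
    -(Complex.sin x * Complex.sin y) := by
    linear_combination Complex.sin x * Complex.sin y * Complex.I_mul_I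
  rw [hI]
  module

theorem rot_zero (ε ξ : ℝ) : rot ε 0 ξ = 1 := by
  simp only [rot, Real.cos_zero, Real.sin_zero, Complex.ofReal_one, Complex.ofReal_zero, mul_zero]
  module

/-- A quarter turn of the unitary group is `-iS`, so `S` inherits the isometry property. -/
theorem norm_unitSymbol (ε ξ : ℝ) (v : Spinor) : ‖toOp (unitSymbol ε ξ) v‖ = ‖v‖ := by
  have h := norm_rot ε (Real.pi / 2) ξ v
  have h1 : rot ε (Real.pi / 2) ξ v = (-Complex.I) • toOp (unitSymbol ε ξ) v := by
    simp only [rot, Real.cos_pi_div_two, Real.sin_pi_div_two, Complex.ofReal_one,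
      Complex.ofReal_zero, mul_one, sub_apply, smul_apply]
    module
  rwa [h1, norm_smul, norm_neg, Complex.norm_I, one_mul] at h

theorem norm_rot_sub_one_le (ε x ξ : ℝ) (v : Spinor) : ‖(rot ε x ξ - 1) v‖ ≤ 2 * |x| * ‖v‖ := by
  have h1 : (rot ε x ξ - 1) v = ((Real.cos x - 1 : ℝ) : ℂ) • v -
      (Complex.I * Real.sin x) • toOp (unitSymbol ε ξ) v := by
    simp only [rot, sub_apply, smul_apply, one_apply_eq_self, Complex.ofReal_sub, Complex.ofReal_one]
    module
  have h2 : |Real.cos x - 1| ≤ |x| := by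
    simpa using Real.abs_cos_sub_cos_le x 0
  rw [h1]
  refine (norm_sub_le _ _).trans ?_
  rw [norm_smul, norm_smul, norm_unitSymbol, norm_mul, Complex.norm_I, one_mul, Complex.norm_real,
    Complex.norm_real, Real.norm_eq_abs, Real.norm_eq_abs]
  nlinarith [norm_nonneg v, mul_le_mul_of_nonneg_right h2 (norm_nonneg v),
    mul_le_mul_of_nonneg_right (Real.abs_sin_le_abs (x := x)) (norm_nonneg v)]

/-- The sine parts cancel and only `2(cos x - 1)` is left. -/
theorem norm_rot_add_rot_neg_le (ε x ξ : ℝ) (v : Spinor) :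
    ‖(rot ε x ξ + rot ε (-x) ξ - (2 : ℂ) • 1) v‖ ≤ x ^ 2 * ‖v‖ := by
  have h1 : rot ε x ξ + rot ε (-x) ξ - (2 : ℂ) • 1 = ((2 * (Real.cos x - 1) : ℝ) : ℂ) • 1 := by
    simp only [rot, Real.cos_neg, Real.sin_neg]
    push_cast
    module
  rw [h1, smul_apply, norm_smul, Complex.norm_real, Real.norm_eq_abs]
  refine mul_le_mul_of_nonneg_right ?_ (norm_nonneg v)
  rw [abs_le]
  constructor <;> nlinarith [Real.one_sub_sq_div_two_le_cos (x := x), Real.cos_le_one x,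
    sq_nonneg x]

theorem abs_sin_sub_le (x : ℝ) : |Real.sin x - x| ≤ 2 * x ^ 2 := by
  rcases le_total |x| 1 with hx | hx
  · have h1 := Complex.norm_exp_sub_one_sub_id_le (x := x * Complex.I) (by simpa using hx)
    have h2 : Real.sin x - x = (Complex.exp (x * Complex.I) - 1 - x * Complex.I).im := by
      simp [Complex.exp_ofReal_mul_I_im]
    rw [h2]
    refine (Complex.abs_im_le_norm _).trans (h1.trans ?_)
    simp
    nlinarith [sq_nonneg x]
  · have h1 := abs_sub (Real.sin x) x
    nlinarith [Real.abs_sin_le_abs (x := x), Real.abs_sin_le_one x, sq_abs x]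

theorem norm_rot_sub_sub_le (ε x ξ : ℝ) (v : Spinor) :
    ‖(rot ε x ξ - 1 + (Complex.I * x) • toOp (unitSymbol ε ξ)) v‖ ≤ 3 * x ^ 2 * ‖v‖ := by
  have h1 : (rot ε x ξ - 1 + (Complex.I * x) • toOp (unitSymbol ε ξ)) v =
      ((Real.cos x - 1 : ℝ) : ℂ) • v -
      (Complex.I * (Real.sin x - x : ℝ)) • toOp (unitSymbol ε ξ) v := by
    simp only [rot, sub_apply, smul_apply, one_apply_eq_self, add_apply]
    push_cast
    module
  have h2 : |Real.cos x - 1| ≤ x ^ 2 := by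
    rw [abs_le]
    constructor <;> nlinarith [Real.one_sub_sq_div_two_le_cos (x := x), Real.cos_le_one x,
      sq_nonneg x]
  rw [h1]
  refine (norm_sub_le _ _).trans ?_
  rw [norm_smul, norm_smul, norm_unitSymbol, norm_mul, Complex.norm_I, one_mul, Complex.norm_real,
    Complex.norm_real, Real.norm_eq_abs, Real.norm_eq_abs]
  nlinarith [norm_nonneg v, mul_le_mul_of_nonneg_right h2 (norm_nonneg v),
    mul_le_mul_of_nonneg_right (abs_sin_sub_le x) (norm_nonneg v)]

/-- The difference is `λ⁻¹(2πεξ)σ₁ + λ⁻¹(1 - λ)σ₃`, and both coefficients are at most `|2πεξ|` in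
modulus. This is the source of the gain of `ε` for the off-diagonal part. -/
theorem norm_unitSymbol_sub_pauli₃_le {ε : ℝ} (hε : 0 ≤ ε) (ξ : ℝ) (v : Spinor) :
    ‖(toOp (unitSymbol ε ξ) - toOp pauli₃) v‖ ≤ 8 * ε * wt ξ * ‖v‖ := by
  have hl := lam_pos ε ξ
  have h1 : (toOp (unitSymbol ε ξ) - toOp pauli₃) v = (((lam ε ξ)⁻¹ * (2 * Real.pi * ε * ξ) : ℝ) : ℂ) •
      toOp pauli₁ v + (((lam ε ξ)⁻¹ * (1 - lam ε ξ) : ℝ) : ℂ) • toOp pauli₃ v := by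
    rw [unitSymbol, symbol, toOp, map_smul, map_add, map_smul]
    have : (((lam ε ξ)⁻¹ * (1 - lam ε ξ) : ℝ) : ℂ) = (lam ε ξ : ℂ)⁻¹ - 1 := by
      push_cast
      have := lam_ne_zero ε ξ
      field_simp
    rw [this]
    simp only [sub_apply, smul_apply, add_apply, Complex.ofReal_mul, Complex.ofReal_inv]
    module
  have h2 : (lam ε ξ)⁻¹ ≤ 1 := inv_le_one_of_one_le₀ (one_le_lam ε ξ)
  rw [h1]
  refine (norm_add_le _ _).trans ?_
  rw [norm_smul, norm_smul, norm_toOp_pauli₁, norm_toOp_pauli₃, Complex.norm_real, Complex.norm_real,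
    Real.norm_eq_abs, Real.norm_eq_abs, abs_mul (lam ε ξ)⁻¹, abs_mul (lam ε ξ)⁻¹,
    abs_of_nonneg (inv_nonneg.2 hl.le), ← add_mul, ← mul_add]
  refine mul_le_mul_of_nonneg_right ?_ (norm_nonneg v)
  have h3 : |1 - lam ε ξ| = lam ε ξ - 1 := by
    rw [abs_sub_comm, abs_of_nonneg (by linarith [one_le_lam ε ξ])]
  rw [h3]
  refine (mul_le_of_le_one_left ?_ h2).trans ?_
  · linarith [abs_nonneg (2 * Real.pi * ε * ξ), one_le_lam ε ξ]
  · linarith [lam_le ε ξ, abs_freq_le hε ξ]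

theorem continuous_unitSymbol (ε : ℝ) : Continuous fun ξ => toOp (unitSymbol ε ξ) := by
  have h1 : (fun ξ => toOp (unitSymbol ε ξ)) = fun ξ => (((lam ε ξ)⁻¹ : ℝ) : ℂ) •
      (((2 * Real.pi * ε * ξ : ℝ) : ℂ) • toOp pauli₁ + toOp pauli₃) := by
    ext1 ξ
    rw [unitSymbol, symbol, toOp, map_smul, map_add, map_smul]
    simp
  rw [h1]
  have h2 : Continuous fun ξ => (lam ε ξ)⁻¹ := (continuous_lam ε).inv₀ fun ξ => (lam_pos ε ξ).ne'
  fun_prop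


/-! ### The free evolution on the Fourier side -/

theorem continuous_rot {ε : ℝ} {φ : ℝ → ℝ} (hφ : Continuous φ) :
    Continuous fun ξ => rot ε (φ ξ) ξ := by
  unfold rot
  have := continuous_unitSymbol ε
  fun_prop

/-- The unitary group with the symbol `e^{-i s φ(ξ) S(ξ)}`. -/
noncomputable def flow (ε : ℝ) (φ : ℝ → ℝ) (s : ℝ) : SpinorL2 →L[ℂ] SpinorL2 :=
  mulOp fun ξ => rot ε (s * φ ξ) ξ

section flow

variable {ε : ℝ} {φ : ℝ → ℝ}

theorem isMul_flow (hφ : Continuous φ) (s : ℝ) :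
    IsMul (flow ε φ s) fun ξ => rot ε (s * φ ξ) ξ := by
  refine isMul_mulOp (c := 1) (continuous_rot (by fun_prop)).aestronglyMeasurable
    (Eventually.of_forall fun ξ => ?_)
  refine ContinuousLinearMap.opNorm_le_bound _ zero_le_one fun v => ?_
  rw [norm_rot, one_mul]

theorem norm_flow (hφ : Continuous φ) (s : ℝ) (f : SpinorL2) : ‖flow ε φ s f‖ = ‖f‖ := by
  rw [Lp.norm_def, Lp.norm_def]
  congr 1
  apply eLpNorm_congr_norm_ae
  filter_upwards [isMul_flow hφ s f] with ξ hξ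
  rw [hξ, norm_rot]

theorem flow_add (hφ : Continuous φ) (s t : ℝ) :
    flow ε φ (s + t) = flow ε φ s * flow ε φ t := by
  refine (isMul_flow hφ (s + t)).eq (((isMul_flow hφ s).mul (isMul_flow hφ t)).congr ?_)
  refine Eventually.of_forall fun ξ => ?_
  rw [rot_mul_rot, add_mul]

theorem flow_zero (hφ : Continuous φ) : flow ε φ 0 = 1 := by
  refine (isMul_flow hφ 0).eq (IsMul.one.congr (Eventually.of_forall fun ξ => ?_))
  rw [zero_mul, rot_zero]

theorem flow_neg_mul_flow (hφ : Continuous φ) (s : ℝ) : flow ε φ (-s) * flow ε φ s = 1 := by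
  rw [← flow_add hφ, neg_add_cancel, flow_zero hφ]

theorem flow_mul_flow_neg (hφ : Continuous φ) (s : ℝ) : flow ε φ s * flow ε φ (-s) = 1 := by
  rw [← flow_add hφ, add_neg_cancel, flow_zero hφ]

theorem flow_mul_flow {χ : ℝ → ℝ} (hφ : Continuous φ) (hχ : Continuous χ) (s : ℝ) :
    flow ε φ s * flow ε χ s = flow ε (fun ξ => φ ξ + χ ξ) s := by
  refine ((isMul_flow hφ s).mul (isMul_flow hχ s)).eq
    ((isMul_flow (hφ.add hχ) s).congr (Eventually.of_forall fun ξ => ?_))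
  rw [rot_mul_rot, Pi.add_apply, mul_add]

theorem Sob.flow {j : ℕ} {N : ℝ} {f : SpinorL2} (hφ : Continuous φ) (s : ℝ) (hf : Sob j N f) :
    Sob j N (flow ε φ s f) := by
  have := hf.isMul_same (isMul_flow (ε := ε) hφ s) zero_le_one fun ξ v => by
    rw [norm_rot, one_mul]
  rwa [one_mul] at this

theorem isMul_flow_sub_one (hφ : Continuous φ) (s : ℝ) :
    IsMul (flow ε φ s - 1) fun ξ => rot ε (s * φ ξ) ξ - 1 :=
  (isMul_flow hφ s).sub IsMul.one

theorem isMul_flow_add_flow_neg (hφ : Continuous φ) (s : ℝ) :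
    IsMul (flow ε φ s + flow ε φ (-s) - (2 : ℂ) • 1)
      fun ξ => rot ε (s * φ ξ) ξ + rot ε (-(s * φ ξ)) ξ - (2 : ℂ) • 1 := by
  refine (((isMul_flow hφ s).add (isMul_flow hφ (-s))).sub (IsMul.one.smul 2)).congr ?_
  exact Eventually.of_forall fun ξ => by simp only [neg_mul]

theorem Sob.flow_sub_one {j p : ℕ} {c N : ℝ} {f : SpinorL2} (hφ : Continuous φ) (hc : 0 ≤ c)
    (h : ∀ ξ, |φ ξ| ≤ c * wt ξ ^ p) (s : ℝ) (hf : Sob (j + p) N f) :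
    Sob j (2 * c * |s| * N) ((Dirac.flow ε φ s - 1) f) := by
  refine Sob.isMul (isMul_flow_sub_one hφ s) (by positivity) (fun ξ v => ?_) hf
  refine (norm_rot_sub_one_le _ _ _ _).trans (mul_le_mul_of_nonneg_right ?_ (norm_nonneg v))
  rw [abs_mul]
  nlinarith [mul_le_mul_of_nonneg_left (h ξ) (abs_nonneg s)]

theorem Sob.flow_second {j q : ℕ} {c N : ℝ} {f : SpinorL2} (hφ : Continuous φ) (hc : 0 ≤ c)
    (h : ∀ ξ, φ ξ ^ 2 ≤ c * wt ξ ^ q) (s : ℝ) (hf : Sob (j + q) N f) :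
    Sob j (c * s ^ 2 * N)
      ((Dirac.flow ε φ s + Dirac.flow ε φ (-s) - (2 : ℂ) • (1 : SpinorL2 →L[ℂ] SpinorL2)) f) := by
  refine Sob.isMul (isMul_flow_add_flow_neg hφ s) (by positivity) (fun ξ v => ?_) hf
  refine (norm_rot_add_rot_neg_le _ _ _ _).trans (mul_le_mul_of_nonneg_right ?_ (norm_nonneg v))
  rw [mul_pow]
  nlinarith [mul_le_mul_of_nonneg_left (h ξ) (sq_nonneg s)]

/-- Truncated functions lie in every weighted space; they form the dense class on which strong
continuity of the group is checked. -/
theorem Sob.cut (j R : ℕ) (f : SpinorL2) : Sob j (wt (R + 1) ^ j * ‖f‖) (cut 0 R f) := fun R' => by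
  refine Lp.norm_le_mul_norm_of_ae_le_mul ?_
  filter_upwards [cut_ae j R' (Dirac.cut 0 R f), cut_ae 0 R f] with ξ h1 h2
  rw [h1, h2, ← mul_assoc]
  refine mul_le_mul_of_nonneg_right ?_ (norm_nonneg _)
  have h3 : cutSymbol j R' ξ * cutSymbol 0 R ξ ≤ cutSymbol j R ξ := by
    unfold cutSymbol indicator
    split_ifs <;> simp [pow_nonneg (wt_pos _).le]
  exact h3.trans (cutSymbol_le j R ξ)

theorem tendsto_flow_zero (hφ : Continuous φ) (hφ' : ∃ c p, ∀ ξ, |φ ξ| ≤ c * wt ξ ^ p)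
    (f : SpinorL2) : Tendsto (fun s => flow ε φ s f) (𝓝 0) (𝓝 f) := by
  obtain ⟨c, p, hcp⟩ := hφ'
  have hc : 0 ≤ c := by
    have := (abs_nonneg _).trans (hcp 0)
    simpa [wt] using this
  rw [Metric.tendsto_nhds]
  intro δ hδ
  obtain ⟨R, hR⟩ := ((Metric.tendsto_nhds.1 (Sob.tendsto_cut_zero f)) (δ / 4) (by positivity)).exists
  have h1 := Sob.cut p R f
  have h2 : ∀ s, ‖(flow ε φ s - 1) (Dirac.cut 0 R f)‖ ≤ 2 * c * |s| * (wt (R + 1) ^ p * ‖f‖) :=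
    fun s => (Sob.flow_sub_one (j := 0) hφ hc hcp s (by rwa [zero_add])).norm_le
  have h3 : Tendsto (fun s : ℝ => 2 * c * |s| * (wt (R + 1) ^ p * ‖f‖)) (𝓝 0) (𝓝 0) := by
    have : Continuous fun s : ℝ => 2 * c * |s| * (wt (R + 1) ^ p * ‖f‖) := by fun_prop
    simpa using this.tendsto 0
  filter_upwards [h3.eventually_lt_const (show 0 < δ / 2 by positivity)] with s hs
  have h4 : flow ε φ s f - f = (flow ε φ s - 1) (Dirac.cut 0 R f) -
      flow ε φ s (Dirac.cut 0 R f - f) + (Dirac.cut 0 R f - f) := by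
    simp only [sub_apply, map_sub, one_apply_eq_self]
    abel
  rw [dist_eq_norm] at hR ⊢
  rw [h4]
  refine (norm_add_le _ _).trans_lt ?_
  have h5 := norm_sub_le ((flow ε φ s - 1) (Dirac.cut 0 R f)) (flow ε φ s (Dirac.cut 0 R f - f))
  rw [norm_flow hφ] at h5
  linarith [h2 s]

/-- For unbounded `φ` the group is only strongly continuous, so the time and the vector have to be
moved together. -/
theorem continuous_flow_apply (hφ : Continuous φ) (hφ' : ∃ c p, ∀ ξ, |φ ξ| ≤ c * wt ξ ^ p)
    {X : Type*} [TopologicalSpace X] {s : X → ℝ} {f : X → SpinorL2} {D : Set X}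
    (hs : ContinuousOn s D) (hf : ContinuousOn f D) :
    ContinuousOn (fun x => flow ε φ (s x) (f x)) D := by
  intro x hx
  have h1 : ∀ y, flow ε φ (s y) (f y) =
      flow ε φ (s y) (f y - f x) + flow ε φ (s x) (flow ε φ (s y - s x) (f x)) := fun y => by
    rw [← mul_apply_eq_comp, ← flow_add hφ, add_sub_cancel, map_sub, sub_add_cancel]
  rw [ContinuousWithinAt]
  simp_rw [h1]
  refine Tendsto.add ?_ ?_
  · have : Tendsto (fun y => f y - f x) (𝓝[D] x) (𝓝 0) := by
      simpa using (hf x hx).sub_const (f x)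
    rw [tendsto_zero_iff_norm_tendsto_zero] at this
    rw [sub_self, map_zero, tendsto_zero_iff_norm_tendsto_zero]
    simpa only [norm_flow hφ] using this
  · refine (flow ε φ (s x)).continuous.continuousAt.tendsto.comp ?_
    rw [sub_self, flow_zero hφ]
    refine (tendsto_flow_zero hφ hφ' (f x)).comp ?_
    simpa using (hs x hx).sub_const (s x)

end flow

/-- The operators bounded by `C` on the weighted spaces of orders `0`, `1` and `2`. -/
def SobBdd (C : ℝ) (W : SpinorL2 →L[ℂ] SpinorL2) : Prop :=
  ∀ p ≤ 2, ∀ N f, Sob p N f → Sob p (C * N) (W f)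

/-- The conjugate `g(-r) W g(r)`. -/
noncomputable def conj (g : ℝ → SpinorL2 →L[ℂ] SpinorL2) (r : ℝ) (W : SpinorL2 →L[ℂ] SpinorL2) :
    SpinorL2 →L[ℂ] SpinorL2 := g (-r) * W * g r

theorem conj_add_left (g : ℝ → SpinorL2 →L[ℂ] SpinorL2) (r : ℝ) (W W' : SpinorL2 →L[ℂ] SpinorL2) :
    conj g r (W + W') = conj g r W + conj g r W' := by
  simp only [conj]
  noncomm_ring

/-! ### First and second differences of the conjugates -/

section differences

variable {ε : ℝ} {φ : ℝ → ℝ}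

/-- By the group law, the base point `r` enters only through outer unitaries, which preserve all
weighted norms. Differences therefore need to be estimated at `0` only. -/
theorem conj_flow_add (hφ : Continuous φ) (r h : ℝ) (W : SpinorL2 →L[ℂ] SpinorL2) :
    conj (flow ε φ) (r + h) W = flow ε φ (-r) * conj (flow ε φ) h W * flow ε φ r := by
  rw [conj, conj, add_comm r h, flow_add hφ, neg_add_rev, flow_add hφ]
  noncomm_ring

/-- A bound for the first difference of `r ↦ g(-r) W g(r)` at `0` extends to all `r`. -/
theorem norm_conj_diff_le (hφ : Continuous φ) {W : SpinorL2 →L[ℂ] SpinorL2} {c N h : ℝ} {j : ℕ}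
    (H : ∀ f, Sob j N f → ‖conj (flow ε φ) h W f - W f‖ ≤ c) (r : ℝ) {f : SpinorL2}
    (hf : Sob j N f) : ‖conj (flow ε φ) (r + h) W f - conj (flow ε φ) r W f‖ ≤ c := by
  have h1 : conj (flow ε φ) (r + h) W f - conj (flow ε φ) r W f =
      flow ε φ (-r) (conj (flow ε φ) h W (flow ε φ r f) - W (flow ε φ r f)) := by
    rw [conj_flow_add hφ, map_sub]
    rfl
  rw [h1, norm_flow hφ]
  exact H _ (hf.flow hφ r)

/-- A bound for the second difference of `r ↦ g(-r) W g(r)` at `0` extends to all `r`. -/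
theorem norm_conj_second_diff_le (hφ : Continuous φ) {W : SpinorL2 →L[ℂ] SpinorL2} {c N h : ℝ}
    {j : ℕ}
    (H : ∀ f, Sob j N f →
      ‖conj (flow ε φ) h W f + conj (flow ε φ) (-h) W f - (2 : ℂ) • W f‖ ≤ c)
    (r : ℝ) {f : SpinorL2} (hf : Sob j N f) :
    ‖conj (flow ε φ) (r + h) W f + conj (flow ε φ) (r - h) W f -
      (2 : ℂ) • conj (flow ε φ) r W f‖ ≤ c := by
  have h1 : conj (flow ε φ) (r + h) W f + conj (flow ε φ) (r - h) W f -
      (2 : ℂ) • conj (flow ε φ) r W f =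
      flow ε φ (-r) (conj (flow ε φ) h W (flow ε φ r f) + conj (flow ε φ) (-h) W (flow ε φ r f) -
        (2 : ℂ) • W (flow ε φ r f)) := by
    rw [conj_flow_add hφ, sub_eq_add_neg r h, conj_flow_add hφ, map_sub, map_add, map_smul]
    rfl
  rw [h1, norm_flow hφ]
  exact H _ (hf.flow hφ r)

theorem conj_flow_sub_eq (φ : ℝ → ℝ) (h : ℝ) (W : SpinorL2 →L[ℂ] SpinorL2) (f : SpinorL2) :
    conj (flow ε φ) h W f - W f =
      (flow ε φ (-h) - 1) (W (flow ε φ h f)) + W ((flow ε φ h - 1) f) := by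
  simp [conj]

theorem conj_flow_second_eq (φ : ℝ → ℝ) (h : ℝ) (W : SpinorL2 →L[ℂ] SpinorL2) (f : SpinorL2) :
    conj (flow ε φ) h W f + conj (flow ε φ) (-h) W f - (2 : ℂ) • W f =
      (flow ε φ h + flow ε φ (-h) - (2 : ℂ) • (1 : SpinorL2 →L[ℂ] SpinorL2)) (W f) +
      W ((flow ε φ h + flow ε φ (-h) - (2 : ℂ) • (1 : SpinorL2 →L[ℂ] SpinorL2)) f) +
      (flow ε φ (-h) - 1) (W ((flow ε φ h - 1) f)) +
      (flow ε φ h - 1) (W ((flow ε φ (-h) - 1) f)) := by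
  simp only [conj, mul_apply_eq_comp, sub_apply, add_apply, smul_apply, map_sub,
    map_add, map_smul, one_apply_eq_self, neg_neg]
  module

end differences


/-! ### Diagonal and off-diagonal parts with respect to the symbol -/

/-- The multiplication by the normalised symbol. -/
noncomputable def unitOp (ε : ℝ) : SpinorL2 →L[ℂ] SpinorL2 := mulOp fun ξ => toOp (unitSymbol ε ξ)

/-- The multiplication by `σ₃`. -/
noncomputable def pauliOp₃ : SpinorL2 →L[ℂ] SpinorL2 := mulOp fun _ => toOp pauli₃

theorem isMul_unitOp (ε : ℝ) : IsMul (unitOp ε) fun ξ => toOp (unitSymbol ε ξ) :=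
  isMul_mulOp (c := 1) (continuous_unitSymbol ε).aestronglyMeasurable
    (Eventually.of_forall fun ξ => ContinuousLinearMap.opNorm_le_bound _ zero_le_one fun v => by
      rw [norm_unitSymbol, one_mul])

theorem isMul_pauliOp₃ : IsMul pauliOp₃ fun _ => toOp pauli₃ :=
  isMul_mulOp (c := 1) aestronglyMeasurable_const
    (Eventually.of_forall fun ξ => ContinuousLinearMap.opNorm_le_bound _ zero_le_one fun v => by
      rw [norm_toOp_pauli₃, one_mul])

theorem unitOp_mul_self (ε : ℝ) : unitOp ε * unitOp ε = 1 := by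
  refine ((isMul_unitOp ε).mul (isMul_unitOp ε)).eq (IsMul.one.congr ?_)
  exact Eventually.of_forall fun ξ => (toOp_unitSymbol_mul_self ε ξ).symm

theorem Sob.unitOp {ε : ℝ} {j : ℕ} {N : ℝ} {f : SpinorL2} (hf : Sob j N f) :
    Sob j N (unitOp ε f) := by
  have := hf.isMul_same (isMul_unitOp ε) zero_le_one fun ξ v => by
    rw [norm_unitSymbol, one_mul]
  rwa [one_mul] at this

theorem Sob.unitOp_sub {ε : ℝ} (hε : 0 ≤ ε) {j : ℕ} {N : ℝ} {f : SpinorL2} (hf : Sob (j + 1) N f) :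
    Sob j (8 * ε * N) ((Dirac.unitOp ε - pauliOp₃) f) :=
  Sob.isMul ((isMul_unitOp ε).sub isMul_pauliOp₃) (by positivity)
    (fun ξ v => by rw [pow_one]; exact norm_unitSymbol_sub_pauli₃_le hε ξ v) hf

/-- The part of `W` that commutes with the normalised symbol. -/
noncomputable def diagPart (ε : ℝ) (W : SpinorL2 →L[ℂ] SpinorL2) : SpinorL2 →L[ℂ] SpinorL2 :=
  (1 / 2 : ℂ) • (W + unitOp ε * W * unitOp ε)

/-- The part of `W` that anticommutes with the normalised symbol. -/
noncomputable def offPart (ε : ℝ) (W : SpinorL2 →L[ℂ] SpinorL2) : SpinorL2 →L[ℂ] SpinorL2 :=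
  (1 / 2 : ℂ) • (W - unitOp ε * W * unitOp ε)

theorem diagPart_add_offPart (ε : ℝ) (W : SpinorL2 →L[ℂ] SpinorL2) :
    diagPart ε W + offPart ε W = W := by
  rw [diagPart, offPart]
  module

theorem diagPart_commute (ε : ℝ) (W : SpinorL2 →L[ℂ] SpinorL2) :
    Commute (unitOp ε) (diagPart ε W) := by
  have h := unitOp_mul_self ε
  rw [diagPart]
  refine Commute.smul_right ?_ _
  rw [commute_iff_eq, mul_add, add_mul, add_comm]
  simp only [mul_assoc, h, mul_one]
  simp only [← mul_assoc, h, one_mul]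

namespace SobBdd

variable {C C' : ℝ} {W W' : SpinorL2 →L[ℂ] SpinorL2}

theorem add (h : SobBdd C W) (h' : SobBdd C' W') : SobBdd (C + C') (W + W') := fun p hp N f hf => by
  rw [add_mul]
  exact (h p hp N f hf).add (h' p hp N f hf)

theorem sub (h : SobBdd C W) (h' : SobBdd C' W') : SobBdd (C + C') (W - W') := fun p hp N f hf => by
  rw [add_mul]
  exact (h p hp N f hf).sub (h' p hp N f hf)

theorem conj_unitOp (h : SobBdd C W) (ε : ℝ) : SobBdd C (unitOp ε * W * unitOp ε) :=
  fun p hp N _ hf => (h p hp N _ hf.unitOp).unitOp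

theorem half (h : SobBdd (C + C) W) : SobBdd C ((1 / 2 : ℂ) • W) := fun p hp N f hf => by
  have := (h p hp N f hf).smul (1 / 2)
  refine this.mono (le_of_eq ?_)
  norm_num
  ring

theorem diagPart (h : SobBdd C W) (ε : ℝ) : SobBdd C (diagPart ε W) := (h.add (h.conj_unitOp ε)).half

theorem offPart (h : SobBdd C W) (ε : ℝ) : SobBdd C (offPart ε W) := (h.sub (h.conj_unitOp ε)).half

end SobBdd

theorem norm_unitOp_le (ε : ℝ) : ‖unitOp ε‖ ≤ 1 :=
  (unitOp ε).opNorm_le_bound zero_le_one fun f => by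
    rw [one_mul]
    exact (Sob.unitOp (Sob.of_norm_le le_rfl)).norm_le

/-- `S` is a contraction, so averaging `W` with `SWS` does not increase the norm. The global
estimate requires this of `Γ`. -/
theorem norm_diagPart_le (ε : ℝ) (W : SpinorL2 →L[ℂ] SpinorL2) : ‖diagPart ε W‖ ≤ ‖W‖ := by
  have h1 : ‖unitOp ε * W * unitOp ε‖ ≤ ‖W‖ := by
    refine (norm_mul_le _ _).trans ?_
    refine (mul_le_of_le_one_right (norm_nonneg _) (norm_unitOp_le ε)).trans ?_
    refine (norm_mul_le _ _).trans ?_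
    exact mul_le_of_le_one_left (norm_nonneg _) (norm_unitOp_le ε)
  rw [diagPart, norm_smul]
  have h2 := norm_add_le W (unitOp ε * W * unitOp ε)
  have h3 : ‖(1 / 2 : ℂ)‖ = 1 / 2 := by norm_num
  rw [h3]
  linarith

/-- An operator that commutes with `σ₃` has an off-diagonal part of order `ε`. -/
theorem norm_offPart_apply_le {ε C N : ℝ} (hε : 0 ≤ ε) {W : SpinorL2 →L[ℂ] SpinorL2}
    (hW : SobBdd C W) (hc : Commute W pauliOp₃) {f : SpinorL2} (hf : Sob 1 N f) :
    ‖offPart ε W f‖ ≤ 8 * ε * C * N := by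
  -- Insert `σ₃`: since `W` commutes with it, `Wσ₃S` and `σ₃WS` cancel, and each remaining term
  -- carries a factor `S - σ₃` of size `ε`.
  have h1 : offPart ε W f = (1 / 2 : ℂ) • (W ((unitOp ε - pauliOp₃) (unitOp ε f)) -
      (unitOp ε - pauliOp₃) (W (unitOp ε f))) := by
    have h2 : ∀ g, unitOp ε (unitOp ε g) = g := fun g => by
      rw [← mul_apply_eq_comp, unitOp_mul_self]
      rfl
    have h3 : ∀ g, W (pauliOp₃ g) = pauliOp₃ (W g) := fun g => by
      rw [← mul_apply_eq_comp, hc.eq]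
      rfl
    simp only [offPart, smul_apply, sub_apply, mul_apply_eq_comp, map_sub, h2, h3]
    congr 1
    abel
  have h4 := (hW 0 (by norm_num) _ _ ((hf.unitOp (ε := ε)).unitOp_sub (ε := ε) (j := 0) hε)).norm_le
  have h5 := ((hW 1 (by norm_num) _ _ (hf.unitOp (ε := ε))).unitOp_sub (ε := ε) (j := 0) hε).norm_le
  have h6 := norm_sub_le (W ((unitOp ε - pauliOp₃) (unitOp ε f)))
    ((unitOp ε - pauliOp₃) (W (unitOp ε f)))
  rw [h1, norm_smul]
  have h7 : ‖(1 / 2 : ℂ)‖ = 1 / 2 := by norm_num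
  rw [h7]
  linarith


/-! ### The conjugates of the potential -/

/-- The symbol `λ/ε²` of the free evolution. -/
noncomputable def freq (ε ξ : ℝ) : ℝ := lam ε ξ / ε ^ 2

/-- The symbol `(λ - 1)/ε²` of the slow part of the free evolution. -/
noncomputable def slowFreq (ε ξ : ℝ) : ℝ := (lam ε ξ - 1) / ε ^ 2

theorem continuous_freq (ε : ℝ) : Continuous (freq ε) := (continuous_lam ε).div_const _

theorem continuous_slowFreq (ε : ℝ) : Continuous (slowFreq ε) :=
  ((continuous_lam ε).sub continuous_const).div_const _

variable {ε : ℝ}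

/-- From `λ² = 1 + (2πεξ)²` and `λ ≥ 1` one gets `λ - 1 ≤ (2πεξ)²/2`, so the division by `ε²` is
compensated exactly. -/
theorem abs_slowFreq_le (hε : 0 < ε) (ξ : ℝ) : |slowFreq ε ξ| ≤ 20 * wt ξ ^ 1 := by
  have h1 := one_le_lam ε ξ
  have h2 := lam_sq ε ξ
  have h3 : lam ε ξ - 1 ≤ (2 * Real.pi * ε * ξ) ^ 2 / 2 := by nlinarith
  rw [slowFreq, abs_of_nonneg (div_nonneg (by linarith) (by positivity)), pow_one,
    div_le_iff₀ (by positivity)]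
  refine h3.trans ?_
  have h4 : Real.pi ^ 2 ≤ 10 := by nlinarith [Real.pi_lt_d2, Real.pi_pos]
  have h5 : (2 * Real.pi * ε * ξ) ^ 2 / 2 = Real.pi ^ 2 * (2 * (ξ ^ 2 * ε ^ 2)) := by ring
  rw [h5]
  have h6 : Real.pi ^ 2 * (2 * (ξ ^ 2 * ε ^ 2)) ≤ 10 * (2 * (ξ ^ 2 * ε ^ 2)) := by gcongr
  refine h6.trans ?_
  rw [wt]
  nlinarith [sq_nonneg ε]

theorem slowFreq_sq_le (hε : 0 < ε) (ξ : ℝ) : slowFreq ε ξ ^ 2 ≤ 400 * wt ξ ^ 2 := by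
  have h := abs_slowFreq_le hε ξ
  rw [← sq_abs]
  have h2 := pow_le_pow_left₀ (abs_nonneg _) h 2
  rw [pow_one] at h2
  linarith

theorem abs_freq (ε ξ : ℝ) : |freq ε ξ| = lam ε ξ / ε ^ 2 :=
  abs_of_nonneg (div_nonneg (lam_pos ε ξ).le (sq_nonneg ε))

/-- The weighted term keeps an extra factor `ε`. This matters when the function is `O(ε)` in `L²`
but only `O(1)` in the weighted norm. -/
theorem abs_freq_le_one_add (hε : 0 < ε) (ξ : ℝ) :
    |freq ε ξ| ≤ 1 / ε ^ 2 * (1 + 4 * ε * wt ξ ^ 1) := by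
  rw [abs_freq, pow_one, div_eq_inv_mul, one_div]
  refine mul_le_mul_of_nonneg_left ?_ (by positivity)
  linarith [lam_le ε ξ, abs_freq_le hε.le ξ]

theorem abs_freq_le' (hε : 0 < ε) (hε1 : ε ≤ 1) (ξ : ℝ) : |freq ε ξ| ≤ 5 / ε ^ 2 * wt ξ ^ 1 := by
  refine (abs_freq_le_one_add hε ξ).trans ?_
  rw [div_mul_eq_mul_div, div_mul_eq_mul_div, one_mul]
  gcongr
  nlinarith [one_le_wt ξ]

theorem freq_sq_le_one_add (hε : 0 < ε) (ξ : ℝ) :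
    freq ε ξ ^ 2 ≤ 1 / ε ^ 4 * (1 + 16 * ε ^ 2 * wt ξ ^ 2) := by
  rw [freq, div_pow, lam_sq, div_eq_inv_mul, one_div, ← pow_mul]
  refine mul_le_mul_of_nonneg_left ?_ (by positivity)
  have := pow_le_pow_left₀ (abs_nonneg _) (abs_freq_le hε.le ξ) 2
  rw [sq_abs] at this
  linarith

/-- A single weight suffices since `λ²` is quadratic in `ξ`; the other available weight is then free
for the off-diagonal part. -/
theorem freq_sq_le (hε : 0 < ε) (hε1 : ε ≤ 1) (ξ : ℝ) :
    freq ε ξ ^ 2 ≤ 40 / ε ^ 4 * wt ξ ^ 1 := by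
  rw [freq, div_pow, lam_sq, ← pow_mul, div_mul_eq_mul_div]
  gcongr
  have h4 : Real.pi ^ 2 ≤ 10 := by nlinarith [Real.pi_lt_d2, Real.pi_pos]
  have h5 : (2 * Real.pi * ε * ξ) ^ 2 = Real.pi ^ 2 * ε ^ 2 * (4 * ξ ^ 2) := by ring
  have h6 : Real.pi ^ 2 * ε ^ 2 ≤ 10 * 1 := by
    gcongr
    exact pow_le_one₀ hε.le hε1
  rw [h5, wt, pow_one]
  nlinarith [mul_le_mul_of_nonneg_right h6 (show 0 ≤ 4 * ξ ^ 2 by positivity)]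

/-- Made for functions with a small plain norm and a weighted norm of order one. The two truncations
are added before the pointwise comparison, so that each norm keeps its own coefficient. -/
theorem IsMul.norm_le_of_one_add {A : SpinorL2 →L[ℂ] SpinorL2} {m : ℝ → Spinor →L[ℂ] Spinor}
    {c d M N : ℝ} {p : ℕ} {f : SpinorL2} (hA : IsMul A m) (hc : 0 ≤ c) (hd : 0 ≤ d)
    (h : ∀ ξ v, ‖m ξ v‖ ≤ c * (1 + d * wt ξ ^ p) * ‖v‖) (hM : ‖f‖ ≤ M) (hf : Sob p N f) :
    ‖A f‖ ≤ c * (M + d * N) := by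
  refine Sob.norm_le fun R => ?_
  have h1 : ‖cut 0 R f + (d : ℂ) • cut p R f‖ ≤ M + d * N := by
    refine (norm_add_le _ _).trans (add_le_add (Sob.of_norm_le hM R) ?_)
    rw [norm_smul, Complex.norm_real, Real.norm_of_nonneg hd]
    exact mul_le_mul_of_nonneg_left (hf R) hd
  refine le_trans ?_ (mul_le_mul_of_nonneg_left h1 hc)
  refine Lp.norm_le_mul_norm_of_ae_le_mul ?_
  filter_upwards [cut_ae 0 R (A f), hA f, Lp.coeFn_add (cut 0 R f) ((d : ℂ) • cut p R f),
    Lp.coeFn_smul (d : ℂ) (cut p R f), isMul_cut 0 R f, isMul_cut p R f] with ξ h2 h3 h4 h5 h6 h7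
  have h8 : (cut 0 R f + (d : ℂ) • cut p R f : SpinorL2) ξ =
      ((cutSymbol 0 R ξ * (1 + d * wt ξ ^ p) : ℝ) : ℂ) • f ξ := by
    rw [h4, Pi.add_apply, h5, Pi.smul_apply, h6, h7, smul_apply, smul_apply, one_apply_eq_self,
      smul_smul, ← add_smul]
    congr 1
    unfold cutSymbol indicator
    split_ifs <;> simp
  have h9 : 0 ≤ 1 + d * wt ξ ^ p := by
    have := pow_pos (wt_pos ξ) p
    positivity
  rw [h8, norm_smul, Complex.norm_real, Real.norm_of_nonneg (mul_nonneg (cutSymbol_nonneg 0 R ξ) h9),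
    h2, h3]
  have := mul_le_mul_of_nonneg_left (h ξ (f ξ)) (cutSymbol_nonneg 0 R ξ)
  linarith

/-- The free evolution `e^{-i s 𝒯^ε/ε²}` on the Fourier side. -/
noncomputable abbrev free (ε s : ℝ) : SpinorL2 →L[ℂ] SpinorL2 := flow ε (freq ε) s

theorem norm_free_sub_one_le (hε : 0 < ε) (h : ℝ) {M N : ℝ} {f : SpinorL2} (hM : ‖f‖ ≤ M)
    (hf : Sob 1 N f) : ‖(free ε h - 1) f‖ ≤ 2 * |h| / ε ^ 2 * (M + 4 * ε * N) := by
  refine IsMul.norm_le_of_one_add (isMul_flow_sub_one (continuous_freq ε) h) (by positivity)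
    (by positivity) (fun ξ v => ?_) hM hf
  refine (norm_rot_sub_one_le _ _ _ _).trans (mul_le_mul_of_nonneg_right ?_ (norm_nonneg v))
  rw [abs_mul]
  have := mul_le_mul_of_nonneg_left (abs_freq_le_one_add hε ξ) (abs_nonneg h)
  have h2 : 2 * |h| / ε ^ 2 * (1 + 4 * ε * wt ξ ^ 1) =
    2 * (|h| * (1 / ε ^ 2 * (1 + 4 * ε * wt ξ ^ 1))) := by ring
  rw [h2]
  linarith

theorem norm_free_second_le (hε : 0 < ε) (h : ℝ) {M N : ℝ} {f : SpinorL2} (hM : ‖f‖ ≤ M)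
    (hf : Sob 2 N f) :
    ‖(free ε h + free ε (-h) - (2 : ℂ) • (1 : SpinorL2 →L[ℂ] SpinorL2)) f‖ ≤
      h ^ 2 / ε ^ 4 * (M + 16 * ε ^ 2 * N) := by
  refine IsMul.norm_le_of_one_add (isMul_flow_add_flow_neg (continuous_freq ε) h) (by positivity)
    (by positivity) (fun ξ v => ?_) hM hf
  refine (norm_rot_add_rot_neg_le _ _ _ _).trans (mul_le_mul_of_nonneg_right ?_ (norm_nonneg v))
  rw [mul_pow]
  have := mul_le_mul_of_nonneg_left (freq_sq_le_one_add hε ξ) (sq_nonneg h)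
  refine this.trans (le_of_eq ?_)
  ring

/-- The free group is the product of the slow group and of `e^{-irS/ε²}`. The latter is a
combination of `1` and `S`, hence commutes with the diagonal part and cancels against its inverse.
-/
theorem conj_free_diagPart (r : ℝ) (W : SpinorL2 →L[ℂ] SpinorL2) :
    conj (free ε) r (diagPart ε W) = conj (flow ε (slowFreq ε)) r (diagPart ε W) := by
  have h0 : Continuous fun _ : ℝ => 1 / ε ^ 2 := continuous_const
  have h1 : (fun ξ => 1 / ε ^ 2 + slowFreq ε ξ) = freq ε := by
    ext ξ
    rw [slowFreq, freq]
    ring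
  have h2 : ∀ s, free ε s = flow ε (fun _ => 1 / ε ^ 2) s * flow ε (slowFreq ε) s := fun s => by
    rw [flow_mul_flow h0 (continuous_slowFreq ε), h1]
  have h3 : ∀ s, free ε s = flow ε (slowFreq ε) s * flow ε (fun _ => 1 / ε ^ 2) s := fun s => by
    rw [free, flow_mul_flow (continuous_slowFreq ε) h0, ← h1]
    simp only [add_comm]
  have h4 : ∀ s, flow ε (fun _ => 1 / ε ^ 2) s = (Real.cos (s * (1 / ε ^ 2)) : ℂ) • 1 -
      (Complex.I * Real.sin (s * (1 / ε ^ 2))) • unitOp ε := fun s => by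
    refine (isMul_flow h0 s).eq ?_
    exact (IsMul.one.smul _).sub ((isMul_unitOp ε).smul _)
  have h5 : Commute (flow ε (fun _ => 1 / ε ^ 2) (-r)) (diagPart ε W) := by
    rw [h4]
    exact ((Commute.one_left _).smul_left _).sub_left ((diagPart_commute ε W).smul_left _)
  rw [conj, h3 (-r), h2 r]
  calc _ = flow ε (slowFreq ε) (-r) * (flow ε (fun _ => 1 / ε ^ 2) (-r) * diagPart ε W) *
        flow ε (fun _ => 1 / ε ^ 2) r * flow ε (slowFreq ε) r := by noncomm_ring
    _ = flow ε (slowFreq ε) (-r) * diagPart ε W * (flow ε (fun _ => 1 / ε ^ 2) (-r) *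
        flow ε (fun _ => 1 / ε ^ 2) r) * flow ε (slowFreq ε) r := by
      rw [h5.eq]
      noncomm_ring
    _ = _ := by rw [flow_neg_mul_flow h0, mul_one, conj]

section diag

variable {C N : ℝ} {W : SpinorL2 →L[ℂ] SpinorL2} {f : SpinorL2}

/-- Each increment of the slow group costs one weight, with a constant independent of `ε`. The
increments to the left and to the right of the operator contribute `40` each. -/
theorem norm_conj_diagPart_sub_le (hε : 0 < ε) (hW : SobBdd C W) (hf : Sob 2 N f) (r h : ℝ) :
    ‖conj (free ε) (r + h) (diagPart ε W) f - conj (free ε) r (diagPart ε W) f‖ ≤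
      80 * C * |h| * N := by
  rw [conj_free_diagPart, conj_free_diagPart]
  have hφ := continuous_slowFreq ε
  have hD := hW.diagPart ε
  refine norm_conj_diff_le hφ (fun f hf => ?_) r hf
  rw [conj_flow_sub_eq]
  have h1 := (hD 1 (by norm_num) _ _ ((hf.of_le one_le_two).flow (ε := ε) hφ h)).flow_sub_one
    (ε := ε) (j := 0) hφ (by norm_num) (abs_slowFreq_le hε) (-h)
  have h2 := hD 0 (by norm_num) _ _ ((hf.of_le one_le_two).flow_sub_one
    (ε := ε) (j := 0) hφ (by norm_num) (abs_slowFreq_le hε) h)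
  rw [abs_neg] at h1
  refine (h1.add h2).norm_le.trans (le_of_eq ?_)
  ring

/-- Two terms carry a second difference (`400` each), two carry a product of first differences
(`40²` each). -/
theorem norm_conj_diagPart_second_le (hε : 0 < ε) (hW : SobBdd C W) (hf : Sob 2 N f) (r h : ℝ) :
    ‖conj (free ε) (r + h) (diagPart ε W) f + conj (free ε) (r - h) (diagPart ε W) f -
      (2 : ℂ) • conj (free ε) r (diagPart ε W) f‖ ≤ 4000 * C * h ^ 2 * N := by
  rw [conj_free_diagPart, conj_free_diagPart, conj_free_diagPart]
  have hφ := continuous_slowFreq ε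
  have hD := hW.diagPart ε
  refine norm_conj_second_diff_le hφ (fun f hf => ?_) r hf
  rw [conj_flow_second_eq]
  have h1 := (hD 2 le_rfl _ _ hf).flow_second (ε := ε) (j := 0) hφ (by norm_num)
    (slowFreq_sq_le hε) h
  have h2 := hD 0 (by norm_num) _ _ (hf.flow_second (ε := ε) (j := 0) hφ (by norm_num)
    (slowFreq_sq_le hε) h)
  have h3 : ∀ h, Sob 0 _ ((flow ε (slowFreq ε) (-h) - 1)
      (diagPart ε W ((flow ε (slowFreq ε) h - 1) f))) := fun h =>
    (hD 1 (by norm_num) _ _ (hf.flow_sub_one (ε := ε) (j := 1) hφ (by norm_num)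
      (abs_slowFreq_le hε) h)).flow_sub_one (ε := ε) (j := 0) hφ (by norm_num)
      (abs_slowFreq_le hε) (-h)
  have h4 := h3 h
  have h5 := h3 (-h)
  rw [neg_neg] at h5
  refine (((h1.add h2).add h4).add h5).norm_le.trans (le_of_eq ?_)
  rw [abs_neg, ← sq_abs h]
  ring

end diag

section off

variable {C N : ℝ} {W : SpinorL2 →L[ℂ] SpinorL2} {f : SpinorL2}

/-- An increment of the free group costs `ε⁻²`, and the off-diagonal part returns a factor `ε`. The
left increment contributes `24` and the right one, which spends a weight before the off-diagonal
part spends the other, contributes `80`. -/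
theorem norm_conj_offPart_sub_le (hε : 0 < ε) (hε1 : ε ≤ 1) (hW : SobBdd C W)
    (hc : Commute W pauliOp₃) (hf : Sob 2 N f) (r h : ℝ) :
    ‖conj (free ε) (r + h) (offPart ε W) f - conj (free ε) r (offPart ε W) f‖ ≤
      104 * C * |h| / ε * N := by
  have hφ := continuous_freq ε
  have hO := hW.offPart ε
  refine norm_conj_diff_le hφ (fun f hf => ?_) r hf
  rw [conj_flow_sub_eq]
  have hf1 := (hf.of_le one_le_two).flow (ε := ε) hφ h
  have h1 := norm_free_sub_one_le hε (-h) (norm_offPart_apply_le hε.le hW hc hf1)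
    (hO 1 (by norm_num) _ _ hf1)
  have h2 := norm_offPart_apply_le hε.le hW hc (hf.flow_sub_one
    (ε := ε) (j := 1) hφ (by positivity) (abs_freq_le' hε hε1) h)
  rw [abs_neg] at h1
  refine (norm_add_le _ _).trans ((add_le_add h1 h2).trans (le_of_eq ?_))
  field_simp
  ring

/-- The same counting at second order gives `ε · ε⁻⁴`. The only term of order `ε⁻²` is absorbed by
`ε ≤ 1`. -/
theorem norm_conj_offPart_second_le (hε : 0 < ε) (hε1 : ε ≤ 1) (hC : 0 ≤ C) (hW : SobBdd C W)
    (hc : Commute W pauliOp₃) (hf : Sob 2 N f) (r h : ℝ) :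
    ‖conj (free ε) (r + h) (offPart ε W) f + conj (free ε) (r - h) (offPart ε W) f -
      (2 : ℂ) • conj (free ε) r (offPart ε W) f‖ ≤ 1000 * C * h ^ 2 / ε ^ 3 * N := by
  have hφ := continuous_freq ε
  have hO := hW.offPart ε
  refine norm_conj_second_diff_le hφ (fun f hf => ?_) r hf
  have hN := hf.nonneg
  rw [conj_flow_second_eq]
  have h1 := norm_free_second_le hε h (norm_offPart_apply_le hε.le hW hc (hf.of_le one_le_two))
    (hO 2 le_rfl _ _ hf)
  have h2 := norm_offPart_apply_le hε.le hW hc (hf.flow_second (ε := ε) (j := 1) hφ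
    (by positivity) (freq_sq_le hε hε1) h)
  have h3 : ∀ h, ‖(free ε (-h) - 1) (offPart ε W ((free ε h - 1) f))‖ ≤ _ := fun h => by
    have h4 := hf.flow_sub_one (ε := ε) (j := 1) hφ (by positivity) (abs_freq_le' hε hε1) h
    exact norm_free_sub_one_le hε (-h) (norm_offPart_apply_le hε.le hW hc h4)
      (hO 1 (by norm_num) _ _ h4)
  have h4 := h3 h
  have h5 := h3 (-h)
  rw [neg_neg] at h5
  rw [abs_neg] at h4 h5
  refine (norm_add_le _ _).trans ((add_le_add ((norm_add_le _ _).trans (add_le_add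
    ((norm_add_le _ _).trans (add_le_add h1 h2)) h4)) h5).trans ?_)
  have h6 : 16 * C * h ^ 2 / ε ^ 2 * N ≤ 16 * C * h ^ 2 / ε ^ 3 * N := by
    gcongr 16 * C * h ^ 2 / ?_ * N
    exact pow_le_pow_of_le_one hε.le hε1 (by norm_num)
  have h7 : 0 ≤ C * h ^ 2 / ε ^ 3 * N := by positivity
  refine le_trans (le_of_eq ?_) (show 16 * C * h ^ 2 / ε ^ 2 * N + 808 * (C * h ^ 2 / ε ^ 3 * N) ≤ _
    from ?_)
  · have : |h| * |h| = h ^ 2 := by rw [← sq_abs h, sq]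
    field_simp
    ring_nf
    simp only [sq_abs]
    ring
  · have h8 : 1000 * C * h ^ 2 / ε ^ 3 * N = 1000 * (C * h ^ 2 / ε ^ 3 * N) := by ring
    have h9 : 16 * C * h ^ 2 / ε ^ 3 * N = 16 * (C * h ^ 2 / ε ^ 3 * N) := by ring
    linarith

theorem norm_conj_offPart_le (hε : 0 < ε) (hW : SobBdd C W) (hc : Commute W pauliOp₃)
    (hf : Sob 2 N f) (r : ℝ) : ‖conj (free ε) r (offPart ε W) f‖ ≤ 8 * ε * C * N := by
  change ‖free ε (-r) (offPart ε W (free ε r f))‖ ≤ _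
  rw [norm_flow (continuous_freq ε)]
  exact norm_offPart_apply_le hε.le hW hc ((hf.of_le one_le_two).flow (continuous_freq ε) r)

end off


/-! ### One step of the splitting -/

/-- If the second differences of `u` are at most `K h²`, then linear interpolation on `[a, b]` has
an error of at most `K (b - a)² / 4`. -/
theorem norm_sub_interpolation_le {E : Type*} [NormedAddCommGroup E] [NormedSpace ℝ E] {u : ℝ → E}
    {a b K : ℝ} (hab : a < b) (hu : ContinuousOn u (Icc a b))
    (h : ∀ t h, t + h ∈ Icc a b → t - h ∈ Icc a b →
      ‖u (t + h) + u (t - h) - (2 : ℝ) • u t‖ ≤ K * h ^ 2)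
    {s : ℝ} (hs : s ∈ Icc a b) :
    ‖u s - (u a + ((s - a) / (b - a)) • (u b - u a))‖ ≤ K * (b - a) ^ 2 / 4 := by
  have hba : 0 < b - a := sub_pos.2 hab
  set v : ℝ → E := fun s => u s - (u a + ((s - a) / (b - a)) • (u b - u a)) with hv
  have hvc : ContinuousOn v (Icc a b) := by
    rw [hv]
    fun_prop
  have hva : v a = 0 := by simp [hv]
  have hvb : v b = 0 := by simp [hv, div_self hba.ne']
  -- A maximum principle: at a maximum `t` of `‖v‖`, take the second difference that reaches the
  -- nearer endpoint, where `v = 0`. The other point contributes at most `‖v t‖`, so `2‖v t‖ ≤ ‖v t‖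
  -- + Kr²` with `r ≤ (b - a)/2`.
  obtain ⟨t, ht, hmax⟩ := isCompact_Icc.exists_isMaxOn ⟨s, hs⟩ hvc.norm
  have hmax' : ∀ r ∈ Icc a b, ‖v r‖ ≤ ‖v t‖ := hmax
  refine (hmax' s hs).trans ?_
  have hK : 0 ≤ K := by
    have := (norm_nonneg _).trans (h ((a + b) / 2) ((b - a) / 2)
      ⟨by linarith, by linarith⟩ ⟨by linarith, by linarith⟩)
    exact nonneg_of_mul_nonneg_left this (by positivity)
  have hdiff : ∀ r, t + r ∈ Icc a b → t - r ∈ Icc a b →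
      ‖v (t + r) + v (t - r) - (2 : ℝ) • v t‖ ≤ K * r ^ 2 := fun r h1 h2 => by
    have : v (t + r) + v (t - r) - (2 : ℝ) • v t = u (t + r) + u (t - r) - (2 : ℝ) • u t := by
      simp only [hv]
      module
    rw [this]
    exact h t r h1 h2
  have key : ∀ r, t + r ∈ Icc a b → t - r ∈ Icc a b → |r| ≤ (b - a) / 2 →
      (v (t + r) = 0 ∨ v (t - r) = 0) → ‖v t‖ ≤ K * (b - a) ^ 2 / 4 := fun r h1 h2 h3 h4 => by
    have h5 := hdiff r h1 h2
    have h6 : ‖v (t + r) + v (t - r)‖ ≤ ‖v t‖ := by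
      rcases h4 with h4 | h4
      · rw [h4, zero_add]
        exact hmax' _ h2
      · rw [h4, add_zero]
        exact hmax' _ h1
    have h7 : ‖(2 : ℝ) • v t‖ = 2 * ‖v t‖ := by
      rw [norm_smul]
      norm_num
    have h8 : ‖(2 : ℝ) • v t‖ ≤ ‖v (t + r) + v (t - r)‖ +
        ‖v (t + r) + v (t - r) - (2 : ℝ) • v t‖ := by
      rw [← norm_neg (v (t + r) + v (t - r) - (2 : ℝ) • v t)]
      refine le_trans (le_of_eq ?_) (norm_add_le _ _)
      congr 1
      abel
    have h9 : r ^ 2 ≤ ((b - a) / 2) ^ 2 := by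
      rw [← sq_abs]
      exact pow_le_pow_left₀ (abs_nonneg _) h3 2
    nlinarith [mul_le_mul_of_nonneg_left h9 hK]
  rcases le_total t ((a + b) / 2) with h1 | h1
  · refine key (t - a) ⟨by linarith [ht.1], by linarith⟩ ⟨by linarith, by linarith [ht.2, ht.1]⟩ ?_
      (Or.inr ?_)
    · rw [abs_of_nonneg (by linarith [ht.1])]
      linarith
    · rw [sub_sub_cancel, hva]
  · refine key (b - t) ⟨by linarith [ht.1, ht.2], by linarith⟩
      ⟨by linarith, by linarith [ht.2, ht.1]⟩ ?_ (Or.inl ?_)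
    · rw [abs_of_nonneg (by linarith [ht.2])]
      linarith
    · rw [add_sub_cancel, hvb]

section step

variable {ε : ℝ} {Vop : ℝ → SpinorL2 →L[ℂ] SpinorL2}

theorem continuousOn_conj_free {X : Type*} [TopologicalSpace X] {s : X → ℝ}
    {W : X → SpinorL2 →L[ℂ] SpinorL2} {f : X → SpinorL2} {D : Set X} (hε : 0 < ε) (hε1 : ε ≤ 1)
    (hs : ContinuousOn s D) (hW : ContinuousOn W D) (hf : ContinuousOn f D) :
    ContinuousOn (fun x => conj (free ε) (s x) (W x) (f x)) D := by
  have h1 : ∃ c p, ∀ ξ, |freq ε ξ| ≤ c * wt ξ ^ p := ⟨_, _, abs_freq_le' hε hε1⟩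
  have hφ := continuous_freq ε
  exact continuous_flow_apply hφ h1 hs.neg (hW.clm_apply (continuous_flow_apply hφ h1 hs hf))

theorem norm_conj_free_apply_le (r : ℝ) (W : SpinorL2 →L[ℂ] SpinorL2) (f : SpinorL2) :
    ‖conj (free ε) r W f‖ ≤ ‖W‖ * ‖f‖ := by
  change ‖free ε (-r) (W (free ε r f))‖ ≤ _
  rw [norm_flow (continuous_freq ε)]
  refine (W.le_opNorm _).trans ?_
  rw [norm_flow (continuous_freq ε)]

theorem conj_mul (r : ℝ) (W W' : SpinorL2 →L[ℂ] SpinorL2) :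
    conj (free ε) r (W * W') = conj (free ε) r W * conj (free ε) r W' := by
  simp only [conj]
  calc _ = free ε (-r) * W * 1 * W' * free ε r := by noncomm_ring
    _ = _ := by
      rw [← flow_mul_flow_neg (continuous_freq ε) r]
      noncomm_ring

/-- Conjugation as a bounded linear map. -/
noncomputable def conjL (ε r : ℝ) :
    (SpinorL2 →L[ℂ] SpinorL2) →L[ℂ] (SpinorL2 →L[ℂ] SpinorL2) :=
  ContinuousLinearMap.mulLeftRight ℂ (SpinorL2 →L[ℂ] SpinorL2) (free ε (-r)) (free ε r)

theorem conj_sub (r : ℝ) (W W' : SpinorL2 →L[ℂ] SpinorL2) :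
    conj (free ε) r (W - W') = conj (free ε) r W - conj (free ε) r W' :=
  map_sub (conjL ε r) W W'

theorem conj_smul (r : ℝ) (c : ℂ) (W : SpinorL2 →L[ℂ] SpinorL2) :
    conj (free ε) r (c • W) = c • conj (free ε) r W :=
  map_smul (conjL ε r) c W

/-- The expansion of the exact solution over one time step, up to terms of third order. -/
theorem norm_step_expansion_le {ψ : ℝ → SpinorL2} {a τ M N L : ℝ} (hε : 0 < ε) (hε1 : ε ≤ 1)
    (hτ : 0 < τ) (hVc : ContinuousOn Vop (Icc a (a + τ)))
    (hVM : ∀ s ∈ Icc a (a + τ), ‖Vop s‖ ≤ M)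
    (hVL : ∀ s ∈ Icc a (a + τ), ∀ r ∈ Icc a (a + τ), ‖Vop s - Vop r‖ ≤ M * |s - r|)
    (hψc : ContinuousOn ψ (Icc a (a + τ))) (hψN : ∀ s ∈ Icc a (a + τ), ‖ψ s‖ ≤ N)
    (hψ : ∀ s ∈ Icc a (a + τ),
      ψ s = ψ a - Complex.I • ∫ r in a..s, conj (free ε) r (Vop r) (ψ r))
    (hL : ∀ s ∈ Icc a (a + τ), ∀ χ, χ = ψ a ∨ χ = conj (free ε) (a + τ / 2) (Vop (a + τ / 2)) (ψ a) →
      ‖conj (free ε) s (Vop s) χ - conj (free ε) (a + τ / 2) (Vop s) χ‖ ≤ L) :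
    ‖ψ (a + τ) - (ψ a - Complex.I • (∫ s in a..(a + τ), conj (free ε) s (Vop s) (ψ a)) -
      ((τ ^ 2 / 2 : ℝ) : ℂ) • conj (free ε) (a + τ / 2) (Vop (a + τ / 2))
        (conj (free ε) (a + τ / 2) (Vop (a + τ / 2)) (ψ a)))‖ ≤
      (M ^ 3 * N + 2 * M ^ 2 * N) * τ ^ 3 + (M + 1) * τ ^ 2 * L := by
  set m := a + τ / 2 with hm
  set b := a + τ with hb
  set φ := ψ a with hφ
  set A : ℝ → SpinorL2 →L[ℂ] SpinorL2 := fun s => conj (free ε) s (Vop s) with hA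
  set Am := conj (free ε) m (Vop m) with hAm
  have haI : a ∈ Icc a b := ⟨le_rfl, by linarith⟩
  have hmI : m ∈ Icc a b := ⟨by linarith, by linarith⟩
  have hbI : b ∈ Icc a b := ⟨by linarith, le_rfl⟩
  have hM : 0 ≤ M := (norm_nonneg _).trans (hVM a haI)
  have hN : 0 ≤ N := (norm_nonneg _).trans (hψN a haI)
  have hcA : ∀ {f : ℝ → SpinorL2}, ContinuousOn f (Icc a b) →
      ContinuousOn (fun s => A s (f s)) (Icc a b) := fun hf =>
    continuousOn_conj_free hε hε1 continuousOn_id hVc hf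
  have hint : ∀ {f : ℝ → SpinorL2} {s : ℝ}, ContinuousOn f (Icc a b) → s ∈ Icc a b →
      IntervalIntegrable f volume a s := fun hf hs =>
    (hf.mono (by rw [uIcc_of_le hs.1]; exact Icc_subset_Icc_right hs.2)).intervalIntegrable
  have hA_le : ∀ s ∈ Icc a b, ∀ f, ‖A s f‖ ≤ M * ‖f‖ := fun s hs f =>
    (norm_conj_free_apply_le s (Vop s) f).trans
      (mul_le_mul_of_nonneg_right (hVM s hs) (norm_nonneg f))
  have h_sub : ∀ {s r : ℝ}, s ∈ Icc a b → r ∈ uIoc a s → r ∈ Icc a b := fun hs hr => by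
    rw [uIoc_of_le hs.1] at hr
    exact ⟨hr.1.le, hr.2.trans hs.2⟩
  -- Picard iteration: this bound feeds the first-order expansion `h3`, and that one feeds the
  -- second-order expansion.
  have h1 : ∀ s ∈ Icc a b, ‖ψ s - φ‖ ≤ M * N * τ := fun s hs => by
    rw [hψ s hs, sub_sub_cancel_left, norm_neg, norm_smul, Complex.norm_I, one_mul]
    refine (intervalIntegral.norm_integral_le_of_norm_le_const (C := M * N) fun r hr => ?_).trans ?_
    · have hr' := h_sub hs hr
      exact (hA_le r hr' _).trans (mul_le_mul_of_nonneg_left (hψN r hr') hM)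
    · rw [abs_of_nonneg (by linarith [hs.1])]
      exact mul_le_mul_of_nonneg_left (by linarith [hs.2]) (by positivity)
  -- Freezing at the midpoint costs `L` for the conjugation and `Mτ` for the potential. Only these
  -- two vectors occur, which is why `L` is assumed for them alone.
  have h2 : ∀ s ∈ Icc a b, ∀ χ, χ = φ ∨ χ = Am φ → ‖A s χ - Am χ‖ ≤ L + M * τ * ‖χ‖ :=
    fun s hs χ hχ => by
    have h3 : A s χ - Am χ = (A s χ - conj (free ε) m (Vop s) χ) +
        conj (free ε) m (Vop s - Vop m) χ := by
      rw [conj_sub, sub_apply]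
      abel
    rw [h3]
    refine (norm_add_le _ _).trans (add_le_add (hL s hs χ hχ) ?_)
    refine (norm_conj_free_apply_le _ _ _).trans (mul_le_mul_of_nonneg_right ?_ (norm_nonneg χ))
    refine (hVL s hs m hmI).trans (mul_le_mul_of_nonneg_left ?_ hM)
    rw [abs_le]
    constructor <;> linarith [hs.1, hs.2]
  have hconst : ∀ s, (∫ r in a..s, Am φ) = ((s - a : ℝ) : ℂ) • Am φ := fun s => by
    rw [intervalIntegral.integral_const]
    exact (Complex.coe_smul _ _).symm
  have hφN : ‖φ‖ ≤ N := hψN a haI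
  have hAmφ : ‖Am φ‖ ≤ M * N :=
    (hA_le m hmI φ).trans (mul_le_mul_of_nonneg_left hφN hM)
  have h3 : ∀ s ∈ Icc a b, ‖ψ s - (φ - (Complex.I * (s - a : ℝ)) • Am φ)‖ ≤
      τ * (M * (M * N * τ) + L + M * τ * N) := fun s hs => by
    have h4 : ψ s - (φ - (Complex.I * (s - a : ℝ)) • Am φ) =
        -(Complex.I • ∫ r in a..s, (A r (ψ r) - Am φ)) := by
      rw [intervalIntegral.integral_sub (hint (hcA hψc) hs) (hint continuousOn_const hs), hconst,
        hψ s hs]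
      module
    rw [h4, norm_neg, norm_smul, Complex.norm_I, one_mul]
    refine (intervalIntegral.norm_integral_le_of_norm_le_const
      (C := M * (M * N * τ) + L + M * τ * N) fun r hr => ?_).trans ?_
    · have hr' := h_sub hs hr
      have h5 : A r (ψ r) - Am φ = A r (ψ r - φ) + (A r φ - Am φ) := by
        rw [map_sub]
        abel
      rw [h5]
      have h6 := (hA_le r hr' (ψ r - φ)).trans (mul_le_mul_of_nonneg_left (h1 r hr') hM)
      have h7 := (h2 r hr' φ (Or.inl rfl)).trans
        (add_le_add_right (mul_le_mul_of_nonneg_left hφN (by positivity)) L)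
      refine (norm_add_le _ _).trans ?_
      linarith
    · have hL0 : 0 ≤ L := (norm_nonneg _).trans (hL a haI φ (Or.inl rfl))
      rw [abs_of_nonneg (by linarith [hs.1]), mul_comm]
      exact mul_le_mul_of_nonneg_right (by linarith [hs.2]) (by positivity)
  have hscal : ContinuousOn (fun s => (Complex.I * (s - a : ℝ)) • Am (Am φ)) (Icc a b) := by
    fun_prop
  have h4 : ψ b - (φ - Complex.I • (∫ s in a..b, A s φ) - ((τ ^ 2 / 2 : ℝ) : ℂ) • Am (Am φ)) =
      -(Complex.I • ∫ s in a..b, (A s (ψ s) - A s φ + (Complex.I * (s - a : ℝ)) • Am (Am φ))) := by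
    have h5 : (∫ s in a..b, (Complex.I * (s - a : ℝ)) • Am (Am φ)) =
        (Complex.I * (τ ^ 2 / 2 : ℝ)) • Am (Am φ) := by
      rw [intervalIntegral.integral_smul_const]
      congr 1
      rw [intervalIntegral.integral_const_mul, intervalIntegral.integral_ofReal]
      congr 2
      simp only [intervalIntegral.integral_comp_sub_right (fun x => x), integral_id, hb]
      ring
    rw [intervalIntegral.integral_add ((hint (hcA hψc) hbI).sub (hint (hcA continuousOn_const) hbI))
      (hint hscal hbI), intervalIntegral.integral_sub (hint (hcA hψc) hbI)
      (hint (hcA continuousOn_const) hbI), h5, hψ b hbI, smul_add, smul_smul, ← mul_assoc,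
      Complex.I_mul_I]
    module
  rw [h4, norm_neg, norm_smul, Complex.norm_I, one_mul]
  refine (intervalIntegral.norm_integral_le_of_norm_le_const
    (C := M * (τ * (M * (M * N * τ) + L + M * τ * N)) + τ * (L + M * τ * (M * N)))
    fun s hs => ?_).trans (le_of_eq ?_)
  · have hs' := h_sub hbI hs
    have h5 : A s (ψ s) - A s φ + (Complex.I * (s - a : ℝ)) • Am (Am φ) =
        A s (ψ s - (φ - (Complex.I * (s - a : ℝ)) • Am φ)) -
          (Complex.I * (s - a : ℝ)) • (A s (Am φ) - Am (Am φ)) := by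
      simp only [map_sub, map_smul]
      module
    rw [h5]
    refine (norm_sub_le _ _).trans (add_le_add ?_ ?_)
    · exact (hA_le s hs' _).trans (mul_le_mul_of_nonneg_left (h3 s hs') hM)
    · have h6 := (h2 s hs' (Am φ) (Or.inr rfl)).trans
        (add_le_add_right (mul_le_mul_of_nonneg_left hAmφ (by positivity)) L)
      have h7 : ‖Complex.I * ((s - a : ℝ) : ℂ)‖ ≤ τ := by
        rw [norm_mul, Complex.norm_I, one_mul, Complex.norm_real, Real.norm_of_nonneg
          (by linarith [hs'.1])]
        linarith [hs'.2]
      rw [norm_smul]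
      exact mul_le_mul h7 h6 (norm_nonneg _) hτ.le
  · rw [hb, add_sub_cancel_left, abs_of_pos hτ]
    ring


/-- The expansion of the splitting over one time step, up to terms of third order. -/
theorem norm_conj_exp_sub_le {P : SpinorL2 →L[ℂ] SpinorL2} {a τ M : ℝ} (hτ : 0 < τ)
    (hVc : ContinuousOn Vop (Icc a (a + τ)))
    (hVM : ∀ s ∈ Icc a (a + τ), ‖Vop s‖ ≤ M)
    (hVL : ∀ s ∈ Icc a (a + τ), ∀ r ∈ Icc a (a + τ), ‖Vop s - Vop r‖ ≤ M * |s - r|)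
    (hP : ‖P - (1 - Complex.I • (∫ s in a..(a + τ), Vop s) -
      (1 / 2 : ℂ) • ((∫ s in a..(a + τ), Vop s) * ∫ s in a..(a + τ), Vop s))‖ ≤ (M * τ) ^ 3)
    (f : SpinorL2) :
    ‖conj (free ε) (a + τ / 2) P f -
      (f - Complex.I • conj (free ε) (a + τ / 2) (∫ s in a..(a + τ), Vop s) f -
      ((τ ^ 2 / 2 : ℝ) : ℂ) • conj (free ε) (a + τ / 2) (Vop (a + τ / 2))
        (conj (free ε) (a + τ / 2) (Vop (a + τ / 2)) f))‖ ≤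
      (M ^ 3 + M ^ 2) * τ ^ 3 * ‖f‖ := by
  set m := a + τ / 2 with hm
  set Y := ∫ s in a..(a + τ), Vop s with hY
  have haI : a ∈ Icc a (a + τ) := ⟨le_rfl, by linarith⟩
  have hmI : m ∈ Icc a (a + τ) := ⟨by linarith, by linarith⟩
  have hM : 0 ≤ M := (norm_nonneg _).trans (hVM a haI)
  have h_mem : ∀ {r : ℝ}, r ∈ uIoc a (a + τ) → r ∈ Icc a (a + τ) := fun hr => by
    rw [uIoc_of_le haI.2] at hr
    exact ⟨hr.1.le, hr.2⟩
  have hint : IntervalIntegrable Vop volume a (a + τ) :=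
    (hVc.mono (by rw [uIcc_of_le haI.2])).intervalIntegrable
  have hYM : ‖Y‖ ≤ M * τ := by
    refine (intervalIntegral.norm_integral_le_of_norm_le_const fun r hr => hVM r (h_mem hr)).trans ?_
    rw [add_sub_cancel_left, abs_of_pos hτ]
  -- First order is enough, because this only enters the quadratic term, where the other factor is
  -- already `O(τ)`.
  have hYm : ‖Y - (τ : ℂ) • Vop m‖ ≤ M * τ ^ 2 := by
    have h1 : Y - (τ : ℂ) • Vop m = ∫ s in a..(a + τ), (Vop s - Vop m) := by
      rw [intervalIntegral.integral_sub hint (by simp), intervalIntegral.integral_const,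
        add_sub_cancel_left]
      rfl
    rw [h1]
    refine (intervalIntegral.norm_integral_le_of_norm_le_const (C := M * τ) fun r hr => ?_).trans
      (le_of_eq ?_)
    · have hr' := h_mem hr
      refine (hVL r hr' m hmI).trans (mul_le_mul_of_nonneg_left ?_ hM)
      rw [abs_le]
      constructor <;> linarith [hr'.1, hr'.2]
    · rw [add_sub_cancel_left, abs_of_pos hτ]
      ring
  have hYY : ‖(1 / 2 : ℂ) • (Y * Y) - ((τ ^ 2 / 2 : ℝ) : ℂ) • (Vop m * Vop m)‖ ≤ M ^ 2 * τ ^ 3 := by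
    have h1 : (1 / 2 : ℂ) • (Y * Y) - ((τ ^ 2 / 2 : ℝ) : ℂ) • (Vop m * Vop m) =
        (1 / 2 : ℂ) • ((Y - (τ : ℂ) • Vop m) * Y + (τ : ℂ) • (Vop m * (Y - (τ : ℂ) • Vop m))) := by
      simp only [sub_mul, mul_sub, smul_mul_assoc, mul_smul_comm]
      push_cast
      module
    rw [h1, norm_smul]
    have h2 : ‖(Y - (τ : ℂ) • Vop m) * Y‖ ≤ M * τ ^ 2 * (M * τ) :=
      (norm_mul_le _ _).trans (mul_le_mul hYm hYM (norm_nonneg _) (by positivity))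
    have h3 : ‖(τ : ℂ) • (Vop m * (Y - (τ : ℂ) • Vop m))‖ ≤ τ * (M * (M * τ ^ 2)) := by
      rw [norm_smul, Complex.norm_real, Real.norm_of_nonneg hτ.le]
      refine mul_le_mul_of_nonneg_left ?_ hτ.le
      exact (norm_mul_le _ _).trans (mul_le_mul (hVM m hmI) hYm (norm_nonneg _) hM)
    have h4 := norm_add_le ((Y - (τ : ℂ) • Vop m) * Y) ((τ : ℂ) • (Vop m * (Y - (τ : ℂ) • Vop m)))
    have h5 : ‖(1 / 2 : ℂ)‖ = 1 / 2 := by norm_num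
    rw [h5]
    nlinarith
  have h1 : conj (free ε) m P f - (f - Complex.I • conj (free ε) m Y f -
      ((τ ^ 2 / 2 : ℝ) : ℂ) • conj (free ε) m (Vop m) (conj (free ε) m (Vop m) f)) =
      conj (free ε) m (P - (1 - Complex.I • Y - (1 / 2 : ℂ) • (Y * Y))) f -
      conj (free ε) m ((1 / 2 : ℂ) • (Y * Y) - ((τ ^ 2 / 2 : ℝ) : ℂ) • (Vop m * Vop m)) f := by
    have h2 : conj (free ε) m 1 = 1 := by
      rw [conj, mul_one, flow_neg_mul_flow (continuous_freq ε)]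
    simp only [conj_sub, conj_smul, conj_mul, h2, sub_apply, smul_apply, mul_apply_eq_comp,
      one_apply_eq_self]
    abel
  rw [h1]
  refine (norm_sub_le _ _).trans ?_
  have h2 := (norm_conj_free_apply_le (ε := ε) m _ f).trans
    (mul_le_mul_of_nonneg_right hP (norm_nonneg f))
  have h3 := (norm_conj_free_apply_le (ε := ε) m _ f).trans
    (mul_le_mul_of_nonneg_right hYY (norm_nonneg f))
  refine (add_le_add h2 h3).trans (le_of_eq ?_)
  ring

/-- The quadrature error of the midpoint rule for the conjugates of the potential. -/
theorem norm_quadrature_sub_le {φ : SpinorL2} {a τ K η : ℝ} (hε : 0 < ε) (hε1 : ε ≤ 1)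
    (hτ : 0 < τ) (hVc : ContinuousOn Vop (Icc a (a + τ)))
    (Γ : (SpinorL2 →L[ℂ] SpinorL2) →L[ℂ] (SpinorL2 →L[ℂ] SpinorL2))
    (hη : ∀ s ∈ Icc a (a + τ), ∀ r, ‖conj (free ε) r (Vop s - Γ (Vop s)) φ‖ ≤ η)
    (hK : ∀ s ∈ Icc a (a + τ), ∀ r h, ‖conj (free ε) (r + h) (Γ (Vop s)) φ +
      conj (free ε) (r - h) (Γ (Vop s)) φ - (2 : ℂ) • conj (free ε) r (Γ (Vop s)) φ‖ ≤ K * h ^ 2) :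
    ‖(∫ s in a..(a + τ), conj (free ε) s (Vop s) φ) -
      conj (free ε) (a + τ / 2) (∫ s in a..(a + τ), Vop s) φ -
      ((τ⁻¹ : ℝ) : ℂ) •
        (conj (free ε) (a + τ)
          (∫ s in a..(a + τ), ((s - (a + τ / 2) : ℝ) : ℂ) • Γ (Vop s)) φ -
        conj (free ε) a
          (∫ s in a..(a + τ), ((s - (a + τ / 2) : ℝ) : ℂ) • Γ (Vop s)) φ)‖ ≤
      2 * η * τ + K * τ ^ 3 / 2 := by
  set m := a + τ / 2 with hm
  set b := a + τ with hb
  have hab : a ≤ b := by linarith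
  have hmI : m ∈ Icc a b := ⟨by linarith, by linarith⟩
  have h_mem : ∀ {r : ℝ}, r ∈ uIoc a b → r ∈ Icc a b := fun hr => by
    rw [uIoc_of_le hab] at hr
    exact ⟨hr.1.le, hr.2⟩
  have hint : ∀ {F : Type} [NormedAddCommGroup F] {f : ℝ → F}, ContinuousOn f (Icc a b) →
      IntervalIntegrable f volume a b := fun hf =>
    (hf.mono (by rw [uIcc_of_le hab])).intervalIntegrable
  have hc1 : ContinuousOn (fun s => conj (free ε) s (Vop s) φ) (Icc a b) :=
    continuousOn_conj_free hε hε1 continuousOn_id hVc continuousOn_const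
  have hc2 : ∀ r, ContinuousOn (fun s => conj (free ε) r (Vop s) φ) (Icc a b) := fun r =>
    continuousOn_conj_free hε hε1 continuousOn_const hVc continuousOn_const
  have hcΓ : ContinuousOn (fun s => ((s - m : ℝ) : ℂ) • Γ (Vop s)) (Icc a b) := by
    fun_prop
  have hcΓ' : ∀ r, ContinuousOn (fun s => ((s - m : ℝ) : ℂ) • conj (free ε) r (Γ (Vop s)) φ)
      (Icc a b) := fun r =>
    ContinuousOn.smul (f := fun s : ℝ => ((s - m : ℝ) : ℂ)) (by fun_prop) (continuousOn_conj_free hε hε1 continuousOn_const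
      (Γ.continuous.comp_continuousOn hVc) continuousOn_const)
  let ev : ℝ → (SpinorL2 →L[ℂ] SpinorL2) →L[ℂ] SpinorL2 := fun r =>
    (ContinuousLinearMap.apply ℂ SpinorL2 φ).comp (conjL ε r)
  have hev : ∀ r W, ev r W = conj (free ε) r W φ := fun r W => rfl
  have h1 : conj (free ε) m (∫ s in a..b, Vop s) φ = ∫ s in a..b, conj (free ε) m (Vop s) φ := by
    rw [← hev, ← ContinuousLinearMap.intervalIntegral_comp_comm _ (hint hVc)]
    rfl
  have h2 : ∀ r, conj (free ε) r (∫ s in a..b, ((s - m : ℝ) : ℂ) • Γ (Vop s)) φ =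
      ∫ s in a..b, ((s - m : ℝ) : ℂ) • conj (free ε) r (Γ (Vop s)) φ := fun r => by
    rw [← hev, ← ContinuousLinearMap.intervalIntegral_comp_comm _ (hint hcΓ)]
    simp only [hev, conj_smul, smul_apply]
  have hc3 : ContinuousOn (fun s => conj (free ε) s (Vop s) φ - conj (free ε) m (Vop s) φ)
      (Icc a b) := hc1.sub (hc2 m)
  have hc4 : ContinuousOn (fun s => ((τ⁻¹ : ℝ) : ℂ) • (((s - m : ℝ) : ℂ) •
      conj (free ε) b (Γ (Vop s)) φ - ((s - m : ℝ) : ℂ) • conj (free ε) a (Γ (Vop s)) φ))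
      (Icc a b) := ((hcΓ' b).sub (hcΓ' a)).const_smul ((τ⁻¹ : ℝ) : ℂ)
  rw [h1, h2, h2, ← intervalIntegral.integral_sub (hint (hcΓ' b)) (hint (hcΓ' a)),
    ← intervalIntegral.integral_sub (hint hc1) (hint (hc2 m)), ← intervalIntegral.integral_smul,
    ← intervalIntegral.integral_sub (hint hc3) (hint hc4)]
  refine (intervalIntegral.norm_integral_le_of_norm_le_const (C := 2 * η + K * τ ^ 2 / 2)
    fun s hs => ?_).trans (le_of_eq ?_)
  · have hs' := h_mem hs
    -- For a fixed operator `Γ(V(s))` only the conjugation time varies. Interpolation at `s` and at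
    -- `m` turns `u s - u m` into `(s - m)/τ` times the increment over the whole step, up to
    -- `Kτ²/2`. The dependence of `V` on `s` is left alone, so no mixed regularity is needed.
    set u : ℝ → SpinorL2 := fun r => conj (free ε) r (Γ (Vop s)) φ with hu
    have huc : ContinuousOn u (Icc a b) :=
      continuousOn_conj_free hε hε1 continuousOn_id continuousOn_const continuousOn_const
    have h3 : ∀ r ∈ Icc a b, ‖u r - (u a + ((r - a) / (b - a)) • (u b - u a))‖ ≤
        K * (b - a) ^ 2 / 4 := fun r hr =>
      norm_sub_interpolation_le (by linarith) huc (fun t h _ _ => hK s hs' t h) hr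
    have h4 : ∀ r, conj (free ε) r (Vop s) φ = u r + conj (free ε) r (Vop s - Γ (Vop s)) φ :=
      fun r => by
        rw [conj_sub, sub_apply, hu]
        abel
    have h5 : conj (free ε) s (Vop s) φ - conj (free ε) m (Vop s) φ -
        ((τ⁻¹ : ℝ) : ℂ) • (((s - m : ℝ) : ℂ) • u b - ((s - m : ℝ) : ℂ) • u a) =
        (conj (free ε) s (Vop s - Γ (Vop s)) φ - conj (free ε) m (Vop s - Γ (Vop s)) φ) +
        ((u s - (u a + ((s - a) / (b - a)) • (u b - u a))) -
          (u m - (u a + ((m - a) / (b - a)) • (u b - u a)))) := by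
      rw [h4 s, h4 m, ← smul_sub, smul_smul, ← Complex.ofReal_mul]
      have h6 : ((τ⁻¹ * (s - m) : ℝ) : ℂ) • (u b - u a) = (τ⁻¹ * (s - m)) • (u b - u a) := rfl
      have h7 : τ⁻¹ * (s - m) = (s - a) / (b - a) - (m - a) / (b - a) := by
        rw [hb, add_sub_cancel_left]
        ring
      rw [h6, h7]
      module
    change ‖conj (free ε) s (Vop s) φ - conj (free ε) m (Vop s) φ -
        ((τ⁻¹ : ℝ) : ℂ) • (((s - m : ℝ) : ℂ) • u b - ((s - m : ℝ) : ℂ) • u a)‖ ≤ _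
    rw [h5]
    have h6 := h3 s hs'
    have h7 := h3 m hmI
    have h8 : b - a = τ := by linarith
    rw [h8] at h6 h7 ⊢
    have h9 := (norm_sub_le _ _).trans (add_le_add (hη s hs' s) (hη s hs' m))
    have h10 := (norm_sub_le _ _).trans (add_le_add h6 h7)
    refine (norm_add_le _ _).trans ((add_le_add h9 h10).trans (le_of_eq ?_))
    ring
  · rw [hb, add_sub_cancel_left, abs_of_pos hτ]
    ring

end step


/-! ### Moments of the potential and summation of the local errors -/

section global

variable {ε : ℝ} {Vop : ℝ → SpinorL2 →L[ℂ] SpinorL2}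

/-- The first moment of `Γ(V)` about the midpoint of `[a, a + τ]`. -/
noncomputable def moment (Vop : ℝ → SpinorL2 →L[ℂ] SpinorL2)
    (Γ : (SpinorL2 →L[ℂ] SpinorL2) →L[ℂ] (SpinorL2 →L[ℂ] SpinorL2)) (a τ : ℝ) :
    SpinorL2 →L[ℂ] SpinorL2 :=
  ∫ s in a..(a + τ), ((s - (a + τ / 2) : ℝ) : ℂ) • Γ (Vop s)

theorem integral_moment_const {F : Type*} [NormedAddCommGroup F] [NormedSpace ℂ F] [CompleteSpace F]
    (a τ : ℝ) (W : F) :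
    (∫ s in a..(a + τ), ((s - (a + τ / 2) : ℝ) : ℂ) • W) = 0 := by
  rw [intervalIntegral.integral_smul_const, intervalIntegral.integral_ofReal]
  simp only [intervalIntegral.integral_comp_sub_right (fun x => x), integral_id]
  have : ((a + τ - (a + τ / 2)) ^ 2 - (a - (a + τ / 2)) ^ 2) / 2 = 0 := by ring
  rw [this, Complex.ofReal_zero, zero_smul]

/-- The weight has mean zero about the midpoint, so the value of `G` there may be subtracted and
only its oscillation counts. -/
theorem norm_integral_moment_le {F : Type*} [NormedAddCommGroup F] [NormedSpace ℂ F]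
    [CompleteSpace F] {G : ℝ → F} {a τ c : ℝ} (hτ : 0 < τ) (hG : ContinuousOn G (Icc a (a + τ)))
    (h : ∀ s ∈ Icc a (a + τ), ‖G s - G (a + τ / 2)‖ ≤ c) :
    ‖∫ s in a..(a + τ), ((s - (a + τ / 2) : ℝ) : ℂ) • G s‖ ≤ τ ^ 2 * c := by
  have hab : a ≤ a + τ := by linarith
  have hint : ∀ {f : ℝ → F}, ContinuousOn f (Icc a (a + τ)) →
      IntervalIntegrable f volume a (a + τ) := fun hf =>
    (hf.mono (by rw [uIcc_of_le hab])).intervalIntegrable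
  have h1 : (∫ s in a..(a + τ), ((s - (a + τ / 2) : ℝ) : ℂ) • G s) =
      ∫ s in a..(a + τ), ((s - (a + τ / 2) : ℝ) : ℂ) • (G s - G (a + τ / 2)) := by
    simp only [smul_sub]
    rw [intervalIntegral.integral_sub (hint (by fun_prop)) (hint (by fun_prop)),
      integral_moment_const, sub_zero]
  rw [h1]
  refine (intervalIntegral.norm_integral_le_of_norm_le_const (C := τ * c) fun s hs => ?_).trans
    (le_of_eq ?_)
  · rw [uIoc_of_le hab] at hs
    rw [norm_smul, Complex.norm_real, Real.norm_eq_abs]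
    refine mul_le_mul ?_ (h s ⟨hs.1.le, hs.2⟩) (norm_nonneg _) hτ.le
    rw [abs_le]
    constructor <;> linarith [hs.1, hs.2]
  · rw [add_sub_cancel_left, abs_of_pos hτ]
    ring

variable {Γ : (SpinorL2 →L[ℂ] SpinorL2) →L[ℂ] (SpinorL2 →L[ℂ] SpinorL2)} {T M τ : ℝ}

/-- Multiplied by `τ⁻¹` and summed over the steps, this alone would give order `τ`. It is used for
the boundary terms and for products with another factor `τ`. -/
theorem norm_moment_le (hΓ : ∀ W, ‖Γ W‖ ≤ ‖W‖) (hM : 0 ≤ M) (hVc : ContinuousOn Vop (Icc 0 T))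
    (hVL : ∀ s ∈ Icc 0 T, ∀ r ∈ Icc 0 T, ‖Vop s - Vop r‖ ≤ M * |s - r|)
    {a : ℝ} (hτ : 0 < τ) (ha : 0 ≤ a) (hb : a + τ ≤ T) : ‖moment Vop Γ a τ‖ ≤ M * τ ^ 3 := by
  have hsub : Icc a (a + τ) ⊆ Icc 0 T := Icc_subset_Icc ha hb
  refine (norm_integral_moment_le (c := M * τ) hτ
    (Γ.continuous.comp_continuousOn (hVc.mono hsub)) fun s hs => ?_).trans (le_of_eq (by ring))
  rw [Function.comp_apply, Function.comp_apply, ← map_sub]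
  refine (hΓ _).trans ((hVL s (hsub hs) _ (hsub ⟨by linarith, by linarith⟩)).trans ?_)
  refine mul_le_mul_of_nonneg_left ?_ hM
  rw [abs_le]
  constructor <;> linarith [hs.1, hs.2]

/-- After a translation the difference is the moment of `V(s + τ) - V(s)`. The oscillation of that
function is a mixed second difference of `V`, which supplies the additional power of `τ`. -/
theorem norm_moment_sub_le (hΓ : ∀ W, ‖Γ W‖ ≤ ‖W‖) (hM : 0 ≤ M) (hVc : ContinuousOn Vop (Icc 0 T))
    (hV2 : ∀ t h, t + h ∈ Icc 0 T → t - h ∈ Icc 0 T →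
      ‖Vop (t + h) + Vop (t - h) - (2 : ℂ) • Vop t‖ ≤ M * h ^ 2)
    {a : ℝ} (hτ : 0 < τ) (ha : 0 ≤ a) (hb : a + τ + τ ≤ T) :
    ‖moment Vop Γ (a + τ) τ - moment Vop Γ a τ‖ ≤ M * τ ^ 4 := by
  have hsub : Icc a (a + τ) ⊆ Icc 0 T := Icc_subset_Icc ha (by linarith)
  have hmap : MapsTo (fun s => s + τ) (Icc a (a + τ)) (Icc 0 T) := fun s hs =>
    ⟨by linarith [hs.1], by linarith [hs.2]⟩
  have hc : ContinuousOn (fun s => Vop (s + τ)) (Icc a (a + τ)) :=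
    hVc.comp (by fun_prop) hmap
  have hc' := hVc.mono hsub
  have hab : a ≤ a + τ := by linarith
  have hint : ∀ {f : ℝ → SpinorL2 →L[ℂ] SpinorL2}, ContinuousOn f (Icc a (a + τ)) →
      IntervalIntegrable f volume a (a + τ) := fun hf =>
    (hf.mono (by rw [uIcc_of_le hab])).intervalIntegrable
  have h1 : moment Vop Γ (a + τ) τ - moment Vop Γ a τ =
      ∫ s in a..(a + τ), ((s - (a + τ / 2) : ℝ) : ℂ) • Γ (Vop (s + τ) - Vop s) := by
    have h2 : moment Vop Γ (a + τ) τ =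
        ∫ s in a..(a + τ), ((s - (a + τ / 2) : ℝ) : ℂ) • Γ (Vop (s + τ)) := by
      rw [moment, ← intervalIntegral.integral_comp_add_right
        (fun s => ((s - (a + τ + τ / 2) : ℝ) : ℂ) • Γ (Vop s))]
      refine intervalIntegral.integral_congr fun s _ => ?_
      have h3 : s + τ - (a + τ + τ / 2) = s - (a + τ / 2) := by ring
      simp only [h3]
    have h3 : ContinuousOn (fun s : ℝ => ((s - (a + τ / 2) : ℝ) : ℂ)) (Icc a (a + τ)) := by fun_prop
    simp only [map_sub, smul_sub]
    rw [h2, moment]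
    exact (intervalIntegral.integral_sub
      (hint (h3.smul (Γ.continuous.comp_continuousOn hc)))
      (hint (h3.smul (Γ.continuous.comp_continuousOn hc')))).symm
  rw [h1]
  refine (norm_integral_moment_le (G := fun s => Γ (Vop (s + τ) - Vop s)) (c := M * τ ^ 2) hτ
    (Γ.continuous.comp_continuousOn (hc.sub hc')) fun s hs => ?_).trans (le_of_eq (by ring))
  rw [← map_sub]
  refine (hΓ _).trans ?_
  set r := s - (a + τ / 2) with hr
  -- The pairs `(s + τ, m)` and `(s, m + τ)`, with `m` the midpoint of the step, share the centre
  -- `c`. The mixed difference is therefore a difference of two symmetric second differences about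
  -- `c`.
  set c := (s + τ + (a + τ / 2)) / 2 with hcc
  have hra : |r| ≤ τ / 2 := by
    rw [abs_le]
    constructor <;> linarith [hs.1, hs.2]
  have h3 := hV2 c ((r + τ) / 2)
  have h4 := hV2 c ((r - τ) / 2)
  have e1 : c + (r + τ) / 2 = s + τ := by rw [hcc, hr]; ring
  have e2 : c - (r + τ) / 2 = a + τ / 2 := by rw [hcc, hr]; ring
  have e3 : c + (r - τ) / 2 = s := by rw [hcc, hr]; ring
  have e4 : c - (r - τ) / 2 = a + τ / 2 + τ := by rw [hcc, hr]; ring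
  rw [e1, e2] at h3
  rw [e3, e4] at h4
  have h5 := h3 (hmap hs) (hsub ⟨by linarith, by linarith⟩)
  have h6 := h4 (hsub hs) (hmap ⟨by linarith, by linarith⟩)
  have h7 : Vop (s + τ) - Vop s - (Vop (a + τ / 2 + τ) - Vop (a + τ / 2)) =
      (Vop (s + τ) + Vop (a + τ / 2) - (2 : ℂ) • Vop c) -
      (Vop s + Vop (a + τ / 2 + τ) - (2 : ℂ) • Vop c) := by abel
  rw [h7]
  refine (norm_sub_le _ _).trans ((add_le_add h5 h6).trans ?_)
  have h8 : r ^ 2 ≤ τ ^ 2 := by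
    rw [← sq_abs]
    exact pow_le_pow_left₀ (abs_nonneg _) (by linarith) 2
  nlinarith [mul_le_mul_of_nonneg_left h8 hM]

/-- The error estimate for the splitting in the interaction picture. -/
theorem norm_interaction_error_le {ψ num : ℕ → SpinorL2} {Ψ : ℝ → SpinorL2}
    {P : ℕ → SpinorL2 →L[ℂ] SpinorL2} {N L K η : ℝ} (hε : 0 < ε) (hε1 : ε ≤ 1) (hτ : 0 < τ)
    (hVc : ContinuousOn Vop (Icc 0 T)) (hVM : ∀ s ∈ Icc 0 T, ‖Vop s‖ ≤ M)
    (hVL : ∀ s ∈ Icc 0 T, ∀ r ∈ Icc 0 T, ‖Vop s - Vop r‖ ≤ M * |s - r|)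
    (hV2 : ∀ t h, t + h ∈ Icc 0 T → t - h ∈ Icc 0 T →
      ‖Vop (t + h) + Vop (t - h) - (2 : ℂ) • Vop t‖ ≤ M * h ^ 2)
    (hψc : ContinuousOn Ψ (Icc 0 T)) (hψN : ∀ s ∈ Icc 0 T, ‖Ψ s‖ ≤ N)
    (hψ : ∀ a ∈ Icc 0 T, ∀ b ∈ Icc 0 T, a ≤ b →
      Ψ b = Ψ a - Complex.I • ∫ r in a..b, conj (free ε) r (Vop r) (Ψ r))
    (hΓ : ∀ W, ‖Γ W‖ ≤ ‖W‖)
    (hL : ∀ a ∈ Icc 0 T, ∀ s ∈ Icc 0 T, ∀ m ∈ Icc 0 T, |s - m| ≤ τ → ∀ χ,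
      χ = Ψ a ∨ χ = conj (free ε) m (Vop m) (Ψ a) →
      ‖conj (free ε) s (Vop s) χ - conj (free ε) m (Vop s) χ‖ ≤ L)
    (hη : ∀ a ∈ Icc 0 T, ∀ s ∈ Icc 0 T, ∀ r, ‖conj (free ε) r (Vop s - Γ (Vop s)) (Ψ a)‖ ≤ η)
    (hK : ∀ a ∈ Icc 0 T, ∀ s ∈ Icc 0 T, ∀ r h, ‖conj (free ε) (r + h) (Γ (Vop s)) (Ψ a) +
      conj (free ε) (r - h) (Γ (Vop s)) (Ψ a) - (2 : ℂ) • conj (free ε) r (Γ (Vop s)) (Ψ a)‖ ≤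
      K * h ^ 2)
    (hP1 : ∀ n : ℕ, (n + 1) * τ ≤ T → ∀ f, ‖P n f‖ ≤ ‖f‖)
    (hP2 : ∀ n : ℕ, (n + 1) * τ ≤ T → ‖P n - 1‖ ≤ M * τ)
    (hP3 : ∀ n : ℕ, (n + 1) * τ ≤ T → ‖P n - (1 - Complex.I • (∫ s in n * τ..(n * τ + τ), Vop s) -
      (1 / 2 : ℂ) • ((∫ s in n * τ..(n * τ + τ), Vop s) * ∫ s in n * τ..(n * τ + τ), Vop s))‖ ≤
      (M * τ) ^ 3)
    (hψn : ∀ n : ℕ, ψ n = Ψ (n * τ)) (hnum0 : num 0 = Ψ 0)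
    (hnum : ∀ n : ℕ, num (n + 1) = conj (free ε) (n * τ + τ / 2) (P n) (num n))
    (n : ℕ) (hn : n * τ ≤ T) :
    ‖ψ n - num n‖ ≤ 2 * M * N * τ ^ 2 + T * ((2 * M ^ 3 + 5 * M ^ 2 + M) * N * τ ^ 2 +
      (M + 1) * τ * L + 2 * η + K * τ ^ 2 / 2) := by
  have hT0 : 0 ≤ T := le_trans (by positivity) hn
  have h0 : (0 : ℝ) ∈ Icc 0 T := ⟨le_rfl, hT0⟩
  have hM : 0 ≤ M := (norm_nonneg _).trans (hVM 0 h0)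
  have hN : 0 ≤ N := (norm_nonneg _).trans (hψN 0 h0)
  have hL0 : 0 ≤ L := (norm_nonneg _).trans
    (hL 0 h0 0 h0 0 h0 (by simpa using hτ.le) (Ψ 0) (Or.inl rfl))
  have hη0 : 0 ≤ η := (norm_nonneg _).trans (hη 0 h0 0 h0 0)
  have hK0 : 0 ≤ K := by simpa using (norm_nonneg _).trans (hK 0 h0 0 h0 0 1)
  have hD : 0 ≤ (2 * M ^ 3 + 5 * M ^ 2 + M) * N * τ ^ 2 + (M + 1) * τ * L + 2 * η +
      K * τ ^ 2 / 2 := by positivity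
  rcases Nat.eq_zero_or_pos n with rfl | hn0
  · rw [hψn, hnum0, Nat.cast_zero, zero_mul, sub_self, norm_zero]
    positivity
  have hτT : τ ≤ T := by
    have : (1 : ℝ) ≤ n := by exact_mod_cast hn0
    nlinarith
  set X : ℕ → SpinorL2 →L[ℂ] SpinorL2 := fun k => moment Vop Γ (k * τ) τ with hX
  have hmem : ∀ k : ℕ, k ≤ n → (k : ℝ) * τ ∈ Icc 0 T := fun k hk => by
    have : (k : ℝ) ≤ n := by exact_mod_cast hk
    exact ⟨by positivity, by nlinarith⟩
  have hXk : ∀ k : ℕ, k < n → ‖X k‖ ≤ M * τ ^ 3 := fun k hk => by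
    have := (hmem (k + 1) hk).2
    push_cast at this
    exact norm_moment_le hΓ hM hVc hVL hτ (by positivity) (by linarith)
  -- Truncated subtraction makes the case `k = 0` trivial: the moment before the first step is taken
  -- to be the first one.
  have hXd : ∀ k : ℕ, k < n → ‖X (k - 1) - X k‖ ≤ M * τ ^ 4 := fun k hk => by
    cases k with
    | zero =>
      simp only [zero_tsub, sub_self, norm_zero]
      positivity
    | succ k =>
      have := (hmem (k + 1 + 1) hk).2
      push_cast at this
      have h1 : ((k + 1 : ℕ) : ℝ) * τ = k * τ + τ := by push_cast; ring
      rw [Nat.add_sub_cancel, norm_sub_rev]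
      simp only [hX, h1]
      exact norm_moment_sub_le hΓ hM hVc hV2 hτ (by positivity) (by linarith)
  -- Summation by parts: the error is corrected by the boundary term of the telescoping sum. The
  -- correction is `O(τ²)`, and it replaces the increments of the conjugates of `X k` by `X (k - 1)
  -- - X k`, which is `O(τ⁴)`.
  set z : ℕ → SpinorL2 := fun k => ψ k - num k +
    (Complex.I * (τ⁻¹ : ℝ)) • conj (free ε) (k * τ) (X (k - 1)) (ψ k) with hz
  have hcoef : ‖Complex.I * ((τ⁻¹ : ℝ) : ℂ)‖ = τ⁻¹ := by
    rw [norm_mul, Complex.norm_I, one_mul, Complex.norm_real, Real.norm_of_nonneg (by positivity)]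
  have hψk : ∀ k : ℕ, k ≤ n → ‖ψ k‖ ≤ N := fun k hk => by
    rw [hψn]
    exact hψN _ (hmem k hk)
  have hcorr : ∀ k : ℕ, k ≤ n →
      ‖(Complex.I * (τ⁻¹ : ℝ)) • conj (free ε) (k * τ) (X (k - 1)) (ψ k)‖ ≤ M * N * τ ^ 2 :=
    fun k hk => by
    rw [norm_smul, hcoef]
    have h1 := (norm_conj_free_apply_le (ε := ε) (k * τ) (X (k - 1)) (ψ k)).trans
      (mul_le_mul (hXk (k - 1) (by omega)) (hψk k hk) (norm_nonneg _) (by positivity))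
    refine (mul_le_mul_of_nonneg_left h1 (by positivity)).trans (le_of_eq ?_)
    field_simp
  set δ := τ * ((2 * M ^ 3 + 5 * M ^ 2 + M) * N * τ ^ 2 + (M + 1) * τ * L + 2 * η +
    K * τ ^ 2 / 2) with hδ
  have hstep : ∀ k : ℕ, k < n → ‖z (k + 1)‖ ≤ ‖z k‖ + δ := fun k hk => by
    have hk1 := hmem (k + 1) hk
    have hk0 := hmem k hk.le
    have ea : ((k + 1 : ℕ) : ℝ) * τ = k * τ + τ := by push_cast; ring
    rw [ea] at hk1
    have hkT : ((k : ℝ) + 1) * τ ≤ T := by linarith [hk1.2]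
    set a := (k : ℝ) * τ with ha
    have hsub : Icc a (a + τ) ⊆ Icc 0 T := Icc_subset_Icc hk0.1 hk1.2
    have hmI : a + τ / 2 ∈ Icc 0 T := hsub ⟨by linarith, by linarith⟩
    have h1 := norm_step_expansion_le (L := L) hε hε1 hτ (hVc.mono hsub)
      (fun s hs => hVM s (hsub hs)) (fun s hs r hr => hVL s (hsub hs) r (hsub hr)) (hψc.mono hsub)
      (fun s hs => hψN s (hsub hs)) (fun s hs => hψ a hk0 s (hsub hs) hs.1)
      (fun s hs χ hχ => hL a hk0 s (hsub hs) _ hmI (by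
        rw [abs_le]
        constructor <;> linarith [hs.1, hs.2]) χ hχ)
    have h2 := norm_conj_exp_sub_le (ε := ε) hτ (hVc.mono hsub)
      (fun s hs => hVM s (hsub hs)) (fun s hs r hr => hVL s (hsub hs) r (hsub hr)) (hP3 k hkT) (Ψ a)
    have h3 := norm_quadrature_sub_le (η := η) (K := K) (φ := Ψ a) hε hε1 hτ (hVc.mono hsub) Γ
      (fun s hs => hη a hk0 s (hsub hs)) (fun s hs => hK a hk0 s (hsub hs))
    set Q : SpinorL2 := ∫ s in a..(a + τ), conj (free ε) s (Vop s) (Ψ a)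
    set Am := conj (free ε) (a + τ / 2) (Vop (a + τ / 2))
    set Y := ∫ s in a..(a + τ), Vop s
    set B := conj (free ε) (a + τ / 2) (P k) with hB
    have hXa : (∫ s in a..(a + τ), ((s - (a + τ / 2) : ℝ) : ℂ) • Γ (Vop s)) = X k := rfl
    rw [hXa] at h3
    have hBle : ∀ f, ‖B f‖ ≤ ‖f‖ := fun f => by
      change ‖free ε (-(a + τ / 2)) (P k (free ε (a + τ / 2) f))‖ ≤ _
      rw [norm_flow (continuous_freq ε)]
      refine (hP1 k hkT _).trans (le_of_eq ?_)
      rw [norm_flow (continuous_freq ε)]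
    have hB1 : ∀ f, ‖B f - f‖ ≤ M * τ * ‖f‖ := fun f => by
      have h4 : B f - f = conj (free ε) (a + τ / 2) (P k - 1) f := by
        have h5 : conj (free ε) (a + τ / 2) 1 = 1 := by
          rw [conj, mul_one, flow_neg_mul_flow (continuous_freq ε)]
        rw [conj_sub, h5]
        rfl
      rw [h4]
      exact (norm_conj_free_apply_le _ _ _).trans
        (mul_le_mul_of_nonneg_right (hP2 k hkT) (norm_nonneg f))
    have hincr : ‖Ψ (a + τ) - Ψ a‖ ≤ M * N * τ := by
      rw [hψ a hk0 (a + τ) hk1 (by linarith), sub_sub_cancel_left, norm_neg, norm_smul,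
        Complex.norm_I, one_mul]
      refine (intervalIntegral.norm_integral_le_of_norm_le_const (C := M * N)
        fun r hr => ?_).trans (le_of_eq ?_)
      · rw [uIoc_of_le (by linarith)] at hr
        have hr' := hsub ⟨hr.1.le, hr.2⟩
        exact (norm_conj_free_apply_le r _ _).trans
          (mul_le_mul (hVM r hr') (hψN r hr') (norm_nonneg _) hM)
      · rw [add_sub_cancel_left, abs_of_pos hτ]
    set ca := conj (free ε) a
    set cb := conj (free ε) (a + τ)
    -- The six defects are: the expansion of the solution, the expansion of the splitting, the
    -- quadrature, the increment of `Ψ` under the moment, the change of the moment, and the action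
    -- of `B` on the correction. As `B` is a contraction, they only add up.
    have key : z (k + 1) = B (z k) +
        ((Ψ (a + τ) - (Ψ a - Complex.I • Q - ((τ ^ 2 / 2 : ℝ) : ℂ) • Am (Am (Ψ a)))) -
        (B (Ψ a) - (Ψ a - Complex.I • conj (free ε) (a + τ / 2) Y (Ψ a) -
          ((τ ^ 2 / 2 : ℝ) : ℂ) • Am (Am (Ψ a)))) -
        Complex.I • (Q - conj (free ε) (a + τ / 2) Y (Ψ a) -
          ((τ⁻¹ : ℝ) : ℂ) • (cb (X k) (Ψ a) - ca (X k) (Ψ a))) +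
        (Complex.I * (τ⁻¹ : ℝ)) • cb (X k) (Ψ (a + τ) - Ψ a) -
        (Complex.I * (τ⁻¹ : ℝ)) • ca (X (k - 1) - X k) (Ψ a) -
        (Complex.I * (τ⁻¹ : ℝ)) • (B (ca (X (k - 1)) (Ψ a)) - ca (X (k - 1)) (Ψ a))) := by
      have e1 : ψ (k + 1) = Ψ (a + τ) := by rw [hψn, ea]
      have e2 : ψ k = Ψ a := hψn k
      have e3 : ca (X (k - 1) - X k) = ca (X (k - 1)) - ca (X k) := conj_sub _ _ _
      simp only [hz, Nat.add_sub_cancel, ea, e1, e2, hnum k, e3]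
      simp only [map_add, map_sub, map_smul, sub_apply]
      module
    have b1 := (norm_conj_free_apply_le (ε := ε) (a + τ) (X k) (Ψ (a + τ) - Ψ a)).trans
      (mul_le_mul (hXk k hk) hincr (norm_nonneg _) (by positivity))
    have b2 := (norm_conj_free_apply_le (ε := ε) a (X (k - 1) - X k) (Ψ a)).trans
      (mul_le_mul (hXd k hk) (hψN a hk0) (norm_nonneg _) (by positivity))
    have b3 := (norm_conj_free_apply_le (ε := ε) a (X (k - 1)) (Ψ a)).trans
      (mul_le_mul (hXk (k - 1) (by omega)) (hψN a hk0) (norm_nonneg _) (by positivity))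
    have b4 := (hB1 (ca (X (k - 1)) (Ψ a))).trans (mul_le_mul_of_nonneg_left b3 (by positivity))
    have h2' := h2.trans (mul_le_mul_of_nonneg_left (hψN a hk0) (by positivity))
    rw [key]
    refine (norm_add_le _ _).trans (add_le_add (hBle _) ?_)
    have n1 : ‖Complex.I • (Q - conj (free ε) (a + τ / 2) Y (Ψ a) -
        ((τ⁻¹ : ℝ) : ℂ) • (cb (X k) (Ψ a) - ca (X k) (Ψ a)))‖ ≤ 2 * η * τ + K * τ ^ 3 / 2 := by
      rw [norm_smul, Complex.norm_I, one_mul]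
      exact h3
    have hsm : ∀ {f : SpinorL2} {c : ℝ}, ‖f‖ ≤ c →
        ‖(Complex.I * ((τ⁻¹ : ℝ) : ℂ)) • f‖ ≤ τ⁻¹ * c := fun {f c} hf => by
      rw [norm_smul, hcoef]
      exact mul_le_mul_of_nonneg_left hf (by positivity)
    refine (norm_sub_le _ _).trans ((add_le_add ((norm_sub_le _ _).trans (add_le_add
      ((norm_add_le _ _).trans (add_le_add ((norm_sub_le _ _).trans (add_le_add
      ((norm_sub_le _ _).trans (add_le_add h1 h2')) n1)) (hsm b1))) (hsm b2))) (hsm b4)).trans (le_of_eq ?_))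
    rw [hδ]
    field_simp
    ring
  have hzk : ∀ k : ℕ, k ≤ n → ‖z k‖ ≤ M * N * τ ^ 2 + k * δ := fun k => by
    induction k with
    | zero =>
      intro hk
      have h1 : ψ 0 - num 0 = 0 := by
        rw [hψn, hnum0, Nat.cast_zero, zero_mul, sub_self]
      simp only [hz]
      rw [h1, zero_add]
      simpa using hcorr 0 hk
    | succ k ih =>
      intro hk
      refine (hstep k hk).trans ?_
      have := ih (by omega)
      push_cast
      linarith
  have h1 : ψ n - num n = z n -
      (Complex.I * (τ⁻¹ : ℝ)) • conj (free ε) (n * τ) (X (n - 1)) (ψ n) := by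
    simp only [hz]
    abel
  have h2 := hzk n le_rfl
  have h3 := hcorr n le_rfl
  rw [h1]
  refine (norm_sub_le _ _).trans ((add_le_add h2 h3).trans ?_)
  have h4 := mul_le_mul_of_nonneg_right hn hD
  rw [hδ]
  linarith

end global


/-! ### The Fourier transform on `(L²(ℝ))²` -/

section fourier

open SchwartzMap

/-- The Fourier transform as a bounded operator. -/
noncomputable def ft : SpinorL2 →L[ℂ] SpinorL2 :=
  ((Lp.fourierTransformₗᵢ ℝ Spinor).toContinuousLinearEquiv : SpinorL2 →L[ℂ] SpinorL2)

/-- The inverse Fourier transform as a bounded operator. -/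
noncomputable def ift : SpinorL2 →L[ℂ] SpinorL2 :=
  ((Lp.fourierTransformₗᵢ ℝ Spinor).symm.toContinuousLinearEquiv : SpinorL2 →L[ℂ] SpinorL2)

theorem ft_apply (f : SpinorL2) : ft f = 𝓕 f := rfl

theorem ift_ft (f : SpinorL2) : ift (ft f) = f := (Lp.fourierTransformₗᵢ ℝ Spinor).symm_apply_apply f

theorem ft_ift (f : SpinorL2) : ft (ift f) = f := (Lp.fourierTransformₗᵢ ℝ Spinor).apply_symm_apply f

theorem norm_ft (f : SpinorL2) : ‖ft f‖ = ‖f‖ := (Lp.fourierTransformₗᵢ ℝ Spinor).norm_map f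

theorem norm_ift (f : SpinorL2) : ‖ift f‖ = ‖f‖ :=
  (Lp.fourierTransformₗᵢ ℝ Spinor).symm.norm_map f

/-- An element of `L²` is determined by its tempered distribution, so identities on the Fourier side
can be proved by testing. -/
theorem eq_of_integral_schwartz_eq {f g : SpinorL2}
    (h : ∀ u : 𝓢(ℝ, ℂ), ∫ x, u x • f x = ∫ x, u x • g x) : f = g := by
  have h1 : Lp.toTemperedDistributionCLM Spinor volume 2 (f - g) = 0 := by
    rw [map_sub, sub_eq_zero]
    ext1 u
    simp only [Lp.toTemperedDistributionCLM_apply, Lp.toTemperedDistribution_apply]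
    exact h u
  have h2 : f - g ∈ (Lp.toTemperedDistributionCLM Spinor (volume : Measure ℝ) 2).ker := h1
  rw [Lp.ker_toTemperedDistributionCLM_eq_bot] at h2
  exact sub_eq_zero.1 h2

theorem integral_smul_ft (u : 𝓢(ℝ, ℂ)) (f : SpinorL2) :
    ∫ x, u x • (ft f) x = ∫ x, (𝓕 u) x • f x := by
  have h := congrArg (fun D : TemperedDistribution ℝ Spinor => D u)
    (Lp.fourier_toTemperedDistribution_eq f)
  simp only [TemperedDistribution.fourier_apply, Lp.toTemperedDistribution_apply] at h
  exact h.symm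

theorem integrable_schwartz_smul (u : 𝓢(ℝ, ℂ)) (f : SpinorL2) :
    Integrable (fun x => u x • f x) := by
  have := (Lp.memLp f).smul (u.memLp 2 volume) (r := 1)
  exact memLp_one_iff_integrable.1 this

/-- The Fourier transform commutes with constant matrices. -/
theorem ft_comm_const {A : SpinorL2 →L[ℂ] SpinorL2} {L : Spinor →L[ℂ] Spinor}
    (hA : IsMul A fun _ => L) (f : SpinorL2) : ft (A f) = A (ft f) := by
  have key : ∀ (u : 𝓢(ℝ, ℂ)) (g : SpinorL2), ∫ x, u x • (A g) x = L (∫ x, u x • g x) := fun u g => by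
    rw [← L.integral_comp_comm (integrable_schwartz_smul u g)]
    refine integral_congr_ae ?_
    filter_upwards [hA g] with x hx
    rw [hx, map_smul]
  refine eq_of_integral_schwartz_eq fun u => ?_
  rw [integral_smul_ft, key, key, integral_smul_ft]

/-- The translation `f ↦ f (· + h)`. -/
noncomputable def shift (h : ℝ) (f : SpinorL2) : SpinorL2 :=
  Lp.compMeasurePreserving (fun x => x + h) (measurePreserving_add_right volume h) f

theorem shift_ae (h : ℝ) (f : SpinorL2) : ⇑(shift h f) =ᵐ[volume] fun x => f (x + h) :=
  Lp.coeFn_compMeasurePreserving f (measurePreserving_add_right volume h)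

theorem norm_shift (h : ℝ) (f : SpinorL2) : ‖shift h f‖ = ‖f‖ :=
  Lp.norm_compMeasurePreserving f (measurePreserving_add_right volume h)

/-- The symbol of the translation by `h`. -/
noncomputable def shiftSymbol (h ξ : ℝ) : ℂ := Real.fourierChar (ξ * h)

theorem norm_shiftSymbol (h ξ : ℝ) : ‖shiftSymbol h ξ‖ = 1 := Circle.norm_coe _

theorem continuous_shiftSymbol (h : ℝ) : Continuous (shiftSymbol h) := by
  unfold shiftSymbol
  fun_prop

theorem isMul_shiftSymbol (h : ℝ) :
    IsMul (scalOp (shiftSymbol h)) fun ξ => shiftSymbol h ξ • 1 :=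
  isMul_scalOp (continuous_shiftSymbol h).aestronglyMeasurable (c := 1)
    (Eventually.of_forall fun ξ => (norm_shiftSymbol h ξ).le)

/-- Every derivative is a constant multiple of the function itself, hence bounded. -/
theorem hasTemperateGrowth_shiftSymbol (h : ℝ) : (shiftSymbol h).HasTemperateGrowth := by
  have e : shiftSymbol h = fun ξ : ℝ => Complex.exp ((2 * Real.pi * h * Complex.I) * (ξ : ℂ)) := by
    ext ξ
    rw [shiftSymbol, Real.fourierChar_apply]
    congr 1
    push_cast
    ring
  set c : ℂ := 2 * Real.pi * h * Complex.I
  have hd : ∀ n : ℕ, iteratedDeriv n (shiftSymbol h) = fun ξ => c ^ n * shiftSymbol h ξ := fun n => by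
    induction n with
    | zero => simp
    | succ n ih =>
      ext ξ
      rw [iteratedDeriv_succ, ih, deriv_const_mul_field, pow_succ, mul_assoc]
      congr 1
      rw [e]
      have h1 : HasDerivAt (fun ξ : ℝ => c * (ξ : ℂ)) (c * 1) ξ :=
        (Complex.ofRealCLM.hasDerivAt (x := ξ)).const_mul c
      rw [h1.cexp.deriv, mul_one, mul_comm]
  refine ⟨?_, fun n => ⟨0, ‖c‖ ^ n, fun ξ => ?_⟩⟩
  · rw [e]
    exact (contDiff_const.mul Complex.ofRealCLM.contDiff).cexp
  · rw [norm_iteratedFDeriv_eq_norm_iteratedDeriv, hd, norm_mul, norm_pow, norm_shiftSymbol]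
    simp

theorem ft_shift (h : ℝ) (f : SpinorL2) : ft (shift h f) = scalOp (shiftSymbol h) (ft f) := by
  refine eq_of_integral_schwartz_eq fun u => ?_
  have h1 : ∫ x, u x • (scalOp (shiftSymbol h) (ft f)) x =
      ∫ x, (SchwartzMap.smulLeftCLM ℂ (shiftSymbol h) u) x • (ft f) x := by
    refine integral_congr_ae ?_
    filter_upwards [isMul_shiftSymbol h (ft f)] with x hx
    rw [hx, SchwartzMap.smulLeftCLM_apply_apply (hasTemperateGrowth_shiftSymbol h)]
    simp [smul_smul, mul_comm]
  rw [h1, integral_smul_ft, integral_smul_ft]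
  have h2 : ∫ x, (𝓕 u) x • (shift h f) x = ∫ x, (𝓕 u) x • f (x + h) := by
    refine integral_congr_ae ?_
    filter_upwards [shift_ae h f] with x hx
    rw [hx]
  rw [h2, ← integral_sub_right_eq_self _ h]
  refine integral_congr_ae (Eventually.of_forall fun x => ?_)
  simp only [sub_add_cancel]
  congr 1
  rw [SchwartzMap.fourier_coe, SchwartzMap.fourier_coe, Real.fourier_real_eq, Real.fourier_real_eq]
  refine integral_congr_ae (Eventually.of_forall fun v => ?_)
  simp only [SchwartzMap.smulLeftCLM_apply_apply (hasTemperateGrowth_shiftSymbol h)]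
  rw [shiftSymbol, Circle.smul_def, Circle.smul_def, smul_smul, smul_eq_mul, smul_eq_mul,
    ← Circle.coe_mul, ← AddChar.map_add_eq_mul]
  congr 3
  ring

theorem hasTemperateGrowth_wt_rpow (r : ℝ) :
    (fun ξ : ℝ => (((1 + ‖ξ‖ ^ 2) ^ r : ℝ) : ℂ)).HasTemperateGrowth := by
  fun_prop

/-- The regularity on the Fourier side that follows from a bound in `H⁴(ℝ)`. -/
theorem sob_of_besselPotential {f g : SpinorL2} {M : ℝ}
    (h : TemperedDistribution.besselPotential ℝ Spinor ((2 * 2 + 0 : ℕ) : ℝ)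
      (Lp.toTemperedDistribution f) = Lp.toTemperedDistribution g) (hg : ‖g‖ ≤ M) :
    Sob 2 M (ft f) := by
  have h1 := congrArg (fun D : TemperedDistribution ℝ Spinor => 𝓕 D) h
  simp only [TemperedDistribution.fourier_besselPotential_eq_smulLeftCLM_fourier_apply] at h1
  rw [Lp.fourier_toTemperedDistribution_eq, Lp.fourier_toTemperedDistribution_eq] at h1
  have h2 : ∀ u : 𝓢(ℝ, ℂ), ∫ x, ((wt x ^ 2 : ℝ) * u x : ℂ) • (ft f) x = ∫ x, u x • (ft g) x :=
    fun u => by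
    have h3 := congrArg (fun D : TemperedDistribution ℝ Spinor => D u) h1
    simp only [TemperedDistribution.smulLeftCLM_apply_apply, Lp.toTemperedDistribution_apply] at h3
    refine Eq.trans ?_ h3
    refine integral_congr_ae (Eventually.of_forall fun x => ?_)
    simp only
    rw [SchwartzMap.smulLeftCLM_apply_apply (hasTemperateGrowth_wt_rpow _), smul_eq_mul, ft_apply]
    congr 3
    -- The Bessel potential of order `4` has the symbol `(1 + ξ²)²`, so `H⁴` corresponds to the
    -- exponent `2` of the weight.
    rw [show ((2 * 2 + 0 : ℕ) : ℝ) / 2 = (2 : ℕ) by norm_num, Real.rpow_natCast, wt,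
      Real.norm_eq_abs, sq_abs]
  have hbd : ∀ ξ : ℝ, ‖(((wt ξ ^ 2)⁻¹ : ℝ) : ℂ)‖ ≤ 1 := fun ξ => by
    rw [Complex.norm_real, Real.norm_of_nonneg (by have := wt_pos ξ; positivity)]
    exact inv_le_one_of_one_le₀ (one_le_pow₀ (one_le_wt ξ))
  have hcont : Continuous fun ξ : ℝ => (((wt ξ ^ 2)⁻¹ : ℝ) : ℂ) := by
    have := continuous_wt
    exact Complex.continuous_ofReal.comp ((this.pow 2).inv₀ fun ξ => (pow_pos (wt_pos ξ) 2).ne')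
  have hmul := isMul_scalOp hcont.aestronglyMeasurable (Eventually.of_forall hbd)
  -- Testing with `u` divided by the weight replaces the unbounded multiplier on `f` by a bounded
  -- one on `g`.
  have h4 : ft f = scalOp (fun ξ : ℝ => (((wt ξ ^ 2)⁻¹ : ℝ) : ℂ)) (ft g) := by
    refine eq_of_integral_schwartz_eq fun u => ?_
    have h5 := h2 (SchwartzMap.smulLeftCLM ℂ (fun ξ : ℝ => (((1 + ‖ξ‖ ^ 2) ^ (-2 : ℝ) : ℝ) : ℂ)) u)
    have h6 : ∀ x, (SchwartzMap.smulLeftCLM ℂ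
        (fun ξ : ℝ => (((1 + ‖ξ‖ ^ 2) ^ (-2 : ℝ) : ℝ) : ℂ)) u) x =
        (((wt x ^ 2)⁻¹ : ℝ) : ℂ) * u x := fun x => by
      rw [SchwartzMap.smulLeftCLM_apply_apply (hasTemperateGrowth_wt_rpow _), smul_eq_mul,
        Real.rpow_neg (by positivity), show (2 : ℝ) = (2 : ℕ) by norm_num, Real.rpow_natCast, wt,
        Real.norm_eq_abs, sq_abs]
    simp only [h6] at h5
    refine Eq.trans (integral_congr_ae (Eventually.of_forall fun x => ?_)) (h5.trans ?_)
    · have : (((wt x ^ 2 : ℝ)) : ℂ) ≠ 0 := by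
        exact_mod_cast (pow_pos (wt_pos x) 2).ne'
      simp only
      rw [← mul_assoc, Complex.ofReal_inv, mul_inv_cancel₀ this, one_mul]
    · refine integral_congr_ae ?_
      filter_upwards [hmul (ft g)] with x hx
      rw [hx, mul_comm, ← smul_smul]
      rfl
  rw [h4]
  intro R
  refine le_trans ?_ ((norm_ft g).le.trans hg)
  refine Lp.norm_le_norm_of_ae_le ?_
  filter_upwards [cut_ae 2 R (scalOp (fun ξ : ℝ => (((wt ξ ^ 2)⁻¹ : ℝ) : ℂ)) (ft g)),
    hmul (ft g)] with ξ h5 h6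
  rw [h5, h6, smul_apply, one_apply_eq_self, norm_smul, ← mul_assoc]
  refine mul_le_of_le_one_left (norm_nonneg _) ?_
  have h7 : cutSymbol 2 R ξ ≤ wt ξ ^ 2 := by
    unfold cutSymbol indicator
    split_ifs
    · rfl
    · exact sq_nonneg _
  rw [Complex.norm_real, Real.norm_of_nonneg (by positivity)]
  exact mul_inv_le_one_of_le₀ h7 (sq_nonneg _)

/-- A weak derivative in `L²`, on the Fourier side. -/
theorem ft_of_weakDeriv {f g : SpinorL2}
    (h : ∀ χ : ℝ → ℝ, IsTest χ → ∫ x, deriv χ x • f x = -∫ x, χ x • g x) :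
    ⇑(ft g) =ᵐ[volume] fun ξ => ((2 * Real.pi * ξ : ℝ) * Complex.I : ℂ) • (ft f) ξ := by
  have h1 : ∀ χ : ℝ → ℂ, ContDiff ℝ ∞ χ → HasCompactSupport χ →
      ∫ x, deriv χ x • f x = -∫ x, χ x • g x := fun χ hχ hχc => by
    have hd : Differentiable ℝ χ := hχ.differentiable (by simp)
    have hre : IsTest fun x => (χ x).re :=
      ⟨Complex.reCLM.contDiff.comp hχ, hχc.comp_left (g := Complex.re) rfl⟩
    have him : IsTest fun x => (χ x).im :=
      ⟨Complex.imCLM.contDiff.comp hχ, hχc.comp_left (g := Complex.im) rfl⟩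
    have hdre : ∀ x, deriv (fun x => (χ x).re) x = (deriv χ x).re := fun x =>
      (Complex.reCLM.hasFDerivAt.comp_hasDerivAt x (hd x).hasDerivAt).deriv
    have hdim : ∀ x, deriv (fun x => (χ x).im) x = (deriv χ x).im := fun x =>
      (Complex.imCLM.hasFDerivAt.comp_hasDerivAt x (hd x).hasDerivAt).deriv
    have hint : ∀ (θ : ℝ → ℝ), IsTest θ → ∀ k : SpinorL2, Integrable fun x => θ x • k x :=
      fun θ hθ k => by
      have := integrable_schwartz_smul ((hθ.2.comp_left (g := Complex.ofReal) rfl).toSchwartzMap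
        (Complex.ofRealCLM.contDiff.comp hθ.1)) k
      refine this.congr (Eventually.of_forall fun x => ?_)
      exact Complex.coe_smul (θ x) (k x)
    have hdt : ∀ {θ : ℝ → ℝ}, IsTest θ → IsTest (deriv θ) := fun {θ} hθ =>
      ⟨(contDiff_infty_iff_deriv.1 hθ.1).2, hθ.2.deriv⟩
    have hsplit : ∀ (θ : ℝ → ℂ) (k : SpinorL2), (Integrable fun x => (θ x).re • k x) →
        (Integrable fun x => (θ x).im • k x) →
        ∫ x, θ x • k x = (∫ x, (θ x).re • k x) + Complex.I • ∫ x, (θ x).im • k x :=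
      fun θ k i1 i2 => by
      rw [← integral_smul, ← integral_add i1 (show Integrable (fun x => Complex.I •
        (θ x).im • k x) from i2.smul Complex.I)]
      refine integral_congr_ae (Eventually.of_forall fun x => ?_)
      simp only
      rw [← Complex.coe_smul, ← Complex.coe_smul, smul_smul, ← add_smul, mul_comm Complex.I,
        Complex.re_add_im]
    have i1 := hint _ (hdt hre) f
    have i2 := hint _ (hdt him) f
    have e1 := h _ hre
    have e2 := h _ him
    simp only [hdre, hdim] at i1 i2 e1 e2
    rw [hsplit _ _ i1 i2, hsplit _ _ (hint _ hre g) (hint _ him g), e1, e2, smul_neg, neg_add]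
  -- Schwartz functions are reached by the cut-offs `φ(x/(n + 1))`: their derivatives are `O(1/n)`,
  -- and dominated convergence applies to the rest.
  have h2 : ∀ u : 𝓢(ℝ, ℂ), ∫ x, deriv u x • f x = -∫ x, u x • g x := fun u => by
    let φ : ContDiffBump (0 : ℝ) := ⟨1, 2, one_pos, one_lt_two⟩
    have hφ : ContDiff ℝ ∞ φ := φ.contDiff
    have hφd : Continuous (deriv φ) := hφ.continuous_deriv (by simp)
    obtain ⟨K, hK⟩ := (φ.hasCompactSupport.deriv).exists_bound_of_continuous hφd
    have hK0 : 0 ≤ K := (norm_nonneg _).trans (hK 0)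
    set c : ℕ → ℝ := fun n => ((n : ℝ) + 1)⁻¹ with hc
    have hcpos : ∀ n, 0 < c n := fun n => by positivity
    have hc1 : ∀ n, c n ≤ 1 := fun n => inv_le_one_of_one_le₀ (by simp)
    have hc0 : Tendsto c atTop (𝓝 0) := by
      simpa [hc] using tendsto_one_div_add_atTop_nhds_zero_nat (𝕜 := ℝ)
    have hφx : ∀ x : ℝ, Tendsto (fun n => φ (c n * x)) atTop (𝓝 1) := fun x => by
      have h5 : Tendsto (fun n => c n * x) atTop (𝓝 0) := by simpa using hc0.mul_const x
      have h6 := (hφ.continuous.tendsto 0).comp h5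
      have h7 : φ 0 = 1 := φ.one_of_mem_closedBall (Metric.mem_closedBall_self φ.rIn_pos.le)
      rwa [h7] at h6
    have hder : ∀ (n : ℕ) (x : ℝ), HasDerivAt (fun x => (φ (c n * x) : ℂ) * u x)
        ((c n * deriv φ (c n * x) : ℝ) * u x + (φ (c n * x) : ℂ) * deriv u x) x := fun n x => by
      have h5 : HasDerivAt (fun x => φ (c n * x)) (deriv φ (c n * x) * (c n * 1)) x :=
        ((hφ.differentiable (by simp)) (c n * x)).hasDerivAt.comp x
          ((hasDerivAt_id x).const_mul (c n))
      have h6 := h5.ofReal_comp.mul (u.differentiableAt (x := x)).hasDerivAt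
      refine h6.congr_deriv ?_
      rw [mul_one, mul_comm (deriv φ (c n * x))]
    have hmain : ∀ n : ℕ,
        ∫ x, ((c n * deriv φ (c n * x) : ℝ) * u x + (φ (c n * x) : ℂ) * deriv u x) • f x =
        -∫ x, ((φ (c n * x) : ℂ) * u x) • g x := fun n => by
      have h5 := h1 (fun x => (φ (c n * x) : ℂ) * u x) ?_ ?_
      · simpa only [(hder n _).deriv] using h5
      · exact (Complex.ofRealCLM.contDiff.comp (hφ.comp (contDiff_const.mul contDiff_id))).mul
          (u.smooth ⊤)
      · have h6 : HasCompactSupport fun x => φ (c n * x) :=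
          φ.hasCompactSupport.comp_homeomorph (Homeomorph.mulLeft₀ (c n) (hcpos n).ne')
        exact (h6.comp_left (g := Complex.ofReal) rfl).mul_right
    have hu' : ∀ x, deriv u x = (SchwartzMap.derivCLM ℂ ℂ u) x := fun x =>
      (SchwartzMap.derivCLM_apply ℂ u x).symm
    have l1 : Tendsto (fun n : ℕ =>
        ∫ x, ((c n * deriv φ (c n * x) : ℝ) * u x + (φ (c n * x) : ℂ) * deriv u x) • f x) atTop
        (𝓝 (∫ x, deriv u x • f x)) := by
      refine tendsto_integral_of_dominated_convergence
        (fun x => K * ‖u x • f x‖ + ‖deriv u x • f x‖) (fun n => ?_) ?_ (fun n => ?_) ?_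
      · have h5 : Continuous fun x => ((c n * deriv φ (c n * x) : ℝ) * u x +
            (φ (c n * x) : ℂ) * deriv u x) := by
          have h7 := u.continuous
          have h8 : Continuous (deriv u) := (u.smooth 1).continuous_deriv (by simp)
          have h9 := hφ.continuous
          fun_prop
        exact h5.aestronglyMeasurable.smul (Lp.aestronglyMeasurable f)
      · simp only [hu']
        exact ((integrable_schwartz_smul u f).norm.const_mul K).add
          (integrable_schwartz_smul (SchwartzMap.derivCLM ℂ ℂ u) f).norm
      · refine Eventually.of_forall fun x => ?_
        rw [norm_smul, norm_smul, norm_smul, ← mul_assoc, ← add_mul]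
        refine mul_le_mul_of_nonneg_right ((norm_add_le _ _).trans ?_) (norm_nonneg _)
        rw [norm_mul, norm_mul, Complex.norm_real, Complex.norm_real, norm_mul,
          Real.norm_of_nonneg (hcpos n).le, Real.norm_of_nonneg φ.nonneg]
        refine add_le_add (mul_le_mul_of_nonneg_right ?_ (norm_nonneg _))
          (mul_le_of_le_one_left (norm_nonneg _) φ.le_one)
        exact (mul_le_mul (hc1 n) (hK _) (norm_nonneg _) zero_le_one).trans (one_mul K).le
      · refine Eventually.of_forall fun x => ?_
        refine Tendsto.smul_const ?_ _
        have h5 : Tendsto (fun n : ℕ => ((c n * deriv φ (c n * x) : ℝ) : ℂ)) atTop (𝓝 0) := by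
          have : Tendsto (fun n : ℕ => c n * deriv φ (c n * x)) atTop (𝓝 0) :=
            hc0.zero_mul_isBoundedUnder_le
              ⟨K, Filter.eventually_map.2 (Eventually.of_forall fun n => hK _)⟩
          exact (Complex.continuous_ofReal.tendsto' 0 0 rfl).comp this
        have h6 : Tendsto (fun n : ℕ => (φ (c n * x) : ℂ)) atTop (𝓝 1) :=
          (Complex.continuous_ofReal.tendsto' 1 1 rfl).comp (hφx x)
        simpa using (h5.mul_const (u x)).add (h6.mul_const (deriv u x))
    have l2 : Tendsto (fun n : ℕ => ∫ x, ((φ (c n * x) : ℂ) * u x) • g x) atTop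
        (𝓝 (∫ x, u x • g x)) := by
      refine tendsto_integral_of_dominated_convergence
        (fun x => ‖u x • g x‖) (fun n => ?_) (integrable_schwartz_smul u g).norm (fun n => ?_) ?_
      · have h5 : Continuous fun x => (φ (c n * x) : ℂ) * u x := by
          have h7 := u.continuous
          have h9 := hφ.continuous
          fun_prop
        exact h5.aestronglyMeasurable.smul (Lp.aestronglyMeasurable g)
      · refine Eventually.of_forall fun x => ?_
        rw [norm_smul, norm_smul]
        refine mul_le_mul_of_nonneg_right ?_ (norm_nonneg _)
        rw [norm_mul, Complex.norm_real, Real.norm_of_nonneg φ.nonneg]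
        exact mul_le_of_le_one_left (norm_nonneg _) φ.le_one
      · refine Eventually.of_forall fun x => ?_
        refine Tendsto.smul_const ?_ _
        have h6 : Tendsto (fun n : ℕ => (φ (c n * x) : ℂ)) atTop (𝓝 1) :=
          (Complex.continuous_ofReal.tendsto' 1 1 rfl).comp (hφx x)
        simpa using h6.mul_const (u x)
    simp only [hmain] at l1
    exact tendsto_nhds_unique l1 l2.neg
  have h3 : ∀ u : 𝓢(ℝ, ℂ), ∫ x, (((2 * Real.pi * x : ℝ) * Complex.I) * u x : ℂ) • (ft f) x =
      ∫ x, u x • (ft g) x := fun u => by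
    have hlin : (fun x : ℝ => ((2 * Real.pi * x : ℝ) * Complex.I : ℂ)).HasTemperateGrowth := by
      simp only [Complex.ofReal_mul]
      fun_prop
    set v : 𝓢(ℝ, ℂ) := -SchwartzMap.smulLeftCLM ℂ
      (fun x : ℝ => ((2 * Real.pi * x : ℝ) * Complex.I : ℂ)) u with hv
    have hvx : ∀ x, v x = -((2 * Real.pi * x : ℝ) * Complex.I * u x : ℂ) := fun x => by
      rw [hv, neg_apply, SchwartzMap.smulLeftCLM_apply_apply hlin, smul_eq_mul]
    have h4 : ∀ x, deriv (𝓕 u : 𝓢(ℝ, ℂ)) x = (𝓕 v : 𝓢(ℝ, ℂ)) x := fun x => by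
      rw [SchwartzMap.fourier_coe, SchwartzMap.fourier_coe]
      rw [Real.deriv_fourier u.integrable]
      · refine congrFun (congrArg (fun k : ℝ → ℂ => 𝓕 k) (funext fun y => ?_)) x
        rw [hvx, smul_eq_mul]
        push_cast
        ring
      · have hx : (fun x : ℝ => (x : ℂ)).HasTemperateGrowth := by fun_prop
        refine (SchwartzMap.smulLeftCLM ℂ (fun x : ℝ => (x : ℂ)) u).integrable.congr
          (Eventually.of_forall fun x => ?_)
        simp only
        rw [SchwartzMap.smulLeftCLM_apply_apply hx, Complex.coe_smul]
    rw [integral_smul_ft, ← neg_eq_iff_eq_neg.2 (h2 (𝓕 u))]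
    simp only [h4]
    rw [← integral_smul_ft, ← integral_neg]
    refine integral_congr_ae (Eventually.of_forall fun x => ?_)
    simp only
    rw [hvx, neg_smul, neg_neg]
  have hbd : ∀ ξ : ℝ, ‖(((wt ξ)⁻¹ : ℝ) : ℂ)‖ ≤ 1 := fun ξ => by
    rw [Complex.norm_real, Real.norm_of_nonneg (inv_nonneg.2 (wt_pos ξ).le)]
    exact inv_le_one_of_one_le₀ (one_le_wt ξ)
  have hcont : Continuous fun ξ : ℝ => (((wt ξ)⁻¹ : ℝ) : ℂ) :=
    Complex.continuous_ofReal.comp (continuous_wt.inv₀ fun ξ => (wt_pos ξ).ne')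
  have hm1 := isMul_scalOp hcont.aestronglyMeasurable (Eventually.of_forall hbd)
  have hcont2 : Continuous fun ξ : ℝ => ((2 * Real.pi * ξ : ℝ) * Complex.I : ℂ) *
      (((wt ξ)⁻¹ : ℝ) : ℂ) := by
    have : Continuous fun ξ : ℝ => ((2 * Real.pi * ξ : ℝ) * Complex.I : ℂ) := by fun_prop
    exact this.mul hcont
  have hbd2 : ∀ ξ : ℝ, ‖((2 * Real.pi * ξ : ℝ) * Complex.I : ℂ) * (((wt ξ)⁻¹ : ℝ) : ℂ)‖ ≤
      2 * Real.pi := fun ξ => by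
    rw [norm_mul, norm_mul, Complex.norm_I, mul_one, Complex.norm_real, Complex.norm_real,
      Real.norm_of_nonneg (inv_nonneg.2 (wt_pos ξ).le), ← div_eq_mul_inv, div_le_iff₀ (wt_pos ξ),
      norm_mul, Real.norm_of_nonneg (by positivity : (0 : ℝ) ≤ 2 * Real.pi)]
    refine mul_le_mul_of_nonneg_left ?_ (by positivity)
    rw [Real.norm_eq_abs, wt]
    nlinarith [sq_nonneg (|ξ| - 1), sq_abs ξ]
  have hm2 := isMul_scalOp hcont2.aestronglyMeasurable (Eventually.of_forall hbd2)
  -- Both sides are divided by `1 + ξ²`, so that the multipliers are bounded operators; the weight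
  -- is cancelled pointwise at the end.
  have h4 : scalOp (fun ξ : ℝ => (((wt ξ)⁻¹ : ℝ) : ℂ)) (ft g) = scalOp (fun ξ : ℝ =>
      ((2 * Real.pi * ξ : ℝ) * Complex.I : ℂ) * (((wt ξ)⁻¹ : ℝ) : ℂ)) (ft f) := by
    refine eq_of_integral_schwartz_eq fun u => ?_
    have h5 := h3 (SchwartzMap.smulLeftCLM ℂ (fun ξ : ℝ => (((1 + ‖ξ‖ ^ 2) ^ (-1 : ℝ) : ℝ) : ℂ)) u)
    have h6 : ∀ x, (SchwartzMap.smulLeftCLM ℂ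
        (fun ξ : ℝ => (((1 + ‖ξ‖ ^ 2) ^ (-1 : ℝ) : ℝ) : ℂ)) u) x =
        (((wt x)⁻¹ : ℝ) : ℂ) * u x := fun x => by
      rw [SchwartzMap.smulLeftCLM_apply_apply (hasTemperateGrowth_wt_rpow _), smul_eq_mul,
        Real.rpow_neg_one, wt, Real.norm_eq_abs, sq_abs]
    simp only [h6] at h5
    refine Eq.trans (integral_congr_ae ?_) (h5.symm.trans (integral_congr_ae ?_))
    · filter_upwards [hm1 (ft g)] with x hx
      rw [hx, mul_comm, ← smul_smul]
      rfl
    · filter_upwards [hm2 (ft f)] with x hx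
      rw [hx, smul_apply, one_apply_eq_self, smul_smul]
      congr 1
      ring
  filter_upwards [hm1 (ft g), hm2 (ft f)] with ξ h5 h6
  rw [h4, h6] at h5
  simp only [smul_apply, one_apply_eq_self] at h5
  have h7 : ((wt ξ : ℝ) : ℂ) ≠ 0 := by exact_mod_cast (wt_pos ξ).ne'
  have h8 := congrArg (fun v => ((wt ξ : ℝ) : ℂ) • v) h5
  simp only [smul_smul] at h8
  rw [Complex.ofReal_inv, mul_inv_cancel₀ h7, one_smul, mul_left_comm, mul_inv_cancel₀ h7,
    mul_one] at h8
  exact h8.symm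

end fourier


/-! ### Finite differences of weakly differentiable functions -/

section differences

theorem IsTest.continuous {θ : ℝ → ℝ} (hθ : IsTest θ) : Continuous θ := hθ.1.continuous

theorem IsTest.integrable {θ : ℝ → ℝ} (hθ : IsTest θ) : Integrable θ :=
  hθ.continuous.integrable_of_hasCompactSupport hθ.2

theorem IsTest.comp_sub {θ : ℝ → ℝ} (hθ : IsTest θ) (c : ℝ) : IsTest fun x => θ (x - c) :=
  ⟨hθ.1.comp (contDiff_id.sub contDiff_const), hθ.2.comp_homeomorph (Homeomorph.subRight c)⟩

theorem IsTest.sub {θ η : ℝ → ℝ} (hθ : IsTest θ) (hη : IsTest η) : IsTest (θ - η) :=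
  ⟨hθ.1.sub hη.1, by
    rw [sub_eq_add_neg]
    exact hθ.2.add hη.2.neg⟩

/-- The backward difference. -/
def nabla (h : ℝ) (θ : ℝ → ℝ) : ℝ → ℝ := fun x => θ x - θ (x - h)

/-- The integral of `θ` over `[x - h, x]`. -/
noncomputable def back (h : ℝ) (θ : ℝ → ℝ) : ℝ → ℝ := fun x => ∫ u in (x - h)..x, θ u

theorem IsTest.nabla {θ : ℝ → ℝ} (hθ : IsTest θ) (h : ℝ) : IsTest (nabla h θ) :=
  hθ.sub (hθ.comp_sub h)

/-- Backward integration turns a difference of a test function into the derivative of another one.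
In this way weak derivatives control finite differences. -/
theorem hasDerivAt_back {θ : ℝ → ℝ} (hθ : Continuous θ) (h x : ℝ) :
    HasDerivAt (back h θ) (nabla h θ x) x := by
  have e : back h θ = fun x => (∫ u in (0 : ℝ)..x, θ u) - ∫ u in (0 : ℝ)..(x - h), θ u := by
    ext x
    rw [back, intervalIntegral.integral_interval_sub_left (hθ.intervalIntegrable _ _)
      (hθ.intervalIntegrable _ _)]
  rw [e]
  have h1 := (hθ.integral_hasStrictDerivAt 0 x).hasDerivAt
  have h2 := ((hθ.integral_hasStrictDerivAt 0 (x - h)).hasDerivAt).comp_sub_const x h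
  exact h1.sub h2

theorem deriv_back {θ : ℝ → ℝ} (hθ : Continuous θ) (h : ℝ) : deriv (back h θ) = nabla h θ :=
  funext fun x => (hasDerivAt_back hθ h x).deriv

theorem support_back {θ : ℝ → ℝ} {a b h : ℝ} (hh : 0 ≤ h) (hs : ∀ x ∉ Icc a b, θ x = 0) :
    ∀ x ∉ Icc a (b + h), back h θ x = 0 := fun x hx => by
  have h1 : ∀ u ∈ uIcc (x - h) x, θ u = 0 := fun u hu => by
    rw [uIcc_of_le (by linarith)] at hu
    refine hs u fun hu' => hx ⟨hu'.1.trans hu.2, ?_⟩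
    linarith [hu.1, hu'.2]
  rw [back, intervalIntegral.integral_congr h1]
  simp

theorem exists_Icc_of_isTest {θ : ℝ → ℝ} (hθ : IsTest θ) :
    ∃ a b : ℝ, ∀ x ∉ Icc a b, θ x = 0 := by
  obtain ⟨r, hr⟩ := hθ.2.isCompact.isBounded.subset_closedBall 0
  refine ⟨-r, r, fun x hx => image_eq_zero_of_notMem_tsupport fun h => hx ?_⟩
  have := hr h
  rwa [Real.closedBall_eq_Icc, zero_sub, zero_add] at this

theorem isTest_of_hasDerivAt {θ η : ℝ → ℝ} {a b : ℝ} (hη : ContDiff ℝ ∞ η)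
    (hd : ∀ x, HasDerivAt θ (η x) x) (hs : ∀ x ∉ Icc a b, θ x = 0) : IsTest θ := by
  refine ⟨contDiff_infty_iff_deriv.2 ⟨fun x => (hd x).differentiableAt, ?_⟩,
    HasCompactSupport.intro isCompact_Icc hs⟩
  rwa [show deriv θ = η from funext fun x => (hd x).deriv]

theorem IsTest.back {θ : ℝ → ℝ} (hθ : IsTest θ) {h : ℝ} (hh : 0 ≤ h) : IsTest (back h θ) := by
  obtain ⟨a, b, hs⟩ := exists_Icc_of_isTest hθ
  exact isTest_of_hasDerivAt (hθ.nabla h).1 (hasDerivAt_back hθ.continuous h)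
    (support_back hh hs)

theorem back_nonneg {θ : ℝ → ℝ} (hθ : ∀ x, 0 ≤ θ x) {h : ℝ} (hh : 0 ≤ h) (x : ℝ) :
    0 ≤ back h θ x :=
  intervalIntegral.integral_nonneg (by linarith) fun u _ => hθ u

-- The operator is convolution with the indicator of `(0, h]`, so the masses multiply.
open scoped Convolution in
theorem integral_back {θ : ℝ → ℝ} (hθ : IsTest θ) {h : ℝ} (hh : 0 ≤ h) :
    ∫ x, back h θ x = h * ∫ x, θ x := by
  have e : back h θ = (indicator (Ioc 0 h) fun _ => (1 : ℝ)) ⋆[ContinuousLinearMap.mul ℝ ℝ] θ := by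
    ext x
    rw [convolution_def, back]
    have h1 : ∀ t, ContinuousLinearMap.mul ℝ ℝ (indicator (Ioc 0 h) (fun _ => (1 : ℝ)) t)
        (θ (x - t)) = indicator (Ioc 0 h) (fun t => θ (x - t)) t := fun t => by
      by_cases ht : t ∈ Ioc 0 h <;> simp [ht]
    simp only [h1]
    rw [integral_indicator measurableSet_Ioc, ← intervalIntegral.integral_of_le hh,
      intervalIntegral.integral_comp_sub_left, sub_zero]
  have h2 : Integrable (indicator (Ioc 0 h) fun _ => (1 : ℝ)) :=
    (integrable_indicator_iff measurableSet_Ioc).2 (by simp)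
  rw [e, integral_convolution _ h2 hθ.integrable, integral_indicator measurableSet_Ioc]
  simp [hh]

theorem IsTest.nabla_iterate {θ : ℝ → ℝ} (hθ : IsTest θ) (h : ℝ) (k : ℕ) :
    IsTest ((Dirac.nabla h)^[k] θ) := by
  induction k with
  | zero => exact hθ
  | succ k ih =>
    rw [Function.iterate_succ_apply']
    exact ih.nabla h

theorem IsTest.back_iterate {θ : ℝ → ℝ} (hθ : IsTest θ) {h : ℝ} (hh : 0 ≤ h) (k : ℕ) :
    IsTest ((Dirac.back h)^[k] θ) := by
  induction k with
  | zero => exact hθ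
  | succ k ih =>
    rw [Function.iterate_succ_apply']
    exact ih.back hh

theorem back_iterate_nonneg {θ : ℝ → ℝ} (hθ : ∀ x, 0 ≤ θ x) {h : ℝ} (hh : 0 ≤ h) (k : ℕ) :
    ∀ x, 0 ≤ (back h)^[k] θ x := by
  induction k with
  | zero => exact hθ
  | succ k ih =>
    rw [Function.iterate_succ_apply']
    exact back_nonneg ih hh

theorem integral_back_iterate {θ : ℝ → ℝ} (hθ : IsTest θ) {h : ℝ} (hh : 0 ≤ h) (k : ℕ) :
    ∫ x, (back h)^[k] θ x = h ^ k * ∫ x, θ x := by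
  induction k with
  | zero => simp
  | succ k ih =>
    rw [Function.iterate_succ_apply', integral_back (hθ.back_iterate hh k) hh, ih]
    ring

theorem iteratedDeriv_nabla {θ : ℝ → ℝ} (hθ : IsTest θ) (h : ℝ) (k : ℕ) :
    iteratedDeriv k (nabla h θ) = nabla h (iteratedDeriv k θ) := by
  ext x
  have h1 : ContDiffAt ℝ k θ x := (hθ.1.of_le (by exact_mod_cast le_top)).contDiffAt
  have h2 : ContDiffAt ℝ k (fun x => θ (x - h)) x :=
    ((hθ.comp_sub h).1.of_le (by exact_mod_cast le_top)).contDiffAt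
  have h3 := iteratedDeriv_fun_sub h1 h2
  unfold nabla
  rw [h3, iteratedDeriv_comp_sub_const]

theorem iteratedDeriv_back_iterate {θ : ℝ → ℝ} (hθ : IsTest θ) {h : ℝ} (hh : 0 ≤ h) (k : ℕ) :
    iteratedDeriv k ((back h)^[k] θ) = (nabla h)^[k] θ := by
  induction k with
  | zero => simp
  | succ k ih =>
    rw [Function.iterate_succ_apply', iteratedDeriv_succ',
      deriv_back (hθ.back_iterate hh k).continuous, iteratedDeriv_nabla (hθ.back_iterate hh k), ih,
      Function.iterate_succ_apply']

theorem IsTest.integrable_mul {θ f : ℝ → ℝ} (hθ : IsTest θ) (hf : LocallyIntegrable f) :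
    Integrable fun x => θ x * f x :=
  hf.integrable_smul_left_of_hasCompactSupport hθ.continuous hθ.2

theorem _root_.MeasureTheory.LocallyIntegrable.comp_add {f : ℝ → ℝ} (hf : LocallyIntegrable f)
    (h : ℝ) : LocallyIntegrable fun x => f (x + h) := by
  rw [locallyIntegrable_iff] at hf ⊢
  intro K hK
  have h1 : MeasurePreserving (fun x : ℝ => x + h) volume volume :=
    measurePreserving_add_right volume h
  have h2 := (h1.integrableOn_comp_preimage (Homeomorph.addRight h).measurableEmbedding).2
    (hf _ (hK.image (Homeomorph.addRight h).continuous))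
  rwa [show (fun x => x + h) ⁻¹' ((Homeomorph.addRight h) '' K) = K from
    (Homeomorph.addRight h).injective.preimage_image K] at h2

theorem _root_.MeasureTheory.LocallyIntegrable.fwdDiff {f : ℝ → ℝ} (hf : LocallyIntegrable f)
    (h : ℝ) : LocallyIntegrable (fwdDiff h f) :=
  (hf.comp_add h).sub hf

theorem _root_.MeasureTheory.LocallyIntegrable.fwdDiff_iterate {f : ℝ → ℝ}
    (hf : LocallyIntegrable f) (h : ℝ) (k : ℕ) : LocallyIntegrable ((_root_.fwdDiff h)^[k] f) := by
  induction k with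
  | zero => exact hf
  | succ k ih =>
    rw [Function.iterate_succ_apply']
    exact ih.fwdDiff h

theorem integral_nabla_mul {θ f : ℝ → ℝ} (hθ : IsTest θ) (hf : LocallyIntegrable f) (h : ℝ) :
    ∫ x, nabla h θ x * f x = -∫ x, θ x * fwdDiff h f x := by
  have h1 : ∫ x, θ (x - h) * f x = ∫ x, θ x * f (x + h) := by
    rw [← integral_add_right_eq_self _ h]
    simp
  have i1 := hθ.integrable_mul hf
  have i2 := (hθ.comp_sub h).integrable_mul hf
  have i3 := hθ.integrable_mul (hf.comp_add h)
  simp only [nabla, fwdDiff, sub_mul, mul_sub]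
  rw [integral_sub i1 i2, integral_sub i3 i1, h1]
  ring

theorem integral_nabla_iterate_mul {θ f : ℝ → ℝ} (hθ : IsTest θ) (hf : LocallyIntegrable f)
    (h : ℝ) (k : ℕ) :
    ∫ x, (nabla h)^[k] θ x * f x = (-1) ^ k * ∫ x, θ x * (fwdDiff h)^[k] f x := by
  induction k generalizing f with
  | zero => simp
  | succ k ih =>
    rw [Function.iterate_succ_apply', integral_nabla_mul (hθ.nabla_iterate h k) hf,
      ih (hf.fwdDiff h), Function.iterate_succ_apply]
    ring

/-- A function that is bounded by `c` in the weak sense is bounded by `c`. -/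
theorem ae_abs_le_of_integral_le {F : ℝ → ℝ} (hF : LocallyIntegrable F) {c : ℝ}
    (h : ∀ θ : ℝ → ℝ, IsTest θ → (∀ x, 0 ≤ θ x) → |∫ x, θ x * F x| ≤ c * ∫ x, θ x) :
    ∀ᵐ x, |F x| ≤ c := by
  -- The mollifications converge almost everywhere because the ratio of the radii stays bounded, and
  -- each is a pairing with a nonnegative test function of mass one.
  let φ : ℕ → ContDiffBump (0 : ℝ) := fun n =>
    ⟨((n : ℝ) + 1)⁻¹, 2 * ((n : ℝ) + 1)⁻¹, by positivity, by
      have : 0 < ((n : ℝ) + 1)⁻¹ := by positivity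
      linarith⟩
  have h0 : Tendsto (fun n => (φ n).rOut) atTop (𝓝 0) := by
    have := (tendsto_one_div_add_atTop_nhds_zero_nat (𝕜 := ℝ)).const_mul 2
    simpa [φ] using this
  filter_upwards [ContDiffBump.ae_convolution_tendsto_right_of_locallyIntegrable (μ := volume) h0
    (K := 2) (Eventually.of_forall fun n => le_rfl) hF] with x hx
  refine le_of_tendsto hx.abs (Eventually.of_forall fun n => ?_)
  rw [convolution_eq_swap]
  have h1 : IsTest fun t => (φ n).normed volume (x - t) :=
    ⟨(φ n).contDiff_normed.comp (contDiff_const.sub contDiff_id),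
      (φ n).hasCompactSupport_normed.comp_homeomorph (Homeomorph.subLeft x)⟩
  refine (h _ h1 fun t => (φ n).nonneg_normed _).trans (le_of_eq ?_)
  rw [integral_sub_left_eq_self (fun t => (φ n).normed volume t), (φ n).integral_normed, mul_one]

/-- Move the differences onto `θ` and write its `k`-fold difference as the `k`-th derivative of its
`k`-fold backward integral, which has mass `h^k ∫ θ`. -/
theorem IsWeakDeriv.abs_fwdDiff_le {f W : ℝ → ℝ} {k : ℕ} {M : ℝ} (hf : IsWeakDeriv k f W)
    (hW : ∀ᵐ x, |W x| ≤ M) {h : ℝ} (hh : 0 ≤ h) : ∀ᵐ x, |(fwdDiff h)^[k] f x| ≤ M * h ^ k := by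
  refine ae_abs_le_of_integral_le (hf.1.fwdDiff_iterate h k) fun θ hθ h0 => ?_
  have h1 := integral_nabla_iterate_mul hθ hf.1 h k
  have h2 := hf.2.2 _ (hθ.back_iterate hh k)
  rw [iteratedDeriv_back_iterate hθ hh, h1] at h2
  have h3 := mul_left_cancel₀ (pow_ne_zero k (by norm_num)) h2
  rw [h3]
  have h4 := integral_back_iterate hθ hh k
  have h5 : ∀ᵐ x, ‖(back h)^[k] θ x * W x‖ ≤ M * (back h)^[k] θ x := by
    filter_upwards [hW] with x hx
    rw [norm_mul, Real.norm_of_nonneg (back_iterate_nonneg h0 hh k x), mul_comm]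
    exact mul_le_mul_of_nonneg_right hx (back_iterate_nonneg h0 hh k x)
  refine (norm_integral_le_of_norm_le ((hθ.back_iterate hh k).integrable.const_mul M) h5).trans
    (le_of_eq ?_)
  rw [integral_const_mul, h4]
  ring

end differences


/-! ### Multiplication by a regular function acts on the weighted spaces -/

section multiplication

/-- The comparison takes place in scalar `L²`, since the spinors `v x` and `w x` need not be
aligned. -/
theorem norm_le_add_of_ae_le {u v w : SpinorL2} {a b : ℝ} (ha : 0 ≤ a) (hb : 0 ≤ b)
    (h : ∀ᵐ x, ‖u x‖ ≤ a * ‖v x‖ + b * ‖w x‖) : ‖u‖ ≤ a * ‖v‖ + b * ‖w‖ := by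
  set v' : Lp ℝ 2 (volume : Measure ℝ) := (Lp.memLp v).norm.toLp _ with hv'
  set w' : Lp ℝ 2 (volume : Measure ℝ) := (Lp.memLp w).norm.toLp _ with hw'
  have hv : ‖v'‖ = ‖v‖ := by rw [hv', Lp.norm_toLp, eLpNorm_norm, ← Lp.norm_def]
  have hw : ‖w'‖ = ‖w‖ := by rw [hw', Lp.norm_toLp, eLpNorm_norm, ← Lp.norm_def]
  have h1 : ‖u‖ ≤ ‖a • v' + b • w'‖ := by
    refine Lp.norm_le_norm_of_ae_le ?_
    filter_upwards [h, Lp.coeFn_add (a • v') (b • w'), Lp.coeFn_smul a v', Lp.coeFn_smul b w',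
      (Lp.memLp v).norm.coeFn_toLp, (Lp.memLp w).norm.coeFn_toLp] with x h1 h2 h3 h4 h5 h6
    rw [h2, Pi.add_apply, h3, h4, Pi.smul_apply, Pi.smul_apply, hv', hw', h5, h6]
    exact h1.trans (le_abs_self _)
  refine h1.trans ((norm_add_le _ _).trans (le_of_eq ?_))
  rw [norm_smul, norm_smul, hv, hw, Real.norm_of_nonneg ha, Real.norm_of_nonneg hb]

/-- The forward difference operator with step `h`. -/
noncomputable def diffOp (h : ℝ) : SpinorL2 →L[ℂ] SpinorL2 :=
  ift * scalOp (shiftSymbol h) * ft - 1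

theorem shift_eq (h : ℝ) (f : SpinorL2) : shift h f = ift (scalOp (shiftSymbol h) (ft f)) := by
  rw [← ft_shift, ift_ft]

theorem diffOp_apply (h : ℝ) (f : SpinorL2) : diffOp h f = shift h f - f := by
  rw [shift_eq]
  rfl

theorem isMul_shiftSymbol_sub_one_pow (h : ℝ) (k : ℕ) :
    IsMul ((scalOp (shiftSymbol h) - 1) ^ k) fun ξ => (shiftSymbol h ξ - 1) ^ k • 1 := by
  induction k with
  | zero => simpa using IsMul.one
  | succ k ih =>
    rw [pow_succ]
    refine (ih.mul ((isMul_shiftSymbol h).sub IsMul.one)).congr (Eventually.of_forall fun ξ => ?_)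
    ext1 v
    simp [pow_succ, smul_sub, smul_smul]
    module

theorem ft_diffOp_pow (h : ℝ) (k : ℕ) (f : SpinorL2) :
    ft ((diffOp h ^ k) f) = ((scalOp (shiftSymbol h) - 1) ^ k) (ft f) := by
  induction k with
  | zero => simp
  | succ k ih =>
    rw [pow_succ', pow_succ', mul_apply_eq_comp, mul_apply_eq_comp, ← ih, diffOp_apply, map_sub,
      ft_shift]
    rfl

theorem norm_shiftSymbol_sub_one (h ξ : ℝ) :
    ‖shiftSymbol h ξ - 1‖ = 2 * |Real.sin (Real.pi * (h * ξ))| := by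
  have e : shiftSymbol h ξ = Complex.exp (Complex.I * ((2 * (Real.pi * (h * ξ)) : ℝ) : ℂ)) := by
    rw [shiftSymbol, Real.fourierChar_apply]
    congr 1
    push_cast
    ring
  rw [e, Complex.norm_exp_I_mul_ofReal_sub_one, norm_mul, mul_div_cancel_left₀ _ two_ne_zero]
  simp

theorem norm_shiftSymbol_sub_one_le (h ξ : ℝ) : ‖shiftSymbol h ξ - 1‖ ≤ 7 * |h| * |ξ| := by
  rw [norm_shiftSymbol_sub_one]
  have h1 := Real.abs_sin_le_abs (x := Real.pi * (h * ξ))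
  rw [abs_mul, abs_mul, abs_of_pos Real.pi_pos] at h1
  have h2 := Real.pi_lt_d2
  nlinarith [mul_nonneg (abs_nonneg h) (abs_nonneg ξ)]

/-- Jordan's inequality; the condition keeps `πhξ` in `[-π/2, π/2]`. -/
theorem le_norm_shiftSymbol_sub_one {h ξ : ℝ} (hξ : |h * ξ| ≤ 1 / 2) :
    4 * |h * ξ| ≤ ‖shiftSymbol h ξ - 1‖ := by
  rw [norm_shiftSymbol_sub_one]
  have h1 := Real.mul_abs_le_abs_sin (x := Real.pi * (h * ξ)) (by
    rw [abs_mul, abs_of_pos Real.pi_pos]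
    nlinarith [Real.pi_pos])
  rw [abs_mul, abs_of_pos Real.pi_pos] at h1
  have h2 : 2 / Real.pi * (Real.pi * |h * ξ|) = 2 * |h * ξ| := by
    have := Real.pi_ne_zero
    field_simp
  linarith

theorem abs_pow_le_wt_pow {i p : ℕ} (hi : i ≤ 2 * p) (ξ : ℝ) : |ξ| ^ i ≤ wt ξ ^ p := by
  have h1 : (1 : ℝ) ≤ max 1 |ξ| := le_max_left _ _
  calc |ξ| ^ i ≤ max 1 |ξ| ^ i := pow_le_pow_left₀ (abs_nonneg _) (le_max_right _ _) i
    _ ≤ max 1 |ξ| ^ (2 * p) := pow_le_pow_right₀ h1 hi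
    _ = (max 1 |ξ| ^ 2) ^ p := pow_mul _ _ _
    _ ≤ wt ξ ^ p := by
      refine pow_le_pow_left₀ (by positivity) ?_ p
      rcases max_cases 1 |ξ| with ⟨h, -⟩ | ⟨h, -⟩
      · rw [h]
        simpa using one_le_wt ξ
      · rw [h, sq_abs, wt]
        linarith

theorem norm_diffOp_pow_le {p i : ℕ} {N h : ℝ} {f : SpinorL2} (hf : Sob p N (ft f))
    (hi : i ≤ 2 * p) : ‖(diffOp h ^ i) f‖ ≤ N * (7 * |h|) ^ i := by
  rw [← norm_ft, ft_diffOp_pow, mul_comm]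
  have hf' : Sob (0 + p) N (ft f) := by rwa [zero_add]
  refine (Sob.isMul (isMul_shiftSymbol_sub_one_pow h i) (c := (7 * |h|) ^ i) (by positivity)
    (fun ξ v => ?_) hf').norm_le
  rw [smul_apply, one_apply_eq_self, norm_smul, norm_pow]
  refine mul_le_mul_of_nonneg_right ?_ (norm_nonneg _)
  refine (pow_le_pow_left₀ (norm_nonneg _) (norm_shiftSymbol_sub_one_le h ξ) i).trans ?_
  rw [mul_pow]
  exact mul_le_mul_of_nonneg_left (abs_pow_le_wt_pow hi ξ) (by positivity)

/-- Multiplication by a real function. -/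
noncomputable def realOp (v : ℝ → ℝ) : SpinorL2 →L[ℂ] SpinorL2 := scalOp fun x => (v x : ℂ)

theorem isMul_realOp {v : ℝ → ℝ} (hv : AEStronglyMeasurable v volume) {c : ℝ}
    (hc : ∀ᵐ x, |v x| ≤ c) : IsMul (realOp v) fun x => (v x : ℂ) • 1 :=
  isMul_scalOp (Complex.continuous_ofReal.comp_aestronglyMeasurable hv) (c := c) (by
    filter_upwards [hc] with x hx
    rwa [Complex.norm_real])

theorem norm_realOp_le {v : ℝ → ℝ} (hv : AEStronglyMeasurable v volume) {c : ℝ} (h0 : 0 ≤ c)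
    (hc : ∀ᵐ x, |v x| ≤ c) : ‖realOp v‖ ≤ c := by
  refine (isMul_realOp hv hc).opNorm_le h0 ?_
  filter_upwards [hc] with x hx
  refine (norm_smul_one_le _).trans ?_
  rwa [Complex.norm_real]

theorem diffOp_realOp {v : ℝ → ℝ} (hv : Measurable v) {c c' h : ℝ} (hc : ∀ᵐ x, |v x| ≤ c)
    (hc' : ∀ᵐ x, |fwdDiff h v x| ≤ c') (f : SpinorL2) :
    diffOp h (realOp v f) = realOp v (diffOp h f) + realOp (fwdDiff h v) (shift h f) := by
  have hd : Measurable (fwdDiff h v) := by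
    unfold fwdDiff
    fun_prop
  have hm := isMul_realOp hv.aestronglyMeasurable hc
  have hm' := isMul_realOp hd.aestronglyMeasurable hc'
  rw [diffOp_apply, diffOp_apply]
  refine Lp.ext ?_
  have hq := (measurePreserving_add_right (volume : Measure ℝ) h).quasiMeasurePreserving.ae (hm f)
  filter_upwards [Lp.coeFn_sub (shift h (realOp v f)) (realOp v f), hm f, hm (shift h f - f),
    hm' (shift h f), Lp.coeFn_add (realOp v (shift h f - f)) (realOp (fwdDiff h v) (shift h f)),
    shift_ae h (realOp v f), shift_ae h f, hq, Lp.coeFn_sub (shift h f) f]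
    with x h1 h2 h3 h4 h5 h6 h7 h8 h9
  rw [h1, Pi.sub_apply, h6, h8, h2, h5, Pi.add_apply, h3, h4, h9, Pi.sub_apply, h7]
  simp only [smul_apply, one_apply_eq_self, fwdDiff]
  push_cast
  module

/-- A discrete Leibniz rule. -/
theorem norm_diffOp_pow_realOp_le {h b : ℝ} (hh : 0 ≤ h) (hb : 0 ≤ b) (k : ℕ) {v : ℝ → ℝ}
    (hv : Measurable v) {c N : ℝ} (hc0 : 0 ≤ c) (hN : 0 ≤ N) {f : SpinorL2}
    (hc : ∀ i ≤ k, ∀ᵐ x, |(fwdDiff h)^[i] v x| ≤ c * h ^ i)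
    (hf : ∀ i ≤ k, ‖(diffOp h ^ i) f‖ ≤ N * (b * h) ^ i) :
    ‖(diffOp h ^ k) (realOp v f)‖ ≤ c * N * ((1 + b) * h) ^ k := by
  induction k generalizing v c N f with
  | zero =>
    have h1 := norm_realOp_le hv.aestronglyMeasurable hc0 (by simpa using hc 0 le_rfl)
    have h2 := hf 0 le_rfl
    simp only [pow_zero, one_apply_eq_self, mul_one] at h2 ⊢
    exact ((realOp v).le_opNorm f).trans (mul_le_mul h1 h2 (norm_nonneg _) hc0)
  | succ k ih =>
    have hd : Measurable (fwdDiff h v) := by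
      unfold fwdDiff
      fun_prop
    have h0 : ∀ᵐ x, |v x| ≤ c := by simpa using hc 0 (by omega)
    have h1 : ∀ᵐ x, |fwdDiff h v x| ≤ c * h := by simpa using hc 1 (by omega)
    rw [pow_succ, mul_apply_eq_comp, diffOp_realOp hv h0 h1, map_add]
    have e1 := ih (N := N * (b * h)) hv hc0 (by positivity) (f := diffOp h f)
      (fun i hi => hc i (by omega)) fun i hi => by
        have := hf (i + 1) (by omega)
        rw [pow_succ, mul_apply_eq_comp] at this
        refine this.trans (le_of_eq ?_)
        ring
    have e2 := ih (c := c * h) hd (by positivity) hN (f := shift h f)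
      (fun i hi => by
        have := hc (i + 1) (by omega)
        simp only [Function.iterate_succ_apply] at this
        filter_upwards [this] with x hx
        refine hx.trans (le_of_eq ?_)
        ring)
      fun i hi => by
        have e : (diffOp h ^ i) (shift h f) = shift h ((diffOp h ^ i) f) := by
          have e3 : ∀ g, shift h g = (1 + diffOp h) g := fun g => by
            rw [add_apply, diffOp_apply, one_apply_eq_self]
            abel
          rw [e3, e3, ← mul_apply_eq_comp, ← mul_apply_eq_comp]
          congr 1
          exact ((Commute.one_right _).add_right ((Commute.refl (diffOp h)).pow_left i)).eq
        rw [e, norm_shift]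
        exact hf i (by omega)
    refine (norm_add_le _ _).trans ((add_le_add e1 e2).trans (le_of_eq ?_))
    ring

/-- Weights up to `(1 + ξ²)²` are detected by at most four finite differences in `L²`. These pass
through the product by the discrete Leibniz rule, so `v` need not be differentiated. -/
theorem sobBdd_realOp {v : ℝ → ℝ} (hv : Measurable v) {M : ℝ} (hM0 : 0 ≤ M)
    (hM : ∀ k ≤ 4, ∀ h : ℝ, 0 ≤ h → ∀ᵐ x, |(fwdDiff h)^[k] v x| ≤ M * h ^ k) :
    SobBdd (40 * M) (ft * realOp v * ift) := fun p hp N g hg R => by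
  have hN := hg.nonneg
  set f := ift g with hf
  have hgf : g = ft f := (ft_ift g).symm
  have h0 : ∀ᵐ x, |v x| ≤ M := by simpa using hM 0 (by omega) 0 le_rfl
  have hfN : ‖f‖ ≤ N := by
    rw [hf, norm_ift]
    exact hg.norm_le'
  have h1 : ‖ft (realOp v f)‖ ≤ M * N := by
    rw [norm_ft]
    exact ((realOp v).le_opNorm f).trans
      (mul_le_mul (norm_realOp_le hv.aestronglyMeasurable hM0 h0) hfN (norm_nonneg _) hM0)
  -- The step is adapted to the cut-off: `|ξ| ≤ R + 1` gives `|hξ| ≤ 1/2`, where the symbol of the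
  -- difference is comparable to `hξ`.
  set h : ℝ := (2 * ((R : ℝ) + 1))⁻¹ with hh
  have hpos : 0 < h := by positivity
  have h2 : ‖(diffOp h ^ (2 * p)) (realOp v f)‖ ≤ M * N * ((1 + 7) * h) ^ (2 * p) :=
    norm_diffOp_pow_realOp_le hpos.le (by norm_num) _ hv hM0 hN
      (fun i hi => hM i (by omega) h hpos.le) fun i hi => by
        have := norm_diffOp_pow_le (h := h) (hgf ▸ hg) hi
        rwa [abs_of_pos hpos] at this
  rw [← norm_ft, ft_diffOp_pow] at h2
  change ‖cut p R (ft (realOp v f))‖ ≤ _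
  set u := ft (realOp v f)
  have h3 : ‖cut p R u‖ ≤ 2 * ‖u‖ +
      2 * ((4 * h) ^ (2 * p))⁻¹ * ‖((scalOp (shiftSymbol h) - 1) ^ (2 * p)) u‖ := by
    refine norm_le_add_of_ae_le zero_le_two (by positivity) ?_
    filter_upwards [cut_ae p R u, isMul_shiftSymbol_sub_one_pow h (2 * p) u] with ξ h3 h4
    rw [h3, h4, smul_apply, one_apply_eq_self, norm_smul, ← mul_assoc, ← add_mul, norm_pow]
    refine mul_le_mul_of_nonneg_right ?_ (norm_nonneg _)
    by_cases hξ : |ξ| ≤ R + 1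
    · have h5 : |h * ξ| ≤ 1 / 2 := by
        rw [abs_mul, abs_of_pos hpos, hh, inv_mul_le_iff₀ (by positivity)]
        linarith
      have h6 := pow_le_pow_left₀ (by positivity) (le_norm_shiftSymbol_sub_one h5) (2 * p)
      rw [abs_mul, abs_of_pos hpos, ← mul_assoc, mul_pow] at h6
      have h7 : |ξ| ^ (2 * p) ≤ ((4 * h) ^ (2 * p))⁻¹ * ‖shiftSymbol h ξ - 1‖ ^ (2 * p) := by
        rw [inv_mul_eq_div, le_div_iff₀ (by positivity)]
        linarith
      have h8 : cutSymbol p R ξ ≤ wt ξ ^ p := by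
        unfold cutSymbol indicator
        split_ifs
        · rfl
        · exact pow_nonneg (wt_pos ξ).le _
      have h9 : wt ξ ^ p ≤ 2 + 2 * |ξ| ^ (2 * p) := by
        rw [pow_mul, sq_abs, wt]
        interval_cases p
        · norm_num
        · nlinarith [sq_nonneg ξ]
        · nlinarith [sq_nonneg (ξ ^ 2 - 1)]
      refine h8.trans (h9.trans ?_)
      rw [mul_assoc]
      linarith
    · have h8 : cutSymbol p R ξ = 0 := by
        unfold cutSymbol indicator
        rw [if_neg]
        rwa [mem_Icc, ← abs_le]
      rw [h8]
      positivity
  refine h3.trans ((add_le_add (mul_le_mul_of_nonneg_left h1 zero_le_two)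
    (mul_le_mul_of_nonneg_left h2 (by positivity))).trans ?_)
  -- The powers of `h` cancel, so the bound does not depend on `R`; the total is `(2 + 2 · 2^{2p})MN
  -- ≤ 34MN`.
  have h4 : 2 * ((4 * h) ^ (2 * p))⁻¹ * (M * N * ((1 + 7) * h) ^ (2 * p)) =
      2 * (M * N) * 2 ^ (2 * p) := by
    rw [show (1 + 7) * h = 2 * (4 * h) by ring, mul_pow 2 (4 * h)]
    have : (4 * h) ^ (2 * p) ≠ 0 := by positivity
    field_simp
  rw [h4]
  have h5 : (2 : ℝ) ^ (2 * p) ≤ 2 ^ 4 := pow_le_pow_right₀ (by norm_num) (by omega)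
  nlinarith [mul_nonneg hM0 hN]

end multiplication


/-! ### The bounds on the potential -/

section potential

/-- The quantitative form of the regularity assumption on the potential. -/
structure PotBound (T M : ℝ) (V : ℝ → ℝ → ℝ) : Prop where
  meas : Measurable (Function.uncurry V)
  nonneg : 0 ≤ M
  bdd : ∀ᵐ x, ∀ᵐ t ∂volume.restrict (Icc 0 T), |V t x| ≤ M
  time : ∀ k ≤ 2, ∀ θ : ℝ → ℝ, IsTest θ → tsupport θ ⊆ Ioo 0 T →
    ∀ᵐ x, |∫ t in (0 : ℝ)..T, iteratedDeriv k θ t * V t x| ≤ M * ∫ t, |θ t|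
  space : ∀ᵐ t ∂volume.restrict (Icc 0 T), ∀ k ≤ 4, ∀ h : ℝ, 0 ≤ h →
    ∀ᵐ x, |(fwdDiff h)^[k] (V t) x| ≤ M * h ^ k

theorem MemLinfty.exists_bound {T : ℝ} {W : ℝ → ℝ → ℝ} (hW : MemLinfty T W) :
    ∃ c, 0 ≤ c ∧ ∀ᵐ x, ∀ᵐ t ∂volume.restrict (Icc 0 T), |W t x| ≤ c := by
  obtain ⟨c, hc0, hc⟩ : ∃ c, 0 ≤ c ∧
      ∀ᵐ p ∂volume.restrict (Icc 0 T ×ˢ (univ : Set ℝ)), |Function.uncurry W p| ≤ c := by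
    refine ⟨(eLpNorm (Function.uncurry W) ∞
      (volume.restrict (Icc 0 T ×ˢ (univ : Set ℝ)))).toReal, ENNReal.toReal_nonneg, ?_⟩
    filter_upwards [ae_le_eLpNormEssSup (f := Function.uncurry W)] with p hp
    rw [← eLpNorm_exponent_top] at hp
    have := ENNReal.toReal_mono hW.2.ne hp
    rwa [toReal_enorm] at this
  refine ⟨c, hc0, ?_⟩
  rw [Measure.volume_eq_prod, ← Measure.prod_restrict, Measure.restrict_univ] at hc
  exact Measure.ae_ae_of_ae_prod ((Measure.measurePreserving_swap (μ := (volume : Measure ℝ))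
    (ν := volume.restrict (Icc 0 T))).quasiMeasurePreserving.ae hc)

/-- Weak time derivatives enter only through pairings with test functions, and weak space
derivatives only through differences. The sum of all the bounds serves as a common constant. -/
theorem exists_potBound {T : ℝ} (hT : 0 < T) {V : ℝ → ℝ → ℝ}
    (hV : Measurable (Function.uncurry V)) (hA : AssumptionA T 2 0 V) : ∃ M, PotBound T M V := by
  obtain ⟨⟨h0, h1⟩, M₁, h2⟩ := hA
  obtain ⟨c, hc0, hc⟩ := h0.exists_bound
  choose W hW hθ using h1
  have h3 : ∀ k : Fin 3, ∃ b, 0 ≤ b ∧ ∀ᵐ x, ∀ᵐ t ∂volume.restrict (Icc 0 T),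
      |W k (by omega) t x| ≤ b := fun k => (hW k _).exists_bound
  choose b hb0 hb using h3
  refine ⟨c + |M₁| + ∑ k, b k, hV, ?_, ?_, ?_, ?_⟩
  · have := Finset.sum_nonneg fun k (_ : k ∈ Finset.univ) => hb0 k
    positivity
  · have := Finset.sum_nonneg fun k (_ : k ∈ Finset.univ) => hb0 k
    filter_upwards [hc] with x hx
    filter_upwards [hx] with t ht
    linarith [abs_nonneg M₁]
  · intro k hk θ hθt hθs
    filter_upwards [hθ k hk θ hθt hθs, hb ⟨k, by omega⟩] with x h4 h5
    have h6 : b ⟨k, by omega⟩ ≤ c + |M₁| + ∑ k, b k := by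
      have := Finset.single_le_sum (fun k (_ : k ∈ Finset.univ) => hb0 k)
        (Finset.mem_univ ⟨k, by omega⟩)
      linarith [abs_nonneg M₁]
    have h7 : 0 ≤ ∫ t, |θ t| := integral_nonneg fun t => abs_nonneg _
    refine le_trans ?_ (mul_le_mul_of_nonneg_right h6 h7)
    rw [h4, abs_mul, abs_pow, abs_neg, abs_one, one_pow, one_mul,
      intervalIntegral.integral_of_le hT.le]
    have h8 : ∀ᵐ t ∂volume.restrict (Ioc 0 T), ‖θ t * W k hk t x‖ ≤ b ⟨k, by omega⟩ * |θ t| := by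
      filter_upwards [ae_restrict_of_ae_restrict_of_subset Ioc_subset_Icc_self h5] with t ht
      rw [norm_mul, mul_comm]
      exact mul_le_mul_of_nonneg_right ht (abs_nonneg _)
    have hi : Integrable fun t => |θ t| := hθt.integrable.abs
    refine (norm_integral_le_of_norm_le ((hi.const_mul _).integrableOn) h8).trans ?_
    rw [integral_const_mul]
    refine mul_le_mul_of_nonneg_left ?_ (hb0 _)
    exact setIntegral_le_integral hi (Eventually.of_forall fun t => abs_nonneg _)
  · have h6 : M₁ ≤ c + |M₁| + ∑ k, b k := by
      have := Finset.sum_nonneg fun k (_ : k ∈ Finset.univ) => hb0 k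
      linarith [le_abs_self M₁]
    filter_upwards [h2] with t ht k hk h hh
    obtain ⟨U, hU, hUM⟩ := ht k (by omega)
    filter_upwards [hU.abs_fwdDiff_le hUM hh] with x hx
    exact hx.trans (mul_le_mul_of_nonneg_right h6 (pow_nonneg hh k))

variable {T M : ℝ} {V : ℝ → ℝ → ℝ}

/-- The average of the potential in time with the weight `θ`. -/
noncomputable def timeAvg (T : ℝ) (V : ℝ → ℝ → ℝ) (θ : ℝ → ℝ) (x : ℝ) : ℝ :=
  ∫ t in (0 : ℝ)..T, θ t * V t x

theorem measurable_timeAvg (hV : Measurable (Function.uncurry V)) {θ : ℝ → ℝ}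
    (hθ : Continuous θ) : Measurable (timeAvg T V θ) := by
  have h2 : StronglyMeasurable fun p : ℝ × ℝ => θ p.2 * V p.2 p.1 :=
    ((hθ.measurable.comp measurable_snd).mul (hV.comp measurable_swap)).stronglyMeasurable
  unfold timeAvg intervalIntegral
  exact (h2.integral_prod_right' (ν := volume.restrict (Ioc 0 T))).measurable.sub
    (h2.integral_prod_right' (ν := volume.restrict (Ioc T 0))).measurable

theorem PotBound.intervalIntegrable (h : PotBound T M V) (hT : 0 ≤ T) :
    ∀ᵐ x, IntervalIntegrable (fun t => V t x) volume 0 T := by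
  filter_upwards [h.bdd] with x hx
  rw [intervalIntegrable_iff_integrableOn_Ioc_of_le hT]
  refine IntegrableOn.of_bound (C := M) (by simp) ?_ ?_
  · exact (h.meas.comp (measurable_id.prodMk measurable_const)).aestronglyMeasurable
  · exact ae_restrict_of_ae_restrict_of_subset Ioc_subset_Icc_self hx

theorem PotBound.timeAvg_sub (h : PotBound T M V) (hT : 0 ≤ T) {θ η : ℝ → ℝ} (hθ : Continuous θ)
    (hη : Continuous η) :
    ∀ᵐ x, timeAvg T V (fun t => θ t - η t) x = timeAvg T V θ x - timeAvg T V η x := by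
  filter_upwards [h.intervalIntegrable hT] with x hx
  simp only [timeAvg, sub_mul]
  exact intervalIntegral.integral_sub (hx.continuousOn_mul hθ.continuousOn)
    (hx.continuousOn_mul hη.continuousOn)

/-- Multiplication by an average of the potential in time. -/
noncomputable def avgOp (T : ℝ) (V : ℝ → ℝ → ℝ) (θ : ℝ → ℝ) : SpinorL2 →L[ℂ] SpinorL2 :=
  realOp (timeAvg T V θ)

theorem PotBound.isMul_avgOp (h : PotBound T M V) {θ : ℝ → ℝ} (hθ : IsTest θ)
    (hs : tsupport θ ⊆ Ioo 0 T) : IsMul (avgOp T V θ) fun x => (timeAvg T V θ x : ℂ) • 1 :=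
  isMul_realOp (measurable_timeAvg h.meas hθ.continuous).aestronglyMeasurable
    (c := M * ∫ t, |θ t|) (by
      have := h.time 0 (by omega) θ hθ hs
      simp only [iteratedDeriv_zero] at this
      exact this)

/-- The exceptional set of `x` depends on the test function. Time regularity is therefore recorded
by operator norms of averages, where null sets do not matter. -/
theorem PotBound.norm_avgOp_iteratedDeriv_le (h : PotBound T M V) {k : ℕ} (hk : k ≤ 2) {θ : ℝ → ℝ}
    (hθ : IsTest θ) (hs : tsupport θ ⊆ Ioo 0 T) :
    ‖avgOp T V (iteratedDeriv k θ)‖ ≤ M * ∫ t, |θ t| := by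
  refine norm_realOp_le (measurable_timeAvg h.meas
    (hθ.1.continuous_iteratedDeriv k (by exact_mod_cast le_top))).aestronglyMeasurable
    (mul_nonneg h.nonneg (integral_nonneg fun t => abs_nonneg _)) ?_
  exact h.time k hk θ hθ hs

theorem PotBound.avgOp_sub (h : PotBound T M V) (hT : 0 ≤ T) {θ η : ℝ → ℝ} (hθ : IsTest θ)
    (hs : tsupport θ ⊆ Ioo 0 T) (hη : IsTest η) (hs' : tsupport η ⊆ Ioo 0 T) :
    avgOp T V (fun t => θ t - η t) = avgOp T V θ - avgOp T V η := by
  have h1 : IsTest fun t => θ t - η t := hθ.sub hη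
  have h2 : tsupport (fun t => θ t - η t) ⊆ Ioo 0 T :=
    (tsupport_sub θ η).trans (union_subset hs hs')
  refine ((h.isMul_avgOp h1 h2).congr ?_).eq ((h.isMul_avgOp hθ hs).sub (h.isMul_avgOp hη hs'))
  filter_upwards [h.timeAvg_sub hT hθ.continuous hη.continuous] with x hx
  rw [hx]
  push_cast
  module

/-- A normalized nonnegative test function supported in `[a, b]`. -/
structure IsBump (a b : ℝ) (φ : ℝ → ℝ) : Prop where
  test : IsTest φ
  nonneg : ∀ x, 0 ≤ φ x
  integral : ∫ x, φ x = 1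
  supp : ∀ x ∉ Icc a b, φ x = 0

namespace IsBump

variable {a b a' b' : ℝ} {φ ψ : ℝ → ℝ}

theorem tsupport_subset (h : IsBump a b φ) : tsupport φ ⊆ Icc a b :=
  closure_minimal (fun x hx => by
    by_contra h'
    exact hx (h.supp x h')) isClosed_Icc

theorem mono (h : IsBump a b φ) (ha : a' ≤ a) (hb : b ≤ b') : IsBump a' b' φ :=
  ⟨h.test, h.nonneg, h.integral, fun x hx => h.supp x fun h' => hx ⟨ha.trans h'.1, h'.2.trans hb⟩⟩

theorem comp_sub (h : IsBump a b φ) (c : ℝ) : IsBump (a + c) (b + c) fun x => φ (x - c) :=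
  ⟨h.test.comp_sub c, fun x => h.nonneg _, by rw [integral_sub_right_eq_self]; exact h.integral,
    fun x hx => h.supp _ fun h' => hx ⟨by linarith [h'.1], by linarith [h'.2]⟩⟩

theorem integral_mem_Icc (h : IsBump a b φ) {c x : ℝ} (hc : c ≤ x) :
    ∫ t in c..x, φ t ∈ Icc (0 : ℝ) 1 := by
  refine ⟨intervalIntegral.integral_nonneg hc fun t _ => h.nonneg t, ?_⟩
  rw [intervalIntegral.integral_of_le hc, ← h.integral]
  exact setIntegral_le_integral h.test.integrable (Eventually.of_forall h.nonneg)

theorem le (h : IsBump a b φ) : a ≤ b := by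
  by_contra h'
  have h1 : φ = fun _ => 0 := funext fun x => h.supp x (by
    rw [Icc_eq_empty h']
    exact notMem_empty x)
  have := h.integral
  rw [h1] at this
  simp at this

/-- The two masses are equal, so the primitive of the difference vanishes again to the right of `b`;
it is a difference of two numbers in `[0, 1]`. -/
theorem exists_primitive (hφ : IsBump a b φ) (hψ : IsBump a b ψ) :
    ∃ θ : ℝ → ℝ, IsTest θ ∧ (∀ x ∉ Icc a b, θ x = 0) ∧ (∀ x, |θ x| ≤ 1) ∧
      deriv θ = fun x => φ x - ψ x := by
  have h0 : Continuous fun x => φ x - ψ x := hφ.test.continuous.sub hψ.test.continuous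
  set θ : ℝ → ℝ := fun x => ∫ t in (a - 1)..x, (φ t - ψ t) with hθ
  have hd : ∀ x, HasDerivAt θ (φ x - ψ x) x := fun x =>
    (h0.integral_hasStrictDerivAt (a - 1) x).hasDerivAt
  have hab := hφ.le
  have hs : ∀ x ∉ Icc a b, θ x = 0 := fun x hx => by
    by_cases hxa : x < a
    · have h1 : ∀ t ∈ uIcc (a - 1) x, φ t - ψ t = 0 := fun t ht => by
        have h2 : t ∉ Icc a b := fun h3 => by
          have := ht.2
          rw [le_sup_iff] at this
          rcases this with h4 | h4 <;> linarith [h3.1]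
        rw [hφ.supp t h2, hψ.supp t h2, sub_zero]
      rw [hθ]
      simp only
      rw [intervalIntegral.integral_congr h1]
      simp
    · have hxb : b < x := by
        by_contra h'
        exact hx ⟨not_lt.1 hxa, not_lt.1 h'⟩
      have h1 : ∀ {χ : ℝ → ℝ}, IsBump a b χ → ∫ t in (a - 1)..x, χ t = 1 := fun {χ} hχ => by
        rw [intervalIntegral.integral_eq_integral_of_support_subset, hχ.integral]
        intro t ht
        have h2 : t ∈ Icc a b := by
          by_contra h'
          exact ht (hχ.supp t h')
        exact ⟨by linarith [h2.1], by linarith [h2.2]⟩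
      rw [hθ]
      simp only
      rw [intervalIntegral.integral_sub (hφ.test.continuous.intervalIntegrable _ _)
        (hψ.test.continuous.intervalIntegrable _ _), h1 hφ, h1 hψ, sub_self]
  refine ⟨θ, isTest_of_hasDerivAt (hφ.test.1.sub hψ.test.1) hd hs, hs, fun x => ?_,
    funext fun x => (hd x).deriv⟩
  by_cases hx : x ∈ Icc a b
  · have h1 := hφ.integral_mem_Icc (c := a - 1) (x := x) (by linarith [hx.1])
    have h2 := hψ.integral_mem_Icc (c := a - 1) (x := x) (by linarith [hx.1])
    rw [hθ]
    simp only
    rw [intervalIntegral.integral_sub (hφ.test.continuous.intervalIntegrable _ _)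
        (hψ.test.continuous.intervalIntegrable _ _), abs_le]
    constructor <;> linarith [h1.1, h1.2, h2.1, h2.2]
  · rw [hs x hx]
    simp

end IsBump

/-- The difference of the bumps is the derivative of a test function bounded by `1` on an interval
of length `b - a`, and its `L¹` norm is what the weak derivative sees. -/
theorem PotBound.norm_avgOp_sub_le (h : PotBound T M V) {a b : ℝ} {φ ψ : ℝ → ℝ} (ha : 0 < a)
    (hb : b < T) (hφ : IsBump a b φ) (hψ : IsBump a b ψ) :
    ‖avgOp T V φ - avgOp T V ψ‖ ≤ M * (b - a) := by
  obtain ⟨θ, hθ, hs, h1, hd⟩ := hφ.exists_primitive hψ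
  have hsub : Icc a b ⊆ Ioo 0 T := fun x hx => ⟨ha.trans_le hx.1, hx.2.trans_lt hb⟩
  have hT : 0 ≤ T := by linarith [hφ.le]
  have hts : tsupport θ ⊆ Ioo 0 T := (closure_minimal (fun x hx => by
    by_contra h'
    exact hx (hs x h')) isClosed_Icc).trans hsub
  have h2 := h.norm_avgOp_iteratedDeriv_le (k := 1) (by omega) hθ hts
  rw [iteratedDeriv_one, hd, h.avgOp_sub hT hφ.test (hφ.tsupport_subset.trans hsub) hψ.test
    (hψ.tsupport_subset.trans hsub)] at h2
  refine h2.trans (mul_le_mul_of_nonneg_left ?_ h.nonneg)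
  have h3 : ∫ t, |θ t| = ∫ t in Icc a b, |θ t| := by
    rw [← integral_indicator measurableSet_Icc]
    refine integral_congr_ae (Eventually.of_forall fun t => ?_)
    by_cases ht : t ∈ Icc a b
    · simp [ht]
    · simp [ht, hs t ht]
  rw [h3]
  refine (setIntegral_mono_on hθ.integrable.abs.integrableOn (integrableOn_const (C := (1 : ℝ))
    (by simp)) measurableSet_Icc fun t _ => h1 t).trans (le_of_eq ?_)
  simp [hφ.le]

theorem PotBound.norm_avgOp_le (h : PotBound T M V) {a b : ℝ} {φ : ℝ → ℝ} (ha : 0 < a)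
    (hb : b < T) (hφ : IsBump a b φ) : ‖avgOp T V φ‖ ≤ M := by
  have hsub : Icc a b ⊆ Ioo 0 T := fun x hx => ⟨ha.trans_le hx.1, hx.2.trans_lt hb⟩
  have h2 := h.norm_avgOp_iteratedDeriv_le (k := 0) (by omega) hφ.test
    (hφ.tsupport_subset.trans hsub)
  simp only [abs_of_nonneg (hφ.nonneg _), hφ.integral, mul_one, iteratedDeriv_zero] at h2
  exact h2

/-- The second difference of `φ` is the second derivative of its twofold backward integral, which is
nonnegative with mass `s²`. -/
theorem PotBound.norm_avgOp_second_le (h : PotBound T M V) {a b s : ℝ} {φ : ℝ → ℝ} (ha : 0 < a)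
    (hs : 0 ≤ s) (hb : b + 2 * s < T) (hφ : IsBump a b φ) :
    ‖avgOp T V φ + avgOp T V (fun t => φ (t - 2 * s)) - (2 : ℂ) • avgOp T V fun t => φ (t - s)‖ ≤
      M * s ^ 2 := by
  have hT : 0 ≤ T := by linarith [hφ.le]
  have hsub : ∀ {c d : ℝ} {χ : ℝ → ℝ}, IsBump c d χ → a ≤ c → d ≤ b + 2 * s →
      tsupport χ ⊆ Ioo 0 T := fun {c d χ} hχ hc hd => hχ.tsupport_subset.trans fun x hx =>
    ⟨ha.trans_le (hc.trans hx.1), (hx.2.trans hd).trans_lt hb⟩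
  have h0 := hsub hφ le_rfl (by linarith)
  have h1 := hφ.comp_sub s
  have h1' := hsub h1 (by linarith) (by linarith)
  have h2 := h1.comp_sub s
  have h2' := hsub h2 (by linarith) (by linarith)
  have e1 : avgOp T V (nabla s φ) = avgOp T V φ - avgOp T V fun t => φ (t - s) :=
    h.avgOp_sub hT hφ.test h0 h1.test h1'
  have e2 : avgOp T V (fun t => nabla s φ (t - s)) =
      avgOp T V (fun t => φ (t - s)) - avgOp T V fun t => φ (t - s - s) :=
    h.avgOp_sub hT h1.test h1' h2.test h2'
  have t1 : tsupport (nabla s φ) ⊆ Ioo 0 T :=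
    (tsupport_sub φ _).trans (union_subset h0 h1')
  have t2 : tsupport (fun t => nabla s φ (t - s)) ⊆ Ioo 0 T :=
    (tsupport_sub (fun t => φ (t - s)) _).trans (union_subset h1' h2')
  have e3 : avgOp T V (nabla s (nabla s φ)) =
      avgOp T V (nabla s φ) - avgOp T V fun t => nabla s φ (t - s) :=
    h.avgOp_sub hT (hφ.test.nabla s) t1 ((hφ.test.nabla s).comp_sub s) t2
  have h3 : tsupport ((back s)^[2] φ) ⊆ Ioo 0 T := by
    refine (closure_minimal (t := Icc a (b + s + s)) (fun x hx => ?_) isClosed_Icc).trans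
      fun x hx => ⟨ha.trans_le hx.1, hx.2.trans_lt (by linarith)⟩
    by_contra h'
    exact hx (support_back hs (support_back hs hφ.supp) x h')
  have h4 := h.norm_avgOp_iteratedDeriv_le (k := 2) le_rfl (hφ.test.back_iterate hs 2) h3
  rw [iteratedDeriv_back_iterate hφ.test hs 2] at h4
  simp only [abs_of_nonneg (back_iterate_nonneg hφ.nonneg hs 2 _)] at h4
  rw [integral_back_iterate hφ.test hs 2, hφ.integral, mul_one] at h4
  refine le_trans (le_of_eq ?_) h4
  congr 1
  change _ = avgOp T V (nabla s (nabla s φ))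
  rw [e3, e1, e2]
  have h5 : (fun t => φ (t - s - s)) = fun t => φ (t - 2 * s) := by
    ext t
    congr 1
    ring
  rw [h5]
  module

end potential


/-! ### A Lipschitz family of operators representing the potential -/

section timeRegularity

variable {T M : ℝ} {V : ℝ → ℝ → ℝ}

theorem exists_isBump {r : ℝ} (hr : 0 < r) : ∃ φ, IsBump (-r) r φ := by
  let φ : ContDiffBump (0 : ℝ) := ⟨r / 2, r, by positivity, by linarith⟩
  refine ⟨φ.normed volume, ⟨φ.contDiff_normed, φ.hasCompactSupport_normed⟩, φ.nonneg_normed,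
    φ.integral_normed, fun x hx => ?_⟩
  by_contra h
  have h1 : x ∈ Function.support (φ.normed volume) := h
  rw [φ.support_normed_eq, Real.ball_eq_Ioo] at h1
  exact hx ⟨by linarith [h1.1], by linarith [h1.2]⟩

/-- The multiplication operators by the potential, regularized in time. -/
theorem PotBound.exists_family (h : PotBound T M V) (hT : 0 < T) :
    ∃ Q : ℝ → SpinorL2 →L[ℂ] SpinorL2, (∀ t ∈ Icc 0 T, ‖Q t‖ ≤ M) ∧
      (∀ t ∈ Icc 0 T, ∀ s ∈ Icc 0 T, ‖Q t - Q s‖ ≤ M * |t - s|) ∧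
      (∀ t s, t + s ∈ Icc 0 T → t - s ∈ Icc 0 T →
        ‖Q (t + s) + Q (t - s) - (2 : ℂ) • Q t‖ ≤ M * s ^ 2) ∧
      ∀ t a b φ, 0 < a → b < T → IsBump a b φ → t ∈ Icc a b →
        ‖Q t - avgOp T V φ‖ ≤ M * (b - a) := by
  have hM := h.nonneg
  set r : ℕ → ℝ := fun n => T / (4 * (n + 1)) with hr
  have hrpos : ∀ n, 0 < r n := fun n => by positivity
  choose φ hφ using fun n => exists_isBump (hrpos n)
  -- The centres are pulled towards `T/2`, so that the bumps of radius `r n` stay inside `(0, T)`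
  -- even for `t = 0` and `t = T`. The map is affine in `t`, so symmetric second differences remain
  -- symmetric.
  set c : ℕ → ℝ → ℝ := fun n t => t + (T / 2 - t) / (n + 1) with hc
  have hB : ∀ n t, IsBump (-r n + c n t) (r n + c n t) fun u => φ n (u - c n t) :=
    fun n t => (hφ n).comp_sub (c n t)
  have hfour : ∀ n, T / (n + 1) = 4 * r n := fun n => by
    simp only [hr]
    field_simp
  have hcle : ∀ n, ∀ t ∈ Icc 0 T, |c n t - t| ≤ 2 * r n := fun n t ht => by
    have h1 : c n t - t = (T / 2 - t) / (n + 1) := by simp [hc]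
    rw [h1, abs_div, abs_of_pos (by positivity : (0 : ℝ) < n + 1), div_le_iff₀ (by positivity)]
    have h2 : 2 * r n * (n + 1) = T / 2 := by
      simp only [hr]
      field_simp
      ring
    rw [h2, abs_le]
    constructor <;> linarith [ht.1, ht.2]
  have hcin : ∀ n, ∀ t ∈ Icc 0 T, 0 < -r n + c n t ∧ r n + c n t < T := fun n t ht => by
    have h1 : c n t = t * (1 - 1 / (n + 1)) + 2 * r n := by
      simp only [hc, hr]
      field_simp
      ring
    have h2 : (0 : ℝ) ≤ 1 - 1 / (n + 1) := by
      rw [sub_nonneg, div_le_one (by positivity)]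
      have : (0 : ℝ) ≤ n := Nat.cast_nonneg n
      linarith
    have h3 : T * (1 - 1 / (n + 1)) = T - 4 * r n := by
      rw [← hfour]
      ring
    have h4 := mul_nonneg ht.1 h2
    have h5 := mul_le_mul_of_nonneg_right ht.2 h2
    have := hrpos n
    rw [h1]
    constructor <;> linarith
  set A : ℕ → ℝ → SpinorL2 →L[ℂ] SpinorL2 := fun n t => avgOp T V fun u => φ n (u - c n t) with hA
  have hAsub : ∀ n t a b ψ, t ∈ Icc 0 T → 0 < a → b < T → IsBump a b ψ → ∀ s ∈ Icc a b,
      ‖A n t - avgOp T V ψ‖ ≤ M * (|t - s| + 4 * r n + (b - a)) := fun n t a b ψ ht ha hb hψ s hs => by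
    have h1 := hcin n t ht
    have h2 := abs_le.1 (hcle n t ht)
    have h3 := abs_le.1 (le_refl |t - s|)
    have h4 := hrpos n
    refine (h.norm_avgOp_sub_le (a := min (-r n + c n t) a) (b := max (r n + c n t) b)
      (lt_min h1.1 ha) (max_lt h1.2 hb) ((hB n t).mono (min_le_left _ _) (le_max_left _ _))
      (hψ.mono (min_le_right _ _) (le_max_right _ _))).trans ?_
    refine mul_le_mul_of_nonneg_left ?_ hM
    rcases max_cases (r n + c n t) b with h5 | h5 <;>
      rcases min_cases (-r n + c n t) a with h6 | h6 <;>
      linarith [h2.1, h2.2, h3.1, h3.2, hs.1, hs.2]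
  have hAA : ∀ n m, ∀ t ∈ Icc 0 T, ∀ s ∈ Icc 0 T,
      ‖A n t - A m s‖ ≤ M * (|t - s| + 4 * r n + 4 * r m) := fun n m t ht s hs => by
    have h1 := hcin n t ht
    have h2 := abs_le.1 (hcle n t ht)
    have h3 := abs_le.1 (le_refl |t - s|)
    have h4 := hrpos n
    have h1' := hcin m s hs
    have h2' := abs_le.1 (hcle m s hs)
    have h4' := hrpos m
    refine (h.norm_avgOp_sub_le (a := min (-r n + c n t) (-r m + c m s))
      (b := max (r n + c n t) (r m + c m s))
      (lt_min h1.1 h1'.1) (max_lt h1.2 h1'.2) ((hB n t).mono (min_le_left _ _) (le_max_left _ _))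
      ((hB m s).mono (min_le_right _ _) (le_max_right _ _))).trans ?_
    refine mul_le_mul_of_nonneg_left ?_ hM
    rcases max_cases (r n + c n t) (r m + c m s) with h5 | h5 <;>
      rcases min_cases (-r n + c n t) (-r m + c m s) with h6 | h6 <;>
      linarith [h2.1, h2.2, h2'.1, h2'.2, h3.1, h3.2]
  have hr0 : Tendsto r atTop (𝓝 0) := by
    have := (tendsto_one_div_add_atTop_nhds_zero_nat (𝕜 := ℝ)).const_mul (T / 4)
    rw [mul_zero] at this
    refine this.congr fun n => ?_
    simp only [hr]
    field_simp
  have hranti : Antitone r := fun n m hnm => by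
    simp only [hr]
    have : (n : ℝ) ≤ m := by exact_mod_cast hnm
    gcongr
  have hcauchy : ∀ t ∈ Icc 0 T, ∃ L, Tendsto (fun n => A n t) atTop (𝓝 L) := fun t ht => by
    refine cauchySeq_tendsto_of_complete (cauchySeq_of_le_tendsto_0 (fun N => M * (8 * r N))
      (fun n m N hn hm => ?_) ?_)
    · rw [dist_eq_norm]
      refine (hAA n m t ht t ht).trans (mul_le_mul_of_nonneg_left ?_ hM)
      rw [sub_self, abs_zero]
      linarith [hranti hn, hranti hm]
    · simpa using (hr0.const_mul 8).const_mul M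
  choose! Q hQ using hcauchy
  refine ⟨Q, fun t ht => ?_, fun t ht s hs => ?_, ?_, ?_⟩
  · exact le_of_tendsto (hQ t ht).norm (Eventually.of_forall fun n =>
      h.norm_avgOp_le (hcin n t ht).1 (hcin n t ht).2 (hB n t))
  · have h1 := ((hQ t ht).sub (hQ s hs)).norm
    have h2 : Tendsto (fun n => M * (|t - s| + 4 * r n + 4 * r n)) atTop (𝓝 (M * |t - s|)) := by
      have := ((((hr0.const_mul 4).const_add |t - s|).add (hr0.const_mul 4)).const_mul M)
      simpa using this
    exact le_of_tendsto_of_tendsto' h1 h2 fun n => hAA n n t ht s hs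
  · have key : ∀ t s, 0 ≤ s → t + s ∈ Icc 0 T → t - s ∈ Icc 0 T →
        ‖Q (t + s) + Q (t - s) - (2 : ℂ) • Q t‖ ≤ M * s ^ 2 := fun t s hs h1 h2 => by
      have h3 : t ∈ Icc 0 T := ⟨by linarith [h2.1], by linarith [h1.2]⟩
      refine le_of_tendsto (((hQ _ h1).add (hQ _ h2)).sub ((hQ _ h3).const_smul (2 : ℂ))).norm
        (Eventually.of_forall fun n => ?_)
      -- The slope of the affine map `c n`. As `q ≤ 1`, passing to the step `qs` only improves the
      -- bound.
      set q : ℝ := 1 - 1 / ((n : ℝ) + 1) with hq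
      have hq0 : 0 ≤ q := by
        rw [hq, sub_nonneg, div_le_one (by positivity)]
        have : (0 : ℝ) ≤ n := Nat.cast_nonneg n
        linarith
      have hq1 : q ≤ 1 := by
        rw [hq]
        have : (0 : ℝ) ≤ 1 / ((n : ℝ) + 1) := by positivity
        linarith
      have ec : ∀ u, c n u = q * u + T / 2 / (n + 1) := fun u => by
        simp only [hc, hq]
        field_simp
        ring
      have e1 : c n (t + s) = c n (t - s) + 2 * (q * s) := by
        rw [ec, ec]
        ring
      have e2 : c n t = c n (t - s) + q * s := by
        rw [ec, ec]
        ring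
      have h4 := h.norm_avgOp_second_le (hcin n _ h2).1 (mul_nonneg hq0 hs) (by
        have := (hcin n _ h1).2
        rw [e1] at this
        linarith) (hB n (t - s))
      have f1 : (fun u => φ n (u - 2 * (q * s) - c n (t - s))) = fun u => φ n (u - c n (t + s)) := by
        ext u
        rw [e1]
        congr 1
        ring
      have f2 : (fun u => φ n (u - q * s - c n (t - s))) = fun u => φ n (u - c n t) := by
        ext u
        rw [e2]
        congr 1
        ring
      rw [f1, f2, add_comm] at h4
      refine h4.trans (mul_le_mul_of_nonneg_left ?_ hM)
      rw [mul_pow]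
      exact mul_le_of_le_one_left (sq_nonneg s) (pow_le_one₀ hq0 hq1)
    intro t s h1 h2
    rcases le_total 0 s with hs | hs
    · exact key t s hs h1 h2
    · have := key t (-s) (by linarith) (by rwa [← sub_eq_add_neg]) (by rwa [sub_neg_eq_add])
      rw [← sub_eq_add_neg, sub_neg_eq_add, neg_sq, add_comm (Q (t - s))] at this
      exact this
  · intro t a b ψ ha hb hψ ht
    have ht' : t ∈ Icc 0 T := ⟨ha.le.trans ht.1, ht.2.trans hb.le⟩
    have h1 := ((hQ t ht').sub_const (avgOp T V ψ)).norm
    have h2 : Tendsto (fun n => M * (|t - t| + 4 * r n + (b - a))) atTop (𝓝 (M * (b - a))) := by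
      have := ((((hr0.const_mul 4).const_add |t - t|).add_const (b - a)).const_mul M)
      simpa using this
    exact le_of_tendsto_of_tendsto' h1 h2 fun n => hAsub n t a b ψ ht' ha hb hψ t ht

end timeRegularity


/-! ### Identification with multiplication by the potential -/

section identification

variable {T M : ℝ} {V : ℝ → ℝ → ℝ}

/-- By Lebesgue differentiation in time, for almost every `x` the averages converge to `V t x` at
almost every `t`; Fubini exchanges the null sets. For such an interior `t` the averages also
converge in operator norm to `Q t`, and an almost everywhere convergent subsequence identifies the
limits. -/
theorem PotBound.ae_isMul (h : PotBound T M V) (hT : 0 < T) {Q : ℝ → SpinorL2 →L[ℂ] SpinorL2}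
    (hQ : ∀ t a b φ, 0 < a → b < T → IsBump a b φ → t ∈ Icc a b →
      ‖Q t - avgOp T V φ‖ ≤ M * (b - a)) :
    ∀ᵐ t ∂volume.restrict (Icc 0 T), IsMul (Q t) fun x => (V t x : ℂ) • 1 := by
  let ρ : ℕ → ContDiffBump (0 : ℝ) := fun n =>
    ⟨((n : ℝ) + 1)⁻¹, 2 * ((n : ℝ) + 1)⁻¹, by positivity, by
      have : 0 < ((n : ℝ) + 1)⁻¹ := by positivity
      linarith⟩
  have h0 : Tendsto (fun n => (ρ n).rOut) atTop (𝓝 0) := by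
    have := (tendsto_one_div_add_atTop_nhds_zero_nat (𝕜 := ℝ)).const_mul 2
    simpa [ρ] using this
  set θ : ℕ → ℝ → ℝ → ℝ := fun n t s => (ρ n).normed volume (t - s) with hθ
  have h1 : ∀ᵐ x, ∀ᵐ t ∂volume.restrict (Icc 0 T),
      Tendsto (fun n => timeAvg T V (θ n t) x) atTop (𝓝 (V t x)) := by
    filter_upwards [h.intervalIntegrable hT.le] with x hx
    rw [intervalIntegrable_iff_integrableOn_Icc_of_le hT.le,
      ← integrable_indicator_iff measurableSet_Icc] at hx
    rw [ae_restrict_iff' measurableSet_Icc]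
    filter_upwards [ContDiffBump.ae_convolution_tendsto_right_of_locallyIntegrable (μ := volume) h0
      (K := 2) (Eventually.of_forall fun n => le_rfl) hx.locallyIntegrable] with t ht htI
    rw [indicator_of_mem htI] at ht
    refine ht.congr fun n => ?_
    rw [convolution_eq_swap, timeAvg, intervalIntegral.integral_of_le hT.le,
      ← integral_Icc_eq_integral_Ioc, ← integral_indicator measurableSet_Icc]
    refine integral_congr_ae (Eventually.of_forall fun s => ?_)
    by_cases hs : s ∈ Icc 0 T <;> simp [hs, hθ]
  have h2 : ∀ᵐ t ∂volume.restrict (Icc 0 T), ∀ᵐ x,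
      Tendsto (fun n => timeAvg T V (θ n t) x) atTop (𝓝 (V t x)) := by
    refine (Measure.ae_ae_comm ?_).1 h1
    refine measurableSet_tendsto_fun (fun n => ?_) (h.meas.comp measurable_swap)
    have h3 : StronglyMeasurable fun p : (ℝ × ℝ) × ℝ => θ n p.1.2 p.2 * V p.2 p.1.1 := by
      refine Measurable.stronglyMeasurable ?_
      have h4 : Measurable fun p : (ℝ × ℝ) × ℝ => V p.2 p.1.1 :=
        h.meas.comp (measurable_snd.prodMk (measurable_fst.comp measurable_fst))
      have h5 : Measurable fun p : (ℝ × ℝ) × ℝ => θ n p.1.2 p.2 :=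
        (ρ n).continuous_normed.measurable.comp
          ((measurable_snd.comp measurable_fst).sub measurable_snd)
      exact h5.mul h4
    unfold timeAvg intervalIntegral
    exact (h3.integral_prod_right' (ν := volume.restrict (Ioc 0 T))).measurable.sub
      (h3.integral_prod_right' (ν := volume.restrict (Ioc T 0))).measurable
  have h3 : ∀ᵐ t ∂volume.restrict (Icc 0 T), t ∈ Ioo 0 T := by
    rw [← restrict_Ioo_eq_restrict_Icc]
    exact ae_restrict_mem measurableSet_Ioo
  filter_upwards [h2, h3] with t ht htI f
  have hb : ∀ n, IsBump (-(ρ n).rOut + t) ((ρ n).rOut + t) (θ n t) := fun n => by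
    refine ⟨⟨(ρ n).contDiff_normed.comp (contDiff_const.sub contDiff_id),
      (ρ n).hasCompactSupport_normed.comp_homeomorph (Homeomorph.subLeft t)⟩,
      fun s => (ρ n).nonneg_normed _, ?_, fun s hs => ?_⟩
    · rw [integral_sub_left_eq_self (fun s => (ρ n).normed volume s), (ρ n).integral_normed]
    · by_contra h4
      have h5 : t - s ∈ Function.support ((ρ n).normed volume) := h4
      rw [(ρ n).support_normed_eq, Real.ball_eq_Ioo] at h5
      exact hs ⟨by linarith [h5.2], by linarith [h5.1]⟩
  have hev : ∀ᶠ n in atTop, 0 < -(ρ n).rOut + t ∧ (ρ n).rOut + t < T := by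
    filter_upwards [h0.eventually (gt_mem_nhds htI.1),
      h0.eventually (gt_mem_nhds (sub_pos.2 htI.2))] with n h4 h5
    constructor <;> linarith
  have hlim : Tendsto (fun n => avgOp T V (θ n t) f) atTop (𝓝 (Q t f)) := by
    rw [tendsto_iff_norm_sub_tendsto_zero]
    have h4 : Tendsto (fun n => M * (2 * (ρ n).rOut) * ‖f‖) atTop (𝓝 0) := by
      simpa using ((h0.const_mul 2).const_mul M).mul_const ‖f‖
    refine squeeze_zero' (Eventually.of_forall fun n => norm_nonneg _) ?_ h4
    filter_upwards [hev] with n hn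
    have hpos := (ρ n).rOut_pos
    have h5 := hQ t _ _ _ hn.1 hn.2 (hb n) ⟨by linarith, by linarith⟩
    rw [← sub_apply, ← norm_neg, ← neg_apply, neg_sub]
    refine (ContinuousLinearMap.le_of_opNorm_le _ h5 f).trans (le_of_eq ?_)
    ring
  obtain ⟨k, hk, hkt⟩ := (tendstoInMeasure_of_tendsto_Lp hlim).exists_seq_tendsto_ae
  have hall : ∀ᵐ x, ∀ n, (0 < -(ρ n).rOut + t ∧ (ρ n).rOut + t < T) →
      (avgOp T V (θ n t) f) x = (timeAvg T V (θ n t) x : ℂ) • f x := by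
    refine ae_all_iff.2 fun n => ?_
    by_cases hn : 0 < -(ρ n).rOut + t ∧ (ρ n).rOut + t < T
    · filter_upwards [h.isMul_avgOp (hb n).test ((hb n).tsupport_subset.trans fun s hs =>
        ⟨hn.1.trans_le hs.1, hs.2.trans_lt hn.2⟩) f] with x hx _
      rw [hx]
      rfl
    · exact Eventually.of_forall fun x h' => absurd h' hn
  filter_upwards [hkt, hall, ht] with x h4 h5 h6
  refine tendsto_nhds_unique h4 ?_
  have h7 : Tendsto (fun n => (timeAvg T V (θ (k n) t) x : ℂ) • f x) atTop
      (𝓝 ((V t x : ℂ) • f x)) :=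
    (((Complex.continuous_ofReal.tendsto _).comp h6).smul_const (f x)).comp hk.tendsto_atTop
  refine h7.congr' ?_
  filter_upwards [hk.tendsto_atTop.eventually hev] with n hn
  exact (h5 (k n) hn).symm

/-- The regularity of the potential, on the Fourier side. -/
structure PotOp (T M C : ℝ) (V : ℝ → ℝ → ℝ) (Q : ℝ → SpinorL2 →L[ℂ] SpinorL2) : Prop where
  norm_le : ∀ t ∈ Icc 0 T, ‖Q t‖ ≤ M
  lip : ∀ t ∈ Icc 0 T, ∀ s ∈ Icc 0 T, ‖Q t - Q s‖ ≤ M * |t - s|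
  second : ∀ t s, t + s ∈ Icc 0 T → t - s ∈ Icc 0 T →
    ‖Q (t + s) + Q (t - s) - (2 : ℂ) • Q t‖ ≤ M * s ^ 2
  ae_eq : ∀ᵐ t ∂volume.restrict (Icc 0 T), IsMul (ift * Q t * ft) fun x => (V t x : ℂ) • 1
  sobBdd : ∀ t ∈ Icc 0 T, SobBdd C (Q t)
  commute : ∀ t ∈ Icc 0 T, Commute (Q t) pauliOp₃

theorem continuousOn_of_lipschitz {E : Type*} [SeminormedAddCommGroup E] {Q : ℝ → E}
    (h : ∀ t ∈ Icc 0 T, ∀ s ∈ Icc 0 T, ‖Q t - Q s‖ ≤ M * |t - s|) : ContinuousOn Q (Icc 0 T) := by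
  refine (LipschitzOnWith.of_dist_le_mul (K := M.toNNReal) fun t ht s hs => ?_).continuousOn
  rw [dist_eq_norm, Real.dist_eq]
  exact (h t ht s hs).trans (mul_le_mul_of_nonneg_right (le_max_left _ _) (abs_nonneg _))

/-- A closed condition on a continuous function holds on `[0, T]` if it holds a.e. -/
theorem forall_mem_Icc_of_ae {E : Type*} [TopologicalSpace E] {Q : ℝ → E} (hT : 0 < T)
    (hQ : ContinuousOn Q (Icc 0 T)) {S : Set E} (hS : IsClosed S)
    (h : ∀ᵐ t ∂volume.restrict (Icc 0 T), Q t ∈ S) : ∀ t ∈ Icc 0 T, Q t ∈ S := by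
  have h1 : ∀ t ∈ Ioo 0 T, Q t ∈ S := by
    by_contra! hne
    obtain ⟨t, ht, htS⟩ := hne
    have h2 : ContinuousAt Q t := hQ.continuousAt (Icc_mem_nhds ht.1 ht.2)
    have h3 : ∀ᶠ s in 𝓝 t, Q s ∉ S ∧ s ∈ Ioo 0 T :=
      (h2.eventually (hS.isOpen_compl.mem_nhds htS)).and (Ioo_mem_nhds ht.1 ht.2)
    obtain ⟨U, hU, hUo, htU⟩ := eventually_nhds_iff.1 h3
    have h4 : 0 < volume U := hUo.measure_pos volume ⟨t, htU⟩
    rw [ae_restrict_iff' measurableSet_Icc, ae_iff] at h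
    have h5 : volume U = 0 := by
      refine measure_mono_null (fun s hs => ?_) h
      exact fun h' => (hU s hs).1 (h' (Ioo_subset_Icc_self (hU s hs).2))
    exact h4.ne' h5
  intro t ht
  have h2 : t ∈ closure (Ioo 0 T) := by rwa [closure_Ioo hT.ne]
  have h3 := (hQ t ht).mono Ioo_subset_Icc_self
  have := h3.mem_closure_image h2
  exact hS.closure_subset_iff.2 (image_subset_iff.2 h1) this

/-- Boundedness on the weighted spaces and commutation with `σ₃` are checked at the almost all times
where `Q t` is multiplication by `V t`. Both are closed conditions, so they extend to all times by
continuity. -/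
theorem PotBound.exists_potOp (h : PotBound T M V) (hT : 0 < T) :
    ∃ Q, PotOp T M (40 * M) V Q := by
  obtain ⟨Q, h1, h2, h3, h4⟩ := h.exists_family hT
  have hae := h.ae_isMul hT h4
  have hn : ∀ W : SpinorL2 →L[ℂ] SpinorL2, ‖ft * W * ift‖ ≤ ‖W‖ := fun W =>
    ContinuousLinearMap.opNorm_le_bound _ (norm_nonneg _) fun f => by
      change ‖ft (W (ift f))‖ ≤ _
      rw [norm_ft]
      exact (W.le_opNorm _).trans_eq (by rw [norm_ift])
  have hlip : ∀ t ∈ Icc 0 T, ∀ s ∈ Icc 0 T, ‖ft * Q t * ift - ft * Q s * ift‖ ≤ M * |t - s| :=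
    fun t ht s hs => by
    have e : ft * Q t * ift - ft * Q s * ift = ft * (Q t - Q s) * ift := by noncomm_ring
    rw [e]
    exact (hn _).trans (h2 t ht s hs)
  have hcont := continuousOn_of_lipschitz hlip
  refine ⟨fun t => ft * Q t * ift, fun t ht => (hn _).trans (h1 t ht), hlip, fun t s ht hs => ?_,
    ?_, ?_, ?_⟩
  · have e : ft * Q (t + s) * ift + ft * Q (t - s) * ift - (2 : ℂ) • (ft * Q t * ift) =
        ft * (Q (t + s) + Q (t - s) - (2 : ℂ) • Q t) * ift := by
      rw [mul_sub, mul_add, sub_mul, add_mul, mul_smul_comm, smul_mul_assoc]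
    rw [e]
    exact (hn _).trans (h3 t s ht hs)
  · filter_upwards [hae] with t ht
    have e : ift * (ft * Q t * ift) * ft = Q t := by
      ext1 f
      change ift (ft (Q t (ift (ft f)))) = _
      rw [ift_ft, ift_ft]
    rwa [e]
  · have hcl : IsClosed {W : SpinorL2 →L[ℂ] SpinorL2 | SobBdd (40 * M) W} := by
      simp only [SobBdd, ofPred_forall]
      refine isClosed_iInter fun p => isClosed_iInter fun _ => isClosed_iInter fun N =>
        isClosed_iInter fun f => isClosed_iInter fun _ => ?_
      exact (Sob.isClosed p (40 * M * N)).preimage (ContinuousLinearMap.apply ℂ SpinorL2 f).continuous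
    refine forall_mem_Icc_of_ae hT hcont hcl ?_
    filter_upwards [hae, h.space] with t ht hs
    have hm : Measurable (V t) := h.meas.comp measurable_prodMk_left
    have h5 : ∀ᵐ x, |V t x| ≤ M := by simpa using hs 0 (by omega) 0 le_rfl
    have e : Q t = realOp (V t) := ht.eq (isMul_realOp hm.aestronglyMeasurable h5)
    rw [e]
    exact sobBdd_realOp hm h.nonneg hs
  · have hcl : IsClosed {W : SpinorL2 →L[ℂ] SpinorL2 | Commute W pauliOp₃} :=
      isClosed_eq (continuous_mul_const _) (continuous_const_mul _)
    refine forall_mem_Icc_of_ae hT hcont hcl ?_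
    filter_upwards [hae] with t ht
    have h5 : Q t * pauliOp₃ = pauliOp₃ * Q t := by
      refine (ht.mul isMul_pauliOp₃).eq ((isMul_pauliOp₃.mul ht).congr
        (Eventually.of_forall fun x => ?_))
      rw [mul_smul_comm, smul_mul_assoc, one_mul, mul_one]
    change ft * Q t * ift * pauliOp₃ = pauliOp₃ * (ft * Q t * ift)
    ext1 f
    change ft (Q t (ift (pauliOp₃ f))) = pauliOp₃ (ft (Q t (ift f)))
    have h6 : ift (pauliOp₃ f) = pauliOp₃ (ift f) := by
      rw [← ift_ft (pauliOp₃ (ift f)), ft_comm_const isMul_pauliOp₃, ft_ift]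
    rw [h6, ← ft_comm_const isMul_pauliOp₃]
    exact congrArg (fun W : SpinorL2 →L[ℂ] SpinorL2 => ft (W (ift f))) h5

end identification


/-! ### The exponential of the integrated potential -/

section potentialFlow

variable {T M C : ℝ} {V : ℝ → ℝ → ℝ} {Q : ℝ → SpinorL2 →L[ℂ] SpinorL2}

theorem PotBound.ae_prod (h : PotBound T M V) :
    ∀ᵐ p ∂(volume.restrict (Icc 0 T)).prod (volume : Measure ℝ), |V p.1 p.2| ≤ M := by
  have hm : MeasurableSet {p : ℝ × ℝ | |V p.1 p.2| ≤ M} :=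
    measurableSet_le (_root_.continuous_abs.measurable.comp h.meas) measurable_const
  refine (Measure.ae_prod_iff_ae_ae hm).2 ?_
  refine (Measure.ae_ae_comm (p := fun x t => |V t x| ≤ M) ?_).1 h.bdd
  exact measurable_swap hm

theorem PotBound.abs_integral_le (h : PotBound T M V) {a b : ℝ} (ha : 0 ≤ a) (hab : a ≤ b)
    (hb : b ≤ T) : ∀ᵐ x, |∫ s in a..b, V s x| ≤ M * (b - a) := by
  filter_upwards [h.bdd] with x hx
  have h1 : ∀ᵐ s ∂volume, s ∈ uIoc a b → ‖V s x‖ ≤ M := by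
    rw [ae_restrict_iff' measurableSet_Icc] at hx
    filter_upwards [hx] with s hs hsI
    rw [uIoc_of_le hab] at hsI
    exact hs ⟨ha.trans hsI.1.le, hsI.2.trans hb⟩
  have := intervalIntegral.norm_integral_le_of_norm_le_const_ae h1
  rwa [abs_of_nonneg (by linarith : 0 ≤ b - a)] at this

theorem measurable_integral {V : ℝ → ℝ → ℝ} (hV : Measurable (Function.uncurry V)) (a b : ℝ) :
    Measurable fun x => ∫ s in a..b, V s x := by
  unfold intervalIntegral
  have h2 : StronglyMeasurable (fun p : ℝ × ℝ => V p.2 p.1) :=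
    (hV.comp measurable_swap).stronglyMeasurable
  exact (h2.integral_prod_right' (ν := volume.restrict (Ioc a b))).measurable.sub
    (h2.integral_prod_right' (ν := volume.restrict (Ioc b a))).measurable

theorem PotOp.continuousOn (h : PotOp T M C V Q) : ContinuousOn Q (Icc 0 T) :=
  continuousOn_of_lipschitz h.lip

theorem PotOp.intervalIntegrable (h : PotOp T M C V Q) {a b : ℝ} (ha : 0 ≤ a) (hab : a ≤ b)
    (hb : b ≤ T) : IntervalIntegrable Q volume a b :=
  (h.continuousOn.mono (by rw [uIcc_of_le hab]; exact Icc_subset_Icc ha hb)).intervalIntegrable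

theorem inner_realOp {v : ℝ → ℝ} {A : SpinorL2 →L[ℂ] SpinorL2}
    (hA : IsMul A fun x => (v x : ℂ) • 1) (f g : SpinorL2) :
    inner ℂ g (A f) = ∫ x, (v x : ℂ) * inner ℂ (g x) (f x) := by
  rw [L2.inner_def]
  refine integral_congr_ae ?_
  filter_upwards [hA f] with x hx
  rw [hx, smul_apply, one_apply_eq_self, inner_smul_right]

/-- The integral of the potential in time, as an operator. -/
theorem PotOp.isMul_integral (h : PotOp T M C V Q) (hb : PotBound T M V) {a b : ℝ} (ha : 0 ≤ a)
    (hab : a ≤ b) (hbT : b ≤ T) :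
    IsMul (ift * (∫ s in a..b, Q s) * ft) fun x => ((∫ s in a..b, V s x : ℝ) : ℂ) • 1 := by
  have hm := isMul_realOp (measurable_integral hb.meas a b).aestronglyMeasurable
    (hb.abs_integral_le ha hab hbT)
  suffices h1 : ift * (∫ s in a..b, Q s) * ft = realOp fun x => ∫ s in a..b, V s x by
    rw [h1]
    exact hm
  ext1 f
  -- The integral of operators is compared with the pointwise integral of `V` through a scalar
  -- pairing, which commutes with the former; Fubini does the rest.
  refine ext_inner_left ℂ fun g => ?_
  rw [inner_realOp hm]
  let Λ : (SpinorL2 →L[ℂ] SpinorL2) →L[ℂ] ℂ :=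
    (innerSL ℂ g).comp (ift.comp (ContinuousLinearMap.apply ℂ SpinorL2 (ft f)))
  have h1 : inner ℂ g ((ift * (∫ s in a..b, Q s) * ft) f) = ∫ s in a..b, Λ (Q s) :=
    (Λ.intervalIntegral_comp_comm (h.intervalIntegrable ha hab hbT)).symm
  have hsub : Ioc a b ⊆ Icc 0 T := fun s hs => ⟨ha.trans hs.1.le, hs.2.trans hbT⟩
  have h2 : ∫ s in a..b, Λ (Q s) = ∫ s in Ioc a b, ∫ x, (V s x : ℂ) * inner ℂ (g x) (f x) := by
    rw [intervalIntegral.integral_of_le hab]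
    refine integral_congr_ae ?_
    filter_upwards [ae_restrict_of_ae_restrict_of_subset hsub h.ae_eq] with s hs
    exact inner_realOp hs f g
  have hint : Integrable (fun p : ℝ × ℝ => (V p.1 p.2 : ℂ) * inner ℂ (g p.2) (f p.2))
      ((volume.restrict (Ioc a b)).prod volume) := by
    have h3 : Integrable (fun x => inner ℂ (g x) (f x)) := L2.integrable_inner g f
    refine (h3.comp_snd (volume.restrict (Ioc a b))).bdd_mul (c := M) ?_ ?_
    · exact (Complex.measurable_ofReal.comp hb.meas).aestronglyMeasurable
    · have h4 : (volume.restrict (Ioc a b)).prod (volume : Measure ℝ) ≪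
          (volume.restrict (Icc 0 T)).prod volume :=
        (Measure.prod_mono (Measure.restrict_mono hsub le_rfl) le_rfl).absolutelyContinuous
      filter_upwards [h4.ae_le hb.ae_prod] with p hp
      rwa [Complex.norm_real]
  rw [h1, h2, integral_integral_swap hint]
  refine integral_congr_ae (Eventually.of_forall fun x => ?_)
  simp only
  rw [integral_mul_const, integral_complex_ofReal, intervalIntegral.integral_of_le hab]

/-- Start from `|e^{-ix} - 1| ≤ |x|` and apply the mean value inequality twice on `[-|y|, |y|]`;
each application gains a factor `|y|`. -/
theorem norm_exp_taylor_le (y : ℝ) :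
    ‖Complex.exp (-(Complex.I * y)) - (1 - Complex.I * y - (y : ℂ) ^ 2 / 2)‖ ≤ |y| ^ 3 := by
  have hexp : ∀ x : ℝ, HasDerivAt (fun x : ℝ => Complex.exp (-(Complex.I * x)))
      (Complex.exp (-(Complex.I * x)) * -(Complex.I * 1)) x := fun x =>
    (((Complex.ofRealCLM.hasDerivAt (x := x)).const_mul Complex.I).neg).cexp
  have h0 : ∀ x : ℝ, ‖Complex.exp (-(Complex.I * x)) - 1‖ ≤ |x| := fun x => by
    have := Real.norm_exp_I_mul_ofReal_sub_one_le (x := -x)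
    rwa [Complex.ofReal_neg, mul_neg, norm_neg, Real.norm_eq_abs] at this
  have hconv : Convex ℝ (Icc (-|y|) |y|) := convex_Icc _ _
  have h0m : (0 : ℝ) ∈ Icc (-|y|) |y| := ⟨by simp, abs_nonneg y⟩
  have h1 : ∀ x ∈ Icc (-|y|) |y|,
      ‖Complex.exp (-(Complex.I * x)) - 1 + Complex.I * x‖ ≤ |y| * |y| := fun x hx => by
    have hd : ∀ x ∈ Icc (-|y|) |y|, HasDerivWithinAt
        (fun x : ℝ => Complex.exp (-(Complex.I * x)) - 1 + Complex.I * x)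
        (Complex.exp (-(Complex.I * x)) * -(Complex.I * 1) + Complex.I * 1) (Icc (-|y|) |y|) x :=
      fun x _ => (((hexp x).sub_const 1).add
        ((Complex.ofRealCLM.hasDerivAt (x := x)).const_mul Complex.I)).hasDerivWithinAt
    have := hconv.norm_image_sub_le_of_norm_hasDerivWithin_le (C := |y|) hd (fun z hz => ?_) h0m hx
    · simp only [Complex.ofReal_zero, mul_zero, neg_zero, Complex.exp_zero, sub_self, add_zero,
        sub_zero, Real.norm_eq_abs] at this
      exact this.trans (mul_le_mul_of_nonneg_left (abs_le.2 hx) (abs_nonneg y))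
    · have e : Complex.exp (-(Complex.I * z)) * -(Complex.I * 1) + Complex.I * 1 =
          -Complex.I * (Complex.exp (-(Complex.I * z)) - 1) := by ring
      rw [e, norm_mul, norm_neg, Complex.norm_I, one_mul]
      exact (h0 z).trans (abs_le.2 hz)
  have hd : ∀ x ∈ Icc (-|y|) |y|, HasDerivWithinAt
      (fun x : ℝ => Complex.exp (-(Complex.I * x)) - 1 + Complex.I * x + (x : ℂ) * x / 2)
      (Complex.exp (-(Complex.I * x)) * -(Complex.I * 1) + Complex.I * 1 +
        (1 * (x : ℂ) + x * 1) / 2) (Icc (-|y|) |y|) x :=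
    fun x _ => ((((hexp x).sub_const 1).add
      ((Complex.ofRealCLM.hasDerivAt (x := x)).const_mul Complex.I)).add
      (((Complex.ofRealCLM.hasDerivAt (x := x)).mul
        (Complex.ofRealCLM.hasDerivAt (x := x))).div_const 2)).hasDerivWithinAt
  have := hconv.norm_image_sub_le_of_norm_hasDerivWithin_le (C := |y| * |y|) hd (fun z hz => ?_)
    h0m ⟨neg_abs_le y, le_abs_self y⟩
  · simp only [Complex.ofReal_zero, mul_zero, neg_zero, Complex.exp_zero, sub_self, add_zero,
      sub_zero, Real.norm_eq_abs, zero_div] at this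
    refine le_trans (le_of_eq ?_) (this.trans (le_of_eq (by ring)))
    congr 1
    ring
  · have e : Complex.exp (-(Complex.I * z)) * -(Complex.I * 1) + Complex.I * 1 +
        (1 * (z : ℂ) + z * 1) / 2 =
        -Complex.I * (Complex.exp (-(Complex.I * z)) - 1 + Complex.I * z) := by
      linear_combination (z : ℂ) * Complex.I_mul_I
    rw [e, norm_mul, norm_neg, Complex.norm_I, one_mul]
    exact h1 z hz

/-- The evolution under the potential, on the Fourier side. -/
noncomputable def potFlow (V : ℝ → ℝ → ℝ) (a b : ℝ) : SpinorL2 →L[ℂ] SpinorL2 :=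
  ft * (scalOp fun x => Complex.exp (-(Complex.I * ((∫ s in a..b, V s x : ℝ) : ℂ)))) * ift

theorem isMul_exp (hV : Measurable (Function.uncurry V)) (a b : ℝ) :
    IsMul (scalOp fun x => Complex.exp (-(Complex.I * ((∫ s in a..b, V s x : ℝ) : ℂ))))
      fun x => Complex.exp (-(Complex.I * ((∫ s in a..b, V s x : ℝ) : ℂ))) • 1 := by
  have h1 := measurable_integral hV a b
  refine isMul_scalOp (c := 1) ?_ (Eventually.of_forall fun x => ?_)
  · have : Measurable fun x => Complex.exp (-(Complex.I * ((∫ s in a..b, V s x : ℝ) : ℂ))) := by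
      fun_prop
    exact this.aestronglyMeasurable
  · rw [Complex.norm_exp]
    simp

theorem ft_potentialFlow (hV : Measurable (Function.uncurry V)) (a b : ℝ) (f : SpinorL2) :
    ft (potentialFlow hV a b f) = potFlow V a b (ft f) := by
  change _ = ft ((scalOp fun x => Complex.exp (-(Complex.I * ((∫ s in a..b, V s x : ℝ) : ℂ))))
    (ift (ft f)))
  rw [ift_ft]
  congr 1
  refine Lp.ext ?_
  filter_upwards [isMul_exp hV a b f, (memLp_potentialFlow hV a b f).coeFn_toLp] with x h1 h2
  rw [h1, potentialFlow, h2]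
  rfl

theorem norm_ft_mul_mul_ift_le (W : SpinorL2 →L[ℂ] SpinorL2) : ‖ft * W * ift‖ ≤ ‖W‖ :=
  ContinuousLinearMap.opNorm_le_bound _ (norm_nonneg _) fun f => by
    change ‖ft (W (ift f))‖ ≤ _
    rw [norm_ft]
    exact (W.le_opNorm _).trans_eq (by rw [norm_ift])

theorem ft_mul_ift : ft * ift = (1 : SpinorL2 →L[ℂ] SpinorL2) := by
  ext1 f
  exact ft_ift f

theorem ift_mul_ft : ift * ft = (1 : SpinorL2 →L[ℂ] SpinorL2) := by
  ext1 f
  exact ift_ft f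

theorem norm_potFlow_apply_le (hV : Measurable (Function.uncurry V)) (a b : ℝ) (f : SpinorL2) :
    ‖potFlow V a b f‖ ≤ ‖f‖ := by
  have h1 := (isMul_exp hV a b).norm_apply_le (c := 1) (Eventually.of_forall fun x v => by
    rw [smul_apply, one_apply_eq_self, norm_smul, Complex.norm_exp]
    simp) (ift f)
  rw [one_mul, norm_ift] at h1
  exact (norm_ft _).le.trans h1

theorem PotBound.norm_potFlow_sub_one_le (hb : PotBound T M V) {a b : ℝ} (ha : 0 ≤ a)
    (hab : a ≤ b) (hbT : b ≤ T) : ‖potFlow V a b - 1‖ ≤ M * (b - a) := by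
  have e : potFlow V a b - 1 = ft * ((scalOp fun x => Complex.exp (-(Complex.I *
      ((∫ s in a..b, V s x : ℝ) : ℂ)))) - 1) * ift := by
    rw [mul_sub, sub_mul, mul_one, ft_mul_ift]
    rfl
  rw [e]
  refine (norm_ft_mul_mul_ift_le _).trans (((isMul_exp hb.meas a b).sub IsMul.one).opNorm_le
    (mul_nonneg hb.nonneg (by linarith)) ?_)
  filter_upwards [hb.abs_integral_le ha hab hbT] with x hx
  have e1 : ∀ z : ℂ, z • (1 : Spinor →L[ℂ] Spinor) - 1 = (z - 1) • 1 := fun z => by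
    module
  rw [e1]
  refine (norm_smul_one_le _).trans (le_trans ?_ hx)
  have := Real.norm_exp_I_mul_ofReal_sub_one_le (x := -∫ s in a..b, V s x)
  rwa [Complex.ofReal_neg, mul_neg, norm_neg, Real.norm_eq_abs] at this

/-- Back on the physical side all operators are multiplications by functions of `∫ V`, so the scalar
Taylor bound applies pointwise. -/
theorem PotOp.norm_potFlow_sub_le (h : PotOp T M C V Q) (hb : PotBound T M V) {a b : ℝ}
    (ha : 0 ≤ a) (hab : a ≤ b) (hbT : b ≤ T) :
    ‖potFlow V a b - (1 - Complex.I • (∫ s in a..b, Q s) -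
      (1 / 2 : ℂ) • ((∫ s in a..b, Q s) * ∫ s in a..b, Q s))‖ ≤ (M * (b - a)) ^ 3 := by
  have hY := h.isMul_integral hb ha hab hbT
  set Y := ∫ s in a..b, Q s
  set Z := ift * Y * ft with hZ
  have eY : Y = ft * Z * ift := by
    rw [hZ]
    calc Y = (ft * ift) * Y * (ft * ift) := by rw [ft_mul_ift, one_mul, mul_one]
      _ = _ := by noncomm_ring
  have eYY : Y * Y = ft * (Z * Z) * ift := by
    rw [eY]
    calc ft * Z * ift * (ft * Z * ift) = ft * Z * (ift * ft) * Z * ift := by noncomm_ring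
      _ = _ := by rw [ift_mul_ft]; noncomm_ring
  have e : potFlow V a b - (1 - Complex.I • Y - (1 / 2 : ℂ) • (Y * Y)) =
      ft * ((scalOp fun x => Complex.exp (-(Complex.I * ((∫ s in a..b, V s x : ℝ) : ℂ)))) -
        (1 - Complex.I • Z - (1 / 2 : ℂ) • (Z * Z))) * ift := by
    rw [eYY, mul_sub, mul_sub, mul_sub, sub_mul, sub_mul, sub_mul, mul_one, ft_mul_ift,
      mul_smul_comm, smul_mul_assoc, mul_smul_comm, smul_mul_assoc, ← eY]
    rfl
  rw [e]
  refine (norm_ft_mul_mul_ift_le _).trans (((isMul_exp hb.meas a b).sub ((IsMul.one.sub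
    (hY.smul Complex.I)).sub ((hY.mul hY).smul (1 / 2 : ℂ)))).opNorm_le
    (pow_nonneg (mul_nonneg hb.nonneg (by linarith)) 3) ?_)
  filter_upwards [hb.abs_integral_le ha hab hbT] with x hx
  refine le_trans ?_ (pow_le_pow_left₀ (abs_nonneg _) hx 3)
  refine le_trans ?_ (norm_exp_taylor_le _)
  set y : ℂ := ((∫ s in a..b, V s x : ℝ) : ℂ)
  have e2 : Complex.exp (-(Complex.I * y)) • (1 : Spinor →L[ℂ] Spinor) -
      (1 - Complex.I • (y • (1 : Spinor →L[ℂ] Spinor)) -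
        (1 / 2 : ℂ) • ((y • (1 : Spinor →L[ℂ] Spinor)) * (y • 1))) =
      (Complex.exp (-(Complex.I * y)) - (1 - Complex.I * y - y ^ 2 / 2)) • 1 := by
    rw [smul_mul_assoc, one_mul]
    module
  rw [e2]
  exact norm_smul_one_le _

end potentialFlow


/-! ### The exact solution in the interaction picture -/

section solution

variable {ε T M C : ℝ} {V : ℝ → ℝ → ℝ} {Q : ℝ → SpinorL2 →L[ℂ] SpinorL2} {Φ : ℝ → SpinorL2}

/-- As a bounded operator, the pairing with a test function commutes with integration in time. -/
theorem IsTest.exists_pairing {χ : ℝ → ℝ} (hχ : IsTest χ) :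
    ∃ Λ : SpinorL2 →L[ℂ] Spinor, ∀ f : SpinorL2,
      Integrable (fun x => χ x • f x) ∧ Λ f = ∫ x, χ x • f x := by
  have hc : Continuous fun x => (χ x : ℂ) := Complex.continuous_ofReal.comp hχ.1.continuous
  have hm : MemLp (fun x => (χ x : ℂ)) 2 volume :=
    hc.memLp_of_hasCompactSupport (hχ.2.comp_left (g := Complex.ofReal) rfl)
  refine ⟨(ContinuousLinearMap.lsmul ℂ ℂ (E := Spinor)).lpPairing volume 2 2 (hm.toLp _),
    fun f => ⟨?_, ?_⟩⟩
  · have := (Lp.memLp f).smul hm (r := 1)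
    refine (memLp_one_iff_integrable.1 this).congr (Eventually.of_forall fun x => ?_)
    exact Complex.coe_smul (χ x) (f x)
  · rw [ContinuousLinearMap.lpPairing_eq_integral]
    refine integral_congr_ae ?_
    filter_upwards [hm.coeFn_toLp] with x hx
    rw [hx, ContinuousLinearMap.lsmul_apply, Complex.coe_smul]

/-- Multiplication by `σ₁`. -/
noncomputable def pauliOp₁ : SpinorL2 →L[ℂ] SpinorL2 := mulOp fun _ => toOp pauli₁

theorem isMul_pauliOp₁ : IsMul pauliOp₁ fun _ => toOp pauli₁ :=
  isMul_mulOp aestronglyMeasurable_const (c := ‖toOp pauli₁‖) (Eventually.of_forall fun _ => le_rfl)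

theorem continuousOn_ft (h : ContinuousOn Φ (Icc 0 T)) :
    ContinuousOn (fun s => ft (Φ s)) (Icc 0 T) := ft.continuous.comp_continuousOn h

theorem _root_.ContinuousOn.intervalIntegrable_sub {E : Type*} [NormedAddCommGroup E] {u : ℝ → E}
    (h : ContinuousOn u (Icc 0 T)) {a b : ℝ} (ha : 0 ≤ a) (hab : a ≤ b) (hb : b ≤ T) :
    IntervalIntegrable u volume a b :=
  (h.mono (by rw [uIcc_of_le hab]; exact Icc_subset_Icc ha hb)).intervalIntegrable

theorem _root_.ContinuousLinearMap.intervalIntegrable_apply {E F : Type*} [NormedAddCommGroup E]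
    [NormedAddCommGroup F] [NormedSpace ℂ E] [NormedSpace ℂ F] (L : E →L[ℂ] F) {u : ℝ → E}
    {a b : ℝ} (h : IntervalIntegrable u volume a b) :
    IntervalIntegrable (fun s => L (u s)) volume a b :=
  ⟨L.integrable_comp h.1, L.integrable_comp h.2⟩

/-- The weak form of the equation, tested by one function, in terms of operators. -/
theorem IsSolution.pairing_eq (h : IsSolution ε T V Φ) (hQ : PotOp T M C V Q) {t : ℝ}
    (ht : t ∈ Icc 0 T) {χ : ℝ → ℝ} (hχ : IsTest χ) :
    ∫ x, deriv χ x • ((Complex.I / (ε : ℂ)) • pauliOp₁ (∫ s in (0 : ℝ)..t, Φ s) : SpinorL2) x =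
      -∫ x, χ x • ((1 / ε ^ 2 : ℂ) • pauliOp₃ (∫ s in (0 : ℝ)..t, Φ s) +
        ift (∫ s in (0 : ℝ)..t, Q s (ft (Φ s))) - Complex.I • (Φ t - Φ 0) : SpinorL2) x := by
  have hχ' : IsTest (deriv χ) := ⟨(contDiff_infty_iff_deriv.1 hχ.1).2, hχ.2.deriv⟩
  obtain ⟨Λ, hΛ⟩ := hχ.exists_pairing
  obtain ⟨Λ', hΛ'⟩ := hχ'.exists_pairing
  have h0 : (0 : ℝ) ∈ Icc 0 T := ⟨le_rfl, ht.1.trans ht.2⟩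
  have hw := h.2 χ hχ t ht
  have hc : ContinuousOn (fun s => Q s (ft (Φ s))) (Icc 0 T) :=
    hQ.continuousOn.clm_apply (continuousOn_ft h.1)
  have i1 := h.1.intervalIntegrable_sub le_rfl ht.1 ht.2
  have i2 := hc.intervalIntegrable_sub le_rfl ht.1 ht.2
  have hsub : Ioc 0 t ⊆ Icc 0 T := fun s hs => ⟨hs.1.le, hs.2.trans ht.2⟩
  let K1 : SpinorL2 →L[ℂ] Spinor := (Complex.I / (ε : ℂ)) • Λ'.comp pauliOp₁ +
    (1 / ε ^ 2 : ℂ) • Λ.comp pauliOp₃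
  let K2 : SpinorL2 →L[ℂ] Spinor := Λ.comp ift
  have h1 : ∀ᵐ s ∂volume.restrict (Ioc 0 t),
      (∫ x, ((Complex.I / (ε : ℂ)) • (deriv χ x • act pauli₁ (Φ s x)) +
          χ x • ((1 / ε ^ 2) • act pauli₃ (Φ s x) + V s x • Φ s x))) =
      K1 (Φ s) + K2 (Q s (ft (Φ s))) := by
    filter_upwards [ae_restrict_of_ae_restrict_of_subset hsub hQ.ae_eq] with s hs
    have e : K1 (Φ s) + K2 (Q s (ft (Φ s))) = (Complex.I / (ε : ℂ)) • Λ' (pauliOp₁ (Φ s)) +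
      ((1 / ε ^ 2 : ℂ) • Λ (pauliOp₃ (Φ s)) + Λ ((ift * Q s * ft) (Φ s))) := by
      simp only [K1, K2, add_apply, smul_apply, add_assoc]
      rfl
    have j1 : Integrable fun x => (Complex.I / (ε : ℂ)) • (deriv χ x • (pauliOp₁ (Φ s)) x) :=
      (hΛ' _).1.smul (Complex.I / (ε : ℂ))
    have j2 : Integrable fun x => (1 / ε ^ 2 : ℂ) • (χ x • (pauliOp₃ (Φ s)) x) :=
      (hΛ _).1.smul (1 / ε ^ 2 : ℂ)
    have j3 : Integrable fun x => χ x • ((ift * Q s * ft) (Φ s)) x := (hΛ _).1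
    have e1 : (∫ x, ((Complex.I / (ε : ℂ)) • (deriv χ x • (pauliOp₁ (Φ s)) x) +
        ((1 / ε ^ 2 : ℂ) • (χ x • (pauliOp₃ (Φ s)) x) + χ x • ((ift * Q s * ft) (Φ s)) x))) =
        K1 (Φ s) + K2 (Q s (ft (Φ s))) := by
      rw [integral_add j1 (show Integrable (fun x => (1 / ε ^ 2 : ℂ) • (χ x • (pauliOp₃ (Φ s)) x) +
        χ x • ((ift * Q s * ft) (Φ s)) x) from j2.add j3), integral_add j2 j3, integral_smul,
        integral_smul, e, (hΛ' _).2, (hΛ _).2, (hΛ _).2]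
    rw [← e1]
    refine integral_congr_ae ?_
    filter_upwards [isMul_pauliOp₁ (Φ s), isMul_pauliOp₃ (Φ s), hs (Φ s)] with x h1 h2 h3
    rw [h1, h2, h3, toOp_apply, toOp_apply, smul_apply, one_apply_eq_self, smul_add,
      Complex.coe_smul, ← Complex.coe_smul (1 / ε ^ 2), smul_comm (χ x)]
    push_cast
    rfl
  have h2 : (∫ s in (0 : ℝ)..t, ∫ x, ((Complex.I / (ε : ℂ)) • (deriv χ x • act pauli₁ (Φ s x)) +
          χ x • ((1 / ε ^ 2) • act pauli₃ (Φ s x) + V s x • Φ s x))) =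
      K1 (∫ s in (0 : ℝ)..t, Φ s) + K2 (∫ s in (0 : ℝ)..t, Q s (ft (Φ s))) := by
    rw [← K1.intervalIntegral_comp_comm i1, ← K2.intervalIntegral_comp_comm i2,
      ← intervalIntegral.integral_add (K1.intervalIntegrable_apply i1)
        (K2.intervalIntegrable_apply i2), intervalIntegral.integral_of_le ht.1,
      intervalIntegral.integral_of_le ht.1]
    exact integral_congr_ae h1
  rw [h2, ← (hΛ _).2, ← (hΛ _).2] at hw
  rw [← (hΛ _).2, ← (hΛ' _).2, map_sub, map_add, map_smul, map_smul, map_smul, map_sub, hw]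
  simp only [K1, K2, add_apply, smul_apply, ContinuousLinearMap.comp_apply]
  abel

/-- The equation on the Fourier side, integrated in time. -/
theorem IsSolution.ft_ae (hε : 0 < ε) (h : IsSolution ε T V Φ) (hQ : PotOp T M C V Q) {t : ℝ}
    (ht : t ∈ Icc 0 T) : ∀ᵐ ξ, Complex.I • ((ft (Φ t)) ξ - (ft (Φ 0)) ξ) =
      (freq ε ξ : ℂ) • toOp (unitSymbol ε ξ) ((∫ s in (0 : ℝ)..t, ft (Φ s)) ξ) +
        (∫ s in (0 : ℝ)..t, Q s (ft (Φ s))) ξ := by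
  have hJ : ft (∫ s in (0 : ℝ)..t, Φ s) = ∫ s in (0 : ℝ)..t, ft (Φ s) :=
    (ft.intervalIntegral_comp_comm (h.1.intervalIntegrable_sub le_rfl ht.1 ht.2)).symm
  have h1 := ft_of_weakDeriv fun χ hχ => h.pairing_eq hQ ht hχ
  rw [map_sub, map_add, map_smul, map_smul, map_smul, map_sub, ft_comm_const isMul_pauliOp₁,
    ft_comm_const isMul_pauliOp₃, ft_ift, hJ] at h1
  set J := ∫ s in (0 : ℝ)..t, ft (Φ s)
  set G := ∫ s in (0 : ℝ)..t, Q s (ft (Φ s))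
  have hε' : (ε : ℂ) ≠ 0 := by exact_mod_cast hε.ne'
  filter_upwards [h1, isMul_pauliOp₁ J, isMul_pauliOp₃ J,
    Lp.coeFn_sub ((1 / ε ^ 2 : ℂ) • pauliOp₃ J + G) (Complex.I • (ft (Φ t) - ft (Φ 0))),
    Lp.coeFn_add ((1 / ε ^ 2 : ℂ) • pauliOp₃ J) G, Lp.coeFn_smul (1 / ε ^ 2 : ℂ) (pauliOp₃ J),
    Lp.coeFn_smul Complex.I (ft (Φ t) - ft (Φ 0)), Lp.coeFn_sub (ft (Φ t)) (ft (Φ 0)),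
    Lp.coeFn_smul (Complex.I / (ε : ℂ)) (pauliOp₁ J)] with ξ e1 e2 e3 e4 e5 e6 e7 e8 e9
  rw [e4, Pi.sub_apply, e5, Pi.add_apply, e6, e7, e9, Pi.smul_apply, Pi.smul_apply, Pi.smul_apply,
    e8, Pi.sub_apply, e2, e3] at e1
  have h2 : (freq ε ξ : ℂ) • toOp (unitSymbol ε ξ) (J ξ) =
      (1 / ε ^ 2 : ℂ) • toOp pauli₃ (J ξ) -
        ((2 * Real.pi * ξ : ℝ) * Complex.I : ℂ) • (Complex.I / (ε : ℂ)) • toOp pauli₁ (J ξ) := by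
    have h3 : toOp (symbol ε ξ) (J ξ) =
        ((2 * Real.pi * ε * ξ : ℝ) : ℂ) • toOp pauli₁ (J ξ) + toOp pauli₃ (J ξ) := by
      rw [symbol, toOp, map_add, map_smul]
      rfl
    have h4 : toOp (symbol ε ξ) (J ξ) = (lam ε ξ : ℂ) • toOp (unitSymbol ε ξ) (J ξ) := by
      rw [← lam_smul_unitSymbol, toOp, map_smul]
      rfl
    have h5 : ((freq ε ξ : ℝ) : ℂ) = (1 / ε ^ 2 : ℂ) * (lam ε ξ : ℂ) := by
      rw [freq]
      push_cast
      ring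
    rw [h5, ← smul_smul, ← h4, h3, smul_add, smul_smul, smul_smul, add_comm, sub_eq_add_neg,
      ← neg_smul]
    congr 2
    push_cast
    field_simp
    linear_combination (ξ : ℂ) * Complex.I_sq
  rw [h2, ← e1]
  abel

theorem cut_mul_cut (R : ℕ) : cut 0 R * cut 0 R = cut 0 R := by
  refine ((isMul_cut 0 R).mul (isMul_cut 0 R)).eq ((isMul_cut 0 R).congr ?_)
  refine Eventually.of_forall fun ξ => ?_
  ext1 v
  simp only [cutSymbol, indicator, pow_zero, mul_apply_eq_comp, smul_apply, one_apply_eq_self]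
  split_ifs <;> simp

/-- The generator of the free evolution, cut off at high frequencies. -/
noncomputable def cutGen (ε : ℝ) (R : ℕ) : SpinorL2 →L[ℂ] SpinorL2 :=
  mulOp fun ξ => ((cutSymbol 0 R ξ * freq ε ξ : ℝ) : ℂ) • toOp (unitSymbol ε ξ)

theorem abs_cutSymbol_mul_freq_le (hε : 0 < ε) (hε1 : ε ≤ 1) (R : ℕ) (ξ : ℝ) :
    |cutSymbol 0 R ξ * freq ε ξ| ≤ 5 / ε ^ 2 * wt (R + 1) := by
  have h0 : 0 ≤ 5 / ε ^ 2 := by positivity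
  unfold cutSymbol
  by_cases h : ξ ∈ Icc (-(R + 1 : ℝ)) (R + 1)
  · rw [indicator_of_mem h, pow_zero, one_mul]
    refine (abs_freq_le' hε hε1 ξ).trans (mul_le_mul_of_nonneg_left ?_ h0)
    rw [pow_one, wt, wt]
    nlinarith [h.1, h.2]
  · rw [indicator_of_notMem h, zero_mul, abs_zero]
    exact mul_nonneg h0 (wt_pos _).le

theorem isMul_cutGen (hε : 0 < ε) (hε1 : ε ≤ 1) (R : ℕ) : IsMul (cutGen ε R)
    fun ξ => ((cutSymbol 0 R ξ * freq ε ξ : ℝ) : ℂ) • toOp (unitSymbol ε ξ) := by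
  refine isMul_mulOp (c := 5 / ε ^ 2 * wt (R + 1)) ?_ (Eventually.of_forall fun ξ => ?_)
  · exact (Complex.measurable_ofReal.comp ((measurable_cutSymbol 0 R).mul
      (continuous_freq ε).measurable)).aestronglyMeasurable.smul
      (continuous_unitSymbol ε).aestronglyMeasurable
  · refine ContinuousLinearMap.opNorm_le_bound _ (mul_nonneg (by positivity) (wt_pos _).le)
      fun v => ?_
    rw [smul_apply, norm_smul, norm_unitSymbol, Complex.norm_real]
    exact mul_le_mul_of_nonneg_right (abs_cutSymbol_mul_freq_le hε hε1 R ξ) (norm_nonneg v)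

theorem IsMul.commute_of_forall {A B : SpinorL2 →L[ℂ] SpinorL2} {m n : ℝ → Spinor →L[ℂ] Spinor}
    (hA : IsMul A m) (hB : IsMul B n) (h : ∀ ξ, Commute (m ξ) (n ξ)) : Commute A B :=
  (hA.mul hB).eq ((hB.mul hA).congr (Eventually.of_forall fun ξ => (h ξ).eq.symm))

theorem IsMul.commute_cut {A : SpinorL2 →L[ℂ] SpinorL2} {m : ℝ → Spinor →L[ℂ] Spinor}
    (hA : IsMul A m) (R : ℕ) : Commute A (cut 0 R) :=
  hA.commute_of_forall (isMul_cut 0 R) fun ξ => (Commute.one_right (m ξ)).smul_right _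

/-- The free evolution of the low frequencies is differentiable in the operator norm. -/
theorem hasDerivAt_free_mul_cut (hε : 0 < ε) (hε1 : ε ≤ 1) (R : ℕ) (s : ℝ) :
    HasDerivAt (fun s => free ε (-s) * cut 0 R) (Complex.I • (free ε (-s) * cutGen ε R)) s := by
  set c := 5 / ε ^ 2 * wt (R + 1) with hc
  have hφ := continuous_freq ε
  have key : ∀ h : ℝ, ‖free ε (-(s + h)) * cut 0 R - free ε (-s) * cut 0 R -
      h • (Complex.I • (free ε (-s) * cutGen ε R))‖ ≤ 3 * c ^ 2 * ‖h ^ 2‖ := fun h => by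
    have e : free ε (-(s + h)) * cut 0 R - free ε (-s) * cut 0 R -
        h • (Complex.I • (free ε (-s) * cutGen ε R)) =
        free ε (-s) * (free ε (-h) * cut 0 R - 1 * cut 0 R - ((h : ℂ) * Complex.I) •
          cutGen ε R) := by
      have e0 : free ε (-s + -h) = free ε (-s) * free ε (-h) := flow_add hφ _ _
      have e1 : ∀ X : SpinorL2 →L[ℂ] SpinorL2, h • X = (h : ℂ) • X := fun X => by
        ext1 f
        exact (Complex.coe_smul h (X f)).symm
      rw [neg_add, e0, mul_sub, mul_sub, one_mul, mul_smul_comm, e1, smul_smul, mul_assoc]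
    rw [e]
    refine ContinuousLinearMap.opNorm_le_bound _ (by positivity) fun f => ?_
    rw [mul_apply_eq_comp, norm_flow hφ]
    refine ((((isMul_flow hφ (-h)).mul (isMul_cut 0 R)).sub (IsMul.one.mul (isMul_cut 0 R))).sub
      ((isMul_cutGen hε hε1 R).smul _)).norm_apply_le ?_ f
    refine Eventually.of_forall fun ξ v => ?_
    by_cases hξ : ξ ∈ Icc (-(R + 1 : ℝ)) (R + 1)
    · have h1 : cutSymbol 0 R ξ = 1 := by rw [cutSymbol, indicator_of_mem hξ, pow_zero]
      have h2 := norm_rot_sub_sub_le ε (-h * freq ε ξ) ξ v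
      have h3 := abs_cutSymbol_mul_freq_le hε hε1 R ξ
      rw [h1, one_mul] at h3
      have h4 : freq ε ξ ^ 2 ≤ c ^ 2 := sq_le_sq' (abs_le.1 h3).1 (abs_le.1 h3).2
      rw [h1, Complex.ofReal_one, one_smul, mul_one, mul_one, one_mul]
      refine le_trans (le_of_eq ?_) (h2.trans (mul_le_mul_of_nonneg_right ?_ (norm_nonneg v)))
      · congr 1
        simp only [sub_apply, add_apply, smul_apply]
        rw [smul_smul, sub_eq_add_neg (_ - _), ← neg_smul]
        congr 2
        push_cast
        ring
      · rw [norm_pow, Real.norm_eq_abs, sq_abs]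
        nlinarith [sq_nonneg h]
    · have h1 : cutSymbol 0 R ξ = 0 := by rw [cutSymbol, indicator_of_notMem hξ]
      simp only [h1, sub_apply, mul_apply_eq_comp, smul_apply, Complex.ofReal_zero, zero_mul,
        zero_smul, map_zero, smul_zero, sub_zero, norm_zero]
      exact mul_nonneg (by positivity) (norm_nonneg v)
  rw [hasDerivAt_iff_isLittleO_nhds_zero]
  refine (Asymptotics.IsBigO.of_bound _ (Eventually.of_forall key)).trans_isLittleO ?_
  simpa using Asymptotics.isLittleO_pow_id (𝕜 := ℝ) one_lt_two

/-- The Duhamel formula in the interaction picture. -/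
theorem IsSolution.interaction (hε : 0 < ε) (hε1 : ε ≤ 1) (h : IsSolution ε T V Φ)
    (hQ : PotOp T M C V Q) {a b : ℝ} (ha : a ∈ Icc 0 T) (hb : b ∈ Icc 0 T) (hab : a ≤ b) :
    free ε (-b) (ft (Φ b)) = free ε (-a) (ft (Φ a)) -
      Complex.I • ∫ r in a..b, conj (free ε) r (Q r) (free ε (-r) (ft (Φ r))) := by
  have hφ := continuous_freq ε
  have hφ' : ∃ c p, ∀ ξ, |freq ε ξ| ≤ c * wt ξ ^ p := ⟨_, _, abs_freq_le' hε hε1⟩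
  have hft := continuousOn_ft h.1
  have hQf : ContinuousOn (fun s => Q s (ft (Φ s))) (Icc 0 T) := hQ.continuousOn.clm_apply hft
  have hψ : ContinuousOn (fun s => free ε (-s) (ft (Φ s))) (Icc 0 T) :=
    continuous_flow_apply hφ hφ' continuousOn_neg hft
  have hk : ContinuousOn (fun s => free ε (-s) (Q s (ft (Φ s)))) (Icc 0 T) :=
    continuous_flow_apply hφ hφ' continuousOn_neg hQf
  have hconj : ∀ r, conj (free ε) r (Q r) (free ε (-r) (ft (Φ r))) =
      free ε (-r) (Q r (ft (Φ r))) := fun r => by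
    have : free ε r (free ε (-r) (ft (Φ r))) = ft (Φ r) := by
      rw [← mul_apply_eq_comp, flow_mul_flow_neg hφ, one_apply_eq_self]
    simp only [conj, mul_apply_eq_comp, this]
  simp only [hconj]
  have hint := hk.intervalIntegrable_sub ha.1 hab hb.2
  -- Below a frequency cut-off the generator is bounded, so the equation can be differentiated in
  -- time in `L²`, which `IsSolution` alone does not provide. The cut-off is removed by `R → ∞`.
  suffices h1 : ∀ R, cut 0 R (free ε (-b) (ft (Φ b))) = cut 0 R (free ε (-a) (ft (Φ a)) -
      Complex.I • ∫ r in a..b, free ε (-r) (Q r (ft (Φ r)))) by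
    refine tendsto_nhds_unique (Sob.tendsto_cut_zero _) ?_
    simp only [h1]
    exact Sob.tendsto_cut_zero _
  intro R
  set P := cut 0 R with hP
  set B := cutGen ε R with hB
  have hB' := isMul_cutGen hε hε1 R
  have hPB : P * B = B * P := (hB'.commute_cut R).eq.symm
  have hPB' : ∀ f, P (B f) = B (P f) := fun f => by
    rw [← mul_apply_eq_comp, hPB, mul_apply_eq_comp]
  have hPP : ∀ f, P (P f) = P f := fun f => by rw [← mul_apply_eq_comp, hP, cut_mul_cut]
  have hPF : ∀ s f, P (free ε s f) = free ε s (P f) := fun s f => by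
    rw [← mul_apply_eq_comp, ← mul_apply_eq_comp, ((isMul_flow hφ s).commute_cut R).eq]
  set k : ℝ → SpinorL2 := fun s => B (ft (Φ s)) + P (Q s (ft (Φ s))) with hkdef
  have hkc : ContinuousOn k (Icc 0 T) :=
    (B.continuous.comp_continuousOn hft).add (P.continuous.comp_continuousOn hQf)
  have hp : ∀ t ∈ Icc 0 T, P (ft (Φ t)) = P (ft (Φ 0)) - Complex.I • ∫ s in (0 : ℝ)..t, k s := by
    intro t ht
    have i1 := hft.intervalIntegrable_sub le_rfl ht.1 ht.2
    have i2 := hQf.intervalIntegrable_sub le_rfl ht.1 ht.2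
    have e1 : ∫ s in (0 : ℝ)..t, k s = B (∫ s in (0 : ℝ)..t, ft (Φ s)) +
        P (∫ s in (0 : ℝ)..t, Q s (ft (Φ s))) := by
      rw [← B.intervalIntegral_comp_comm i1, ← P.intervalIntegral_comp_comm i2,
        ← intervalIntegral.integral_add (B.intervalIntegrable_apply i1)
          (P.intervalIntegrable_apply i2)]
    have e2 : Complex.I • (P (ft (Φ t)) - P (ft (Φ 0))) = ∫ s in (0 : ℝ)..t, k s := by
      rw [e1, ← map_sub, ← map_smul]
      set J := ∫ s in (0 : ℝ)..t, ft (Φ s)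
      set G := ∫ s in (0 : ℝ)..t, Q s (ft (Φ s))
      refine Lp.ext ?_
      filter_upwards [h.ft_ae hε hQ ht, isMul_cut 0 R (Complex.I • (ft (Φ t) - ft (Φ 0))),
        hB' J, isMul_cut 0 R G, Lp.coeFn_add (B J) (P G),
        Lp.coeFn_smul Complex.I (ft (Φ t) - ft (Φ 0)), Lp.coeFn_sub (ft (Φ t)) (ft (Φ 0))]
        with ξ h1 h2 h3 h4 h5 h6 h7
      rw [h2, h5, Pi.add_apply, h3, h4, h6, Pi.smul_apply, h7, Pi.sub_apply, h1]
      simp only [smul_apply, one_apply_eq_self, smul_add, smul_smul, Complex.ofReal_mul, J, G]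
    rw [← e2, smul_smul, Complex.I_mul_I, neg_smul, one_smul]
    abel
  have hpd : ∀ t ∈ Ioo 0 T, HasDerivAt (fun t => P (ft (Φ t))) (-(Complex.I • k t)) t := by
    intro t ht
    have h1 : HasDerivAt (fun t => ∫ s in (0 : ℝ)..t, k s) (k t) t := by
      refine intervalIntegral.integral_hasDerivAt_right
        (hkc.intervalIntegrable_sub le_rfl ht.1.le ht.2.le)
        ((hkc.mono Ioo_subset_Icc_self).stronglyMeasurableAtFilter isOpen_Ioo t ht)
        (hkc.continuousAt (Icc_mem_nhds ht.1 ht.2))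
    have h2 := (h1.const_smul Complex.I).const_sub (P (ft (Φ 0)))
    refine h2.congr_of_eventuallyEq ?_
    filter_upwards [Icc_mem_nhds ht.1 ht.2] with s hs using hp s hs
  -- In the product rule the generator terms from the group and from the solution cancel, leaving
  -- the potential. Since `P² = P`, each factor can be given its own truncation.
  have hw : ∀ t ∈ Ioo 0 T, HasDerivAt (fun t => P (free ε (-t) (ft (Φ t))))
      (-(Complex.I • P (free ε (-t) (Q t (ft (Φ t)))))) t := by
    intro t ht
    have h1 := ((isBoundedBilinearMap_apply (𝕜 := ℂ) (E := SpinorL2) (F := SpinorL2)).hasFDerivAt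
      (free ε (-t) * P, P (ft (Φ t)))).restrictScalars ℝ
    have h2 := h1.comp_hasDerivAt t ((hasDerivAt_free_mul_cut hε hε1 R t).prodMk (hpd t ht))
    have h3 : (fun t => P (free ε (-t) (ft (Φ t)))) =
        (fun p : (SpinorL2 →L[ℂ] SpinorL2) × SpinorL2 => p.1 p.2) ∘
          fun t => (free ε (-t) * P, P (ft (Φ t))) := by
      funext s
      simp only [Function.comp, mul_apply_eq_comp, hPP, hPF]
    rw [h3]
    refine h2.congr_deriv ?_
    simp only [ContinuousLinearMap.coe_restrictScalars', IsBoundedBilinearMap.deriv_apply,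
      hkdef, mul_apply_eq_comp, map_neg, map_smul, map_add, hPP, hPF, hPB', smul_apply]
    rw [smul_add]
    abel
  have hcont : ContinuousOn (fun t => P (free ε (-t) (ft (Φ t)))) (Icc a b) :=
    (P.continuous.comp_continuousOn hψ).mono (Icc_subset_Icc ha.1 hb.2)
  have hPk : IntervalIntegrable (fun t => P (free ε (-t) (Q t (ft (Φ t))))) volume a b :=
    P.intervalIntegrable_apply hint
  have hftc := intervalIntegral.integral_eq_sub_of_hasDerivAt_of_le hab hcont
    (fun t ht => hw t ⟨ha.1.trans_lt ht.1, ht.2.trans_le hb.2⟩) ((hPk.smul Complex.I).neg)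
  rw [intervalIntegral.integral_neg, intervalIntegral.integral_smul,
    P.intervalIntegral_comp_comm hint] at hftc
  rw [map_sub, map_smul, eq_comm, sub_eq_add_neg, hftc]
  abel

end solution


/-! ### Regularity of the solution, uniformly in `ε` -/

section regularity

variable {ε T M C N : ℝ} {V : ℝ → ℝ → ℝ} {Q : ℝ → SpinorL2 →L[ℂ] SpinorL2} {Φ : ℝ → SpinorL2}

/-- The bound is closed and the solution continuous, so it holds at every time. As `B` may depend on
`ε` through `Φ`, it serves only as an a priori bound. -/
theorem AssumptionB.exists_sob (h : AssumptionB T 2 0 Φ) (hT : 0 < T)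
    (hc : ContinuousOn Φ (Icc 0 T)) : ∃ B, ∀ t ∈ Icc 0 T, Sob 2 B (ft (Φ t)) := by
  obtain ⟨B, hB⟩ := h
  refine ⟨B, forall_mem_Icc_of_ae hT (continuousOn_ft hc) (Sob.isClosed 2 B) ?_⟩
  filter_upwards [hB] with t ⟨g, hg, hgB⟩
  exact sob_of_besselPotential hg hgB

theorem integral_const_mul_exp (c t : ℝ) :
    ∫ r in (0 : ℝ)..t, c * Real.exp (2 * c * r) = (Real.exp (2 * c * t) - 1) / 2 := by
  have h : ∀ r ∈ uIcc 0 t, HasDerivAt (fun r => Real.exp (2 * c * r) / 2)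
      (c * Real.exp (2 * c * r)) r := fun r _ => by
    have h1 := (((hasDerivAt_id r).const_mul (2 * c)).exp).div_const 2
    refine h1.congr_deriv ?_
    simp only [id]
    ring
  rw [intervalIntegral.integral_eq_sub_of_hasDerivAt h
    (Continuous.intervalIntegrable (by fun_prop) _ _)]
  simp only [mul_zero, Real.exp_zero]
  ring

/-- The regularity of the solution is controlled by that of its initial value. -/
theorem IsSolution.sob_interaction (hε : 0 < ε) (hε1 : ε ≤ 1) (hT : 0 < T) (hC : 0 ≤ C)
    (h : IsSolution ε T V Φ) (hQ : PotOp T M C V Q) (hB : AssumptionB T 2 0 Φ)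
    (hN : Sob 2 N (ft (Φ 0))) {t : ℝ} (ht : t ∈ Icc 0 T) :
    Sob 2 (2 * N * Real.exp (2 * C * T)) (free ε (-t) (ft (Φ t))) := by
  have hφ := continuous_freq ε
  obtain ⟨B, hB⟩ := hB.exists_sob hT h.1
  have h0 : (0 : ℝ) ∈ Icc 0 T := ⟨le_rfl, hT.le⟩
  have hB0 := (hB 0 h0).nonneg
  have hN0 := hN.nonneg
  have hψ : ContinuousOn (fun s => free ε (-s) (ft (Φ s))) (Icc 0 T) :=
    continuous_flow_apply hφ ⟨_, _, abs_freq_le' hε hε1⟩ continuousOn_neg (continuousOn_ft h.1)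
  have hcj : ContinuousOn (fun r => conj (free ε) r (Q r) (free ε (-r) (ft (Φ r)))) (Icc 0 T) :=
    continuousOn_conj_free hε hε1 continuousOn_id hQ.continuousOn hψ
  -- Gronwall without continuity in the weighted norm: because of the factor `e^{2Ct}`, each use of
  -- the Duhamel formula halves the contribution of the a priori bound `B`, while that of the
  -- initial value stays at `2N`. Only the latter survives as `k → ∞`.
  have key : ∀ k : ℕ, ∀ t ∈ Icc 0 T, Sob 2 ((2 * N + B * (1 / 2) ^ k) * Real.exp (2 * C * t))
      (free ε (-t) (ft (Φ t))) := fun k => by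
    induction k with
    | zero =>
      intro t ht
      refine ((hB t ht).flow hφ (-t)).mono ?_
      have : 1 ≤ Real.exp (2 * C * t) := Real.one_le_exp (mul_nonneg (by positivity) ht.1)
      rw [pow_zero, mul_one]
      nlinarith
    | succ k ih =>
      intro t ht
      have h1 := h.interaction hε hε1 hQ h0 ht ht.1
      rw [h1]
      set D := 2 * N + B * (1 / 2) ^ k with hD
      have h2 : ∀ r ∈ Ioc 0 t, Sob 2 (D * (C * Real.exp (2 * C * r)))
          (conj (free ε) r (Q r) (free ε (-r) (ft (Φ r)))) := fun r hr => by
        have hr' : r ∈ Icc 0 T := ⟨hr.1.le, hr.2.trans ht.2⟩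
        refine ((hQ.sobBdd r hr' 2 le_rfl _ _ ((ih r hr').flow hφ r)).flow hφ (-r)).mono
          (le_of_eq ?_)
        ring
      have h3 := Sob.intervalIntegral ht.1 (hcj.intervalIntegrable_sub le_rfl ht.1 ht.2)
        (Continuous.intervalIntegrable (by fun_prop) _ _) h2
      rw [intervalIntegral.integral_const_mul, integral_const_mul_exp] at h3
      refine ((hN.flow hφ (-0)).sub (h3.smul Complex.I)).mono ?_
      have h4 : 1 ≤ Real.exp (2 * C * t) := Real.one_le_exp (mul_nonneg (by positivity) ht.1)
      have h5 : 0 ≤ B * (1 / 2) ^ k := by positivity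
      rw [Complex.norm_I, pow_succ, hD]
      nlinarith
  have hlim : ∀ R, ‖cut 2 R (free ε (-t) (ft (Φ t)))‖ ≤ 2 * N * Real.exp (2 * C * t) := fun R => by
    have h1 : Tendsto (fun k : ℕ => (2 * N + B * (1 / 2) ^ k) * Real.exp (2 * C * t)) atTop
        (𝓝 ((2 * N + B * 0) * Real.exp (2 * C * t))) :=
      (((tendsto_pow_atTop_nhds_zero_of_lt_one (by norm_num) (by norm_num)).const_mul B).const_add
        (2 * N)).mul_const _
    rw [mul_zero, add_zero] at h1
    exact ge_of_tendsto h1 (Eventually.of_forall fun k => key k t ht R)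
  refine Sob.mono hlim (mul_le_mul_of_nonneg_left (Real.exp_le_exp.2 ?_) (by positivity))
  exact mul_le_mul_of_nonneg_left ht.2 (by positivity)

end regularity

/-! ### The two error bounds for the splitting -/

section splitting

variable {ε T M C N τ : ℝ} {V : ℝ → ℝ → ℝ} {Q : ℝ → SpinorL2 →L[ℂ] SpinorL2} {Φ : ℝ → SpinorL2}

/-- The factor `ε²` reconciles the time scale of `𝒯` with that of `𝒯/ε²`, so the half steps
`τ/(2ε²)` become `τ/2`. -/
theorem ft_freeFlow (hε : 0 < ε) (s : ℝ) (f : SpinorL2) :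
    ft (freeFlow ε s f) = free ε (s * ε ^ 2) (ft f) := by
  have h1 : ft (freeFlow ε s f) = (memLp_flowSymbol ε s (𝓕 f)).toLp _ := ft_ift _
  rw [h1]
  refine Lp.ext ?_
  filter_upwards [(memLp_flowSymbol ε s (𝓕 f)).coeFn_toLp,
    isMul_flow (continuous_freq ε) (s * ε ^ 2) (ft f)] with ξ h2 h3
  rw [h2, h3, ← toOp_apply, toOp_flowSymbol, ft_apply, freq]
  congr 2
  field_simp

/-- The numerical solution in the interaction picture. -/
theorem ft_strang_succ (hε : 0 < ε) (hV : Measurable (Function.uncurry V)) (τ : ℝ) (Φ₀ : SpinorL2)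
    (n : ℕ) : free ε (-(((n + 1 : ℕ) : ℝ) * τ)) (ft (strang hV ε τ Φ₀ (n + 1))) =
      conj (free ε) (n * τ + τ / 2) (potFlow V (n * τ) ((n + 1) * τ))
        (free ε (-(n * τ)) (ft (strang hV ε τ Φ₀ n))) := by
  have hφ := continuous_freq ε
  have h1 : τ / (2 * ε ^ 2) * ε ^ 2 = τ / 2 := by field_simp
  rw [strang, ft_freeFlow hε, ft_potentialFlow, ft_freeFlow hε, h1]
  have h2 : ∀ s t f, free ε s (free ε t f) = free ε (s + t) f := fun s t f => by
    rw [← mul_apply_eq_comp, ← flow_add hφ]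
  change _ = free ε (-(n * τ + τ / 2)) (potFlow V (n * τ) ((n + 1) * τ)
    (free ε (n * τ + τ / 2) _))
  rw [h2, h2]
  congr 3
  · push_cast
    ring_nf
  · ring_nf

/-- `diagPart` as a bounded operator. -/
noncomputable def diagPartL (ε : ℝ) :
    (SpinorL2 →L[ℂ] SpinorL2) →L[ℂ] (SpinorL2 →L[ℂ] SpinorL2) :=
  (1 / 2 : ℂ) • (ContinuousLinearMap.id ℂ _ +
    ContinuousLinearMap.mulLeftRight ℂ (SpinorL2 →L[ℂ] SpinorL2) (unitOp ε) (unitOp ε))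

theorem diagPartL_apply (ε : ℝ) (W : SpinorL2 →L[ℂ] SpinorL2) : diagPartL ε W = diagPart ε W := rfl

theorem conj_free_eq_add (r : ℝ) (W : SpinorL2 →L[ℂ] SpinorL2) (f : SpinorL2) :
    conj (free ε) r W f =
      conj (free ε) r (diagPart ε W) f + conj (free ε) r (offPart ε W) f := by
  rw [← add_apply, ← conj_add_left, diagPart_add_offPart]

/-- The error of the splitting, in terms of a decomposition of the potential. -/
theorem IsSolution.norm_sub_strang_le (hε : 0 < ε) (hε1 : ε ≤ 1) (hT : 0 < T) (hτ : 0 < τ)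
    (hV : Measurable (Function.uncurry V)) (h : IsSolution ε T V Φ) (hb : PotBound T M V)
    (hQ : PotOp T M C V Q) (hC : 0 ≤ C)
    (hN : ∀ t ∈ Icc 0 T, Sob 2 N (free ε (-t) (ft (Φ t)))) {L K η : ℝ}
    {Γ : (SpinorL2 →L[ℂ] SpinorL2) →L[ℂ] (SpinorL2 →L[ℂ] SpinorL2)} (hΓ : ∀ W, ‖Γ W‖ ≤ ‖W‖)
    (hL : ∀ s ∈ Icc 0 T, ∀ r h, |h| ≤ τ → ∀ χ, Sob 2 ((1 + C) * N) χ →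
      ‖conj (free ε) (r + h) (Q s) χ - conj (free ε) r (Q s) χ‖ ≤ L)
    (hη : ∀ s ∈ Icc 0 T, ∀ χ, Sob 2 N χ → ∀ r, ‖conj (free ε) r (Q s - Γ (Q s)) χ‖ ≤ η)
    (hK : ∀ s ∈ Icc 0 T, ∀ χ, Sob 2 N χ → ∀ r h, ‖conj (free ε) (r + h) (Γ (Q s)) χ +
      conj (free ε) (r - h) (Γ (Q s)) χ - (2 : ℂ) • conj (free ε) r (Γ (Q s)) χ‖ ≤ K * h ^ 2)
    {n : ℕ} (hn : n * τ ≤ T) :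
    ‖Φ (n * τ) - strang hV ε τ (Φ 0) n‖ ≤
      2 * M * N * τ ^ 2 + T * ((2 * M ^ 3 + 5 * M ^ 2 + M) * N * τ ^ 2 +
      (M + 1) * τ * L + 2 * η + K * τ ^ 2 / 2) := by
  have hφ := continuous_freq ε
  have hN0 : 0 ≤ N := (hN 0 ⟨le_rfl, hT.le⟩).nonneg
  have hψ : ContinuousOn (fun s => free ε (-s) (ft (Φ s))) (Icc 0 T) :=
    continuous_flow_apply hφ ⟨_, _, abs_freq_le' hε hε1⟩ continuousOn_neg (continuousOn_ft h.1)
  have hstep : ∀ n : ℕ, (n + 1) * τ ≤ T → 0 ≤ n * τ ∧ n * τ ≤ (n + 1) * τ ∧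
      ((n : ℝ) + 1) * τ - n * τ = τ := fun n _ =>
    ⟨by positivity, by nlinarith, by ring⟩
  have hmain := norm_interaction_error_le (Γ := Γ) (Vop := Q) (T := T) (M := M) (N := N)
    (L := L) (K := K) (η := η)
    (ψ := fun n : ℕ => free ε (-(n * τ)) (ft (Φ (n * τ))))
    (num := fun n : ℕ => free ε (-(n * τ)) (ft (strang hV ε τ (Φ 0) n)))
    (Ψ := fun s => free ε (-s) (ft (Φ s)))
    (P := fun n : ℕ => potFlow V (n * τ) ((n + 1) * τ)) hε hε1 hτ hQ.continuousOn hQ.norm_le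
    hQ.lip hQ.second hψ (fun s hs => (hN s hs).norm_le')
    (fun a ha b hb hab => h.interaction hε hε1 hQ ha hb hab) hΓ ?_
    (fun a ha s hs r => hη s hs _ (hN a ha) r) (fun a ha s hs r h => hK s hs _ (hN a ha) r h)
    (fun n _ f => norm_potFlow_apply_le hV _ _ f) ?_ ?_ (fun _ => rfl) ?_
    (fun n => ft_strang_succ hε hV τ (Φ 0) n) n hn
  · have e : ‖Φ (n * τ) - strang hV ε τ (Φ 0) n‖ = ‖free ε (-(n * τ)) (ft (Φ (n * τ))) -
        free ε (-(n * τ)) (ft (strang hV ε τ (Φ 0) n))‖ := by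
      rw [← map_sub, norm_flow hφ, ← map_sub, norm_ft]
    rw [e]
    exact hmain
  · intro a ha s hs m hm hsm χ hχ
    -- The factor `1 + C` covers both the solution and its image under a conjugate of the potential.
    have hχ' : Sob 2 ((1 + C) * N) χ := by
      rcases hχ with rfl | rfl
      · exact (hN a ha).mono (by nlinarith)
      · exact ((hQ.sobBdd m hm 2 le_rfl _ _ ((hN a ha).flow hφ m)).flow hφ (-m)).mono
          (by nlinarith)
    have := hL s hs m (s - m) hsm χ hχ'
    rwa [add_sub_cancel] at this
  · intro n hn
    obtain ⟨h1, h2, h3⟩ := hstep n hn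
    have := hb.norm_potFlow_sub_one_le h1 h2 hn
    rwa [h3] at this
  · intro n hn
    obtain ⟨h1, h2, h3⟩ := hstep n hn
    have := hQ.norm_potFlow_sub_le hb h1 h2 hn
    rw [h3] at this
    rwa [show (n : ℝ) * τ + τ = (n + 1) * τ by ring]
  · simp [strang]

/-- Only the diagonal part is treated by quadrature, with constants uniform in `ε`. The off-diagonal
part, of size `ε`, is put into `η`. -/
theorem IsSolution.norm_sub_strang_le_add (hε : 0 < ε) (hε1 : ε ≤ 1) (hT : 0 < T) (hτ : 0 < τ)
    (hV : Measurable (Function.uncurry V)) (h : IsSolution ε T V Φ) (hb : PotBound T M V)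
    (hQ : PotOp T M C V Q) (hC : 0 ≤ C)
    (hN : ∀ t ∈ Icc 0 T, Sob 2 N (free ε (-t) (ft (Φ t)))) {n : ℕ} (hn : n * τ ≤ T) :
    ‖Φ (n * τ) - strang hV ε τ (Φ 0) n‖ ≤
      2 * M * N * τ ^ 2 + T * ((2 * M ^ 3 + 5 * M ^ 2 + M) * N * τ ^ 2 +
      (M + 1) * τ * ((80 * τ + 16 * ε) * (C * ((1 + C) * N))) + 2 * (8 * ε * C * N) +
      4000 * C * N * τ ^ 2 / 2) := by
  have hN0 : 0 ≤ N := (hN 0 ⟨le_rfl, hT.le⟩).nonneg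
  refine h.norm_sub_strang_le hε hε1 hT hτ hV hb hQ hC hN (Γ := diagPartL ε)
    (fun W => norm_diagPart_le ε W) ?_ ?_ ?_ hn
  · intro s hs r h hh χ hχ
    have h1 := norm_conj_diagPart_sub_le hε (hQ.sobBdd s hs) hχ r h
    have h2 := norm_conj_offPart_le hε (hQ.sobBdd s hs) (hQ.commute s hs) hχ
    rw [conj_free_eq_add (r + h), conj_free_eq_add r, add_sub_add_comm]
    refine (norm_add_le _ _).trans ((add_le_add h1 ((norm_sub_le _ _).trans
      (add_le_add (h2 _) (h2 _)))).trans ?_)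
    have h3 : 0 ≤ C * ((1 + C) * N) := by positivity
    nlinarith
  · intro s hs χ hχ r
    rw [diagPartL_apply, sub_eq_of_eq_add' (diagPart_add_offPart ε (Q s)).symm]
    exact norm_conj_offPart_le hε (hQ.sobBdd s hs) (hQ.commute s hs) hχ r
  · intro s hs χ hχ r h
    refine (norm_conj_diagPart_second_le hε (hQ.sobBdd s hs) hχ r h).trans (le_of_eq ?_)
    ring

/-- Nothing is discarded, so `η = 0`; the off-diagonal part contributes `ε⁻³` to `K` and `ε⁻¹` to
`L`. -/
theorem IsSolution.norm_sub_strang_le_div (hε : 0 < ε) (hε1 : ε ≤ 1) (hT : 0 < T) (hτ : 0 < τ)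
    (hV : Measurable (Function.uncurry V)) (h : IsSolution ε T V Φ) (hb : PotBound T M V)
    (hQ : PotOp T M C V Q) (hC : 0 ≤ C)
    (hN : ∀ t ∈ Icc 0 T, Sob 2 N (free ε (-t) (ft (Φ t)))) {n : ℕ} (hn : n * τ ≤ T) :
    ‖Φ (n * τ) - strang hV ε τ (Φ 0) n‖ ≤
      2 * M * N * τ ^ 2 + T * ((2 * M ^ 3 + 5 * M ^ 2 + M) * N * τ ^ 2 +
      (M + 1) * τ * ((80 * τ + 104 * (τ / ε)) * (C * ((1 + C) * N))) + 2 * 0 +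
      (4000 * C * N + 1000 * C * N / ε ^ 3) * τ ^ 2 / 2) := by
  have hN0 : 0 ≤ N := (hN 0 ⟨le_rfl, hT.le⟩).nonneg
  refine h.norm_sub_strang_le hε hε1 hT hτ hV hb hQ hC hN
    (Γ := ContinuousLinearMap.id ℂ (SpinorL2 →L[ℂ] SpinorL2)) (fun W => le_rfl) ?_ ?_ ?_ hn
  · intro s hs r h hh χ hχ
    have h1 := norm_conj_diagPart_sub_le hε (hQ.sobBdd s hs) hχ r h
    have h2 := norm_conj_offPart_sub_le hε hε1 (hQ.sobBdd s hs) (hQ.commute s hs) hχ r h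
    rw [conj_free_eq_add (r + h), conj_free_eq_add r, add_sub_add_comm]
    refine (norm_add_le _ _).trans ((add_le_add h1 h2).trans ?_)
    have h3 : 0 ≤ C * ((1 + C) * N) := by positivity
    have h4 : |h| / ε ≤ τ / ε := div_le_div_of_nonneg_right hh hε.le
    calc 80 * C * |h| * ((1 + C) * N) + 104 * C * |h| / ε * ((1 + C) * N) =
        (80 * |h| + 104 * (|h| / ε)) * (C * ((1 + C) * N)) := by ring
      _ ≤ _ := mul_le_mul_of_nonneg_right (by linarith) h3
  · intro s hs χ hχ r
    simp [conj]
  · intro s hs χ hχ r h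
    have h1 := norm_conj_diagPart_second_le hε (hQ.sobBdd s hs) hχ r h
    have h2 := norm_conj_offPart_second_le hε hε1 hC (hQ.sobBdd s hs) (hQ.commute s hs) hχ r h
    rw [ContinuousLinearMap.id_apply, conj_free_eq_add, conj_free_eq_add (r - h),
      conj_free_eq_add r, smul_add, add_add_add_comm, add_sub_add_comm]
    refine (norm_add_le _ _).trans ((add_le_add h1 h2).trans (le_of_eq ?_))
    ring

/-- Both error bounds, with a constant that depends on the regularity of the initial value only. -/
theorem exists_strang_bound (hT : 0 < T) (hV : Measurable (Function.uncurry V))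
    (hA : AssumptionA T 2 0 V) (Φ₀ : SpinorL2) : ∃ A : ℝ, 0 ≤ A ∧ ∀ ε : ℝ, 0 < ε → ε ≤ 1 →
      ∀ Φ : ℝ → SpinorL2, IsSolution ε T V Φ → Φ 0 = Φ₀ → AssumptionB T 2 0 Φ →
      ∀ τ : ℝ, 0 < τ → τ ≤ T → ∀ n : ℕ, n * τ ≤ T →
        ‖Φ (n * τ) - strang hV ε τ Φ₀ n‖ ≤ A * (τ ^ 2 + ε) ∧
        ‖Φ (n * τ) - strang hV ε τ Φ₀ n‖ ≤ A * (τ ^ 2 + τ ^ 2 / ε ^ 3) := by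
  obtain ⟨M, hb⟩ := exists_potBound hT hV hA
  obtain ⟨Q, hQ⟩ := hb.exists_potOp hT
  have hM : 0 ≤ M := hb.nonneg
  set C := 40 * M with hCdef
  have hC : 0 ≤ C := by positivity
  -- The constant is chosen before `ε` and `Φ`, hence from `Φ₀` alone. If `Φ₀` has no finite `H⁴`
  -- norm, no solution satisfies the regularity assumption and any constant will do.
  by_cases hreg : ∃ N₀, Sob 2 N₀ (ft Φ₀)
  · obtain ⟨N₀, hN₀⟩ := hreg
    have hN₀0 := hN₀.nonneg
    set N := 2 * N₀ * Real.exp (2 * C * T) with hNdef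
    have hN : 0 ≤ N := by positivity
    set D := C * ((1 + C) * N) with hDdef
    have hD : 0 ≤ D := by positivity
    set a := 2 * M * N + T * ((2 * M ^ 3 + 5 * M ^ 2 + M) * N) + T * (M + 1) * 80 * D +
      T * 2000 * C * N with hadef
    have ha : 0 ≤ a := by positivity
    set b := T * (M + 1) * T * 16 * D + T * 16 * C * N with hbdef
    have hb0 : 0 ≤ b := by positivity
    set c := T * (M + 1) * 104 * D + T * 500 * C * N with hcdef
    have hc0 : 0 ≤ c := by positivity
    refine ⟨a + b + c, by positivity, fun ε hε hε1 Φ h h0 hB τ hτ hτT n hn => ?_⟩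
    have hsob : ∀ t ∈ Icc 0 T, Sob 2 N (free ε (-t) (ft (Φ t))) := fun t ht =>
      h.sob_interaction hε hε1 hT hC hQ hB (by rwa [h0]) ht
    rw [← h0]
    constructor
    · refine (h.norm_sub_strang_le_add hε hε1 hT hτ hV hb hQ hC hsob hn).trans ?_
      -- The mixed term `τε`, which comes from `L`, is absorbed into `ε` by `τ ≤ T`.
      have h1 : T * (M + 1) * τ * 16 * ε * D ≤ T * (M + 1) * T * 16 * ε * D := by gcongr
      calc _ = a * τ ^ 2 + (T * (M + 1) * τ * 16 * ε * D + T * 16 * C * N * ε) := by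
            rw [hadef]
            ring
        _ ≤ a * τ ^ 2 + (T * (M + 1) * T * 16 * ε * D + T * 16 * C * N * ε) := by linarith
        _ = a * τ ^ 2 + b * ε := by
            rw [hbdef]
            ring
        _ ≤ (a + b + c) * (τ ^ 2 + ε) := by
            have := sq_nonneg τ
            nlinarith [mul_nonneg ha hε.le, mul_nonneg hb0 this, mul_nonneg hc0 this,
              mul_nonneg hc0 hε.le]
    · refine (h.norm_sub_strang_le_div hε hε1 hT hτ hV hb hQ hC hsob hn).trans ?_
      have h2 : 1 / ε ≤ 1 / ε ^ 3 := one_div_le_one_div_of_le (by positivity) (by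
        simpa using pow_le_pow_of_le_one hε.le hε1 (show 1 ≤ 3 by norm_num))
      have h1 : T * (M + 1) * 104 * D * τ ^ 2 * (1 / ε) ≤
          T * (M + 1) * 104 * D * τ ^ 2 * (1 / ε ^ 3) := by gcongr
      calc _ = a * τ ^ 2 + (T * (M + 1) * 104 * D * τ ^ 2 * (1 / ε) +
            T * 500 * C * N * (τ ^ 2 / ε ^ 3)) := by
            rw [hadef]
            ring
        _ ≤ a * τ ^ 2 + (T * (M + 1) * 104 * D * τ ^ 2 * (1 / ε ^ 3) +
            T * 500 * C * N * (τ ^ 2 / ε ^ 3)) := by linarith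
        _ = a * τ ^ 2 + c * (τ ^ 2 / ε ^ 3) := by
            rw [hcdef]
            ring
        _ ≤ (a + b + c) * (τ ^ 2 + τ ^ 2 / ε ^ 3) := by
            have h3 := sq_nonneg τ
            have h4 : 0 ≤ τ ^ 2 / ε ^ 3 := by positivity
            nlinarith [mul_nonneg ha h4, mul_nonneg hb0 h3, mul_nonneg hc0 h3, mul_nonneg hb0 h4]
  · refine ⟨0, le_rfl, fun ε _ _ Φ h h0 hB => ?_⟩
    obtain ⟨B, hB⟩ := hB.exists_sob hT h.1
    exact absurd ⟨B, h0 ▸ hB 0 ⟨le_rfl, hT.le⟩⟩ hreg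

end splitting

/-! ### The uniform bound -/

/-- The two branches cross at `δ = √τ`: below this point the first is at most `√τ`, above it the
second is. -/
theorem min_le_min_sqrt {τ δ : ℝ} (hτ : 0 < τ) (hδ : 0 < δ) (hδ1 : δ ≤ 1) :
    min δ (τ ^ 2 / δ ^ 3) ≤ min (√τ) 1 := by
  have hs := Real.sqrt_pos.2 hτ
  refine le_min ?_ ((min_le_left _ _).trans hδ1)
  rcases le_total δ (√τ) with h | h
  · exact (min_le_left _ _).trans h
  · refine (min_le_right _ _).trans ((div_le_iff₀ (by positivity)).2 ?_)
    calc τ ^ 2 = √τ * √τ ^ 3 := by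
          nth_rewrite 1 [← Real.sq_sqrt hτ.le]
          ring
      _ ≤ √τ * δ ^ 3 := by gcongr

theorem isGreatest_min_sqrt {τ : ℝ} (hτ : 0 < τ) :
    IsGreatest ((fun δ : ℝ => min δ (τ ^ 2 / δ ^ 3)) '' Ioc 0 1) (min (√τ) 1) := by
  have hs := Real.sqrt_pos.2 hτ
  refine ⟨?_, ?_⟩
  · rcases le_total (√τ) 1 with h | h
    · refine ⟨√τ, ⟨hs, h⟩, ?_⟩
      have : τ ^ 2 / √τ ^ 3 = √τ := by
        rw [div_eq_iff (by positivity)]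
        nth_rewrite 1 [← Real.sq_sqrt hτ.le]
        ring
      simp only [this, min_self, min_eq_left h]
    · refine ⟨1, ⟨one_pos, le_rfl⟩, ?_⟩
      have : 1 ≤ τ := Real.one_le_sqrt.1 h
      simp only [one_pow, div_one, min_eq_right h]
      exact min_eq_left (one_le_pow₀ this)
  · rintro _ ⟨δ, hδ, rfl⟩
    exact min_le_min_sqrt hτ hδ.1 hδ.2

/-- Write `τ² = τ^{3/2}√τ` and bound `τ^{3/2}` by `T^{3/2}`. -/
theorem sq_add_min_sqrt_le {τ T : ℝ} (hτ : 0 < τ) (hT : τ ≤ T) :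
    τ ^ 2 + min (√τ) 1 ≤ (T * √T + 1) * √τ := by
  have h1 : τ ^ 2 = τ * √τ * √τ := by rw [mul_assoc, Real.mul_self_sqrt hτ.le, sq]
  have h2 : τ * √τ ≤ T * √T := by
    have := Real.sqrt_le_sqrt hT
    gcongr
    exact hτ.le.trans hT
  calc τ ^ 2 + min (√τ) 1 ≤ τ * √τ * √τ + √τ := by rw [h1]; linarith [min_le_left (√τ) 1]
    _ = (τ * √τ + 1) * √τ := by ring
    _ ≤ _ := by gcongr

end Dirac

theorem theorem2p2 (T : ℝ) (hT : 0 < T) (V : ℝ → ℝ → ℝ)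
    (hV : Measurable (Function.uncurry V)) (hA : Dirac.AssumptionA T 2 0 V)
    (Φ₀ : Dirac.SpinorL2) :
    ∃ C : ℝ, 0 < C ∧
      ∀ ε : ℝ, 0 < ε → ε ≤ 1 →
      ∀ Φ : ℝ → Dirac.SpinorL2, Dirac.IsSolution ε T V Φ → Φ 0 = Φ₀ → Dirac.AssumptionB T 2 0 Φ →
      ∀ τ : ℝ, 0 < τ → ∀ n : ℕ, n * τ ≤ T →
        ‖Φ (n * τ) - Dirac.strang hV ε τ Φ₀ n‖ ≤ C * (τ ^ 2 + ε) ∧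
        ‖Φ (n * τ) - Dirac.strang hV ε τ Φ₀ n‖ ≤ C * (τ ^ 2 + τ ^ 2 / ε ^ 3) ∧
        (∃ μ : ℝ, IsGreatest ((fun δ : ℝ => min δ (τ ^ 2 / δ ^ 3)) '' Set.Ioc 0 1) μ ∧
          ‖Φ (n * τ) - Dirac.strang hV ε τ Φ₀ n‖ ≤ C * (τ ^ 2 + μ) ∧
          (τ ≤ T → τ ^ 2 + μ ≤ C * √τ)) ∧
        ‖Φ (n * τ) - Dirac.strang hV ε τ Φ₀ n‖ ≤ C * √τ := by
  obtain ⟨A, hA0, hbound⟩ := Dirac.exists_strang_bound hT hV hA Φ₀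
  have hD : 1 ≤ T * √T + 1 := le_add_of_nonneg_left (by positivity)
  have hC0 : 0 < (A + 1) * (T * √T + 1) := by positivity
  have hAC : A ≤ (A + 1) * (T * √T + 1) := by nlinarith
  have hDC : T * √T + 1 ≤ (A + 1) * (T * √T + 1) := by nlinarith
  refine ⟨(A + 1) * (T * √T + 1), hC0, fun ε hε hε1 Φ h h0 hB τ hτ n hn => ?_⟩
  have hμ : 0 ≤ min (√τ) 1 := by positivity
  have hmax := Dirac.isGreatest_min_sqrt hτ
  have hlast : τ ≤ T → τ ^ 2 + min (√τ) 1 ≤ (A + 1) * (T * √T + 1) * √τ := fun hτT =>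
    (Dirac.sq_add_min_sqrt_le hτ hτT).trans (mul_le_mul_of_nonneg_right hDC (Real.sqrt_nonneg τ))
  -- For `n = 0` the error vanishes, whatever `τ` is. For `n ≥ 1` the condition `nτ ≤ T` forces `τ ≤
  -- T`, without which `τ²` is not controlled by `√τ`.
  rcases Nat.eq_zero_or_pos n with rfl | hn0
  · have he : ‖Φ ((0 : ℕ) * τ) - Dirac.strang hV ε τ Φ₀ 0‖ = 0 := by
      rw [Nat.cast_zero, zero_mul, h0, Dirac.strang, sub_self, norm_zero]
    rw [he]
    exact ⟨by positivity, by positivity, ⟨_, hmax, by positivity, hlast⟩, by positivity⟩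
  · have hτT : τ ≤ T := by
      have : (1 : ℝ) ≤ n := by exact_mod_cast hn0
      nlinarith
    obtain ⟨h1, h2⟩ := hbound ε hε hε1 Φ h h0 hB τ hτ hτT n hn
    -- The actual `ε` is one of the admissible `δ`, so the better of the two bounds is at most the
    -- maximum over `δ`.
    have h3 : ‖Φ (n * τ) - Dirac.strang hV ε τ Φ₀ n‖ ≤ A * (τ ^ 2 + min (√τ) 1) := by
      have h4 : ‖Φ (n * τ) - Dirac.strang hV ε τ Φ₀ n‖ ≤ A * (τ ^ 2 + min ε (τ ^ 2 / ε ^ 3)) := by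
        rcases min_choice ε (τ ^ 2 / ε ^ 3) with h5 | h5
        · rwa [h5]
        · rwa [h5]
      refine h4.trans (mul_le_mul_of_nonneg_left ?_ hA0)
      have := Dirac.min_le_min_sqrt hτ hε hε1
      linarith
    have hp : 0 ≤ τ ^ 2 + min (√τ) 1 := by positivity
    refine ⟨h1.trans (mul_le_mul_of_nonneg_right hAC (by positivity)),
      h2.trans (mul_le_mul_of_nonneg_right hAC (by positivity)),
      ⟨_, hmax, h3.trans (mul_le_mul_of_nonneg_right hAC hp), hlast⟩, ?_⟩
    calc _ ≤ A * (τ ^ 2 + min (√τ) 1) := h3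
      _ ≤ (A + 1) * ((T * √T + 1) * √τ) :=
        mul_le_mul (by linarith) (Dirac.sq_add_min_sqrt_le hτ hτT) hp (by linarith)
      _ = _ := by ring
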